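/- \textbf{Lemma (volume growth).} Let $M$ be a complete connected smooth Riemannian surface (without boundary), let $p_0\in M$, and let $\kappa\colon M\to\mathbb{R}$ be its Gaussian curvature. Suppose that there is a function $k\colon[0,\infty)\to[0,\infty)$ of class $C^2$ with $$\int_0^\infty s\,k(s)\,ds<\infty$$ such that $$0\ \ge\ \kappa(p)\ \ge\ -k(\operatorname{dist}_M(p,p_0))\qquad\text{for all } p\in M .$$ Then the geodesic balls of $M$ with a fixed center have at most quadratic area growth: for every $q\in M$ there are constants $c>0$ and $r_0>0$ such that $$\operatorname{vol}_M(\bar B_r(q))\ \le\ c\,r^2\qquad\text{for all } r\ge r_0,$$ where $\bar B_r(q)=\{p\in M:\operatorname{dist}_M(p,q)\le r\}$ and $\operatorname{vol}_M$ is the Riemannian area. -/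

import Mathlib

open Set MeasureTheory Bundle
open scoped Manifold ContDiff ENNReal

noncomputable section

namespace RiemannianSurface

/-- The coordinate plane `ℝ²` with its Euclidean structure. -/
abbrev Plane : Type := EuclideanSpace ℝ (Fin 2)

/-- The `i`-th coordinate vector of the plane. -/
def stdVec (i : Fin 2) : Plane := EuclideanSpace.single i 1

/-- The partial derivative `∂ᵢ f` at `y` of a function on the plane. -/
def partialDeriv (i : Fin 2) (f : Plane → ℝ) (y : Plane) : ℝ := fderiv ℝ f y (stdVec i)

/-- The Christoffel symbols `Γˡᵢⱼ = ½ ∑ₘ gˡᵐ (∂ᵢ gⱼₘ + ∂ⱼ gᵢₘ - ∂ₘ gᵢⱼ)` of a metric tensor `g`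
given by its coefficient matrices. -/
def christoffel (g : Plane → Matrix (Fin 2) (Fin 2) ℝ) (l i j : Fin 2) (y : Plane) : ℝ :=
  2⁻¹ * ∑ m, (g y)⁻¹ l m *
    (partialDeriv i (fun z => g z j m) y + partialDeriv j (fun z => g z i m) y
      - partialDeriv m (fun z => g z i j) y)

/-- The coefficients `Rˡᵢⱼₖ` of the Riemann curvature tensor,
`R(∂ᵢ, ∂ⱼ) ∂ₖ = ∇ᵢ ∇ⱼ ∂ₖ - ∇ⱼ ∇ᵢ ∂ₖ = ∑ₗ Rˡᵢⱼₖ ∂ₗ`. -/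
def riemannTensor (g : Plane → Matrix (Fin 2) (Fin 2) ℝ) (l i j k : Fin 2) (y : Plane) : ℝ :=
  partialDeriv i (christoffel g l j k) y - partialDeriv j (christoffel g l i k) y
    + ∑ m, (christoffel g l i m y * christoffel g m j k y
      - christoffel g l j m y * christoffel g m i k y)

/-- The Gaussian curvature `⟨R(∂₁, ∂₂) ∂₂, ∂₁⟩ / (g₁₁ g₂₂ - g₁₂²)` of a metric tensor in
coordinates. -/
def coordGaussianCurvature (g : Plane → Matrix (Fin 2) (Fin 2) ℝ) (y : Plane) : ℝ :=
  (∑ l, riemannTensor g l 0 1 1 y * g y l 0) / (g y).det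

variable {M : Type*} [TopologicalSpace M] [ChartedSpace Plane M]

/-- The coordinate vector field `∂ᵢ = d(φ⁻¹)_y (eᵢ)` of the chart `φ` of `M` at `q`, at the point
with coordinates `y`. -/
def coordVec (q : M) (i : Fin 2) (y : Plane) : TangentSpace (𝓡 2) ((extChartAt (𝓡 2) q).symm y) :=
  let e : TangentSpace (𝓡 2) y := stdVec i
  mfderiv (𝓡 2) (𝓡 2) (extChartAt (𝓡 2) q).symm y e

variable [RiemannianBundle (fun x : M => TangentSpace (𝓡 2) x)]

/-- The coefficients `gᵢⱼ(y) = ⟨∂ᵢ, ∂ⱼ⟩` of the Riemannian metric of the surface `M` in the chart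
at `q`, as functions of the coordinates `y`. -/
def metricCoeff (q : M) (y : Plane) : Matrix (Fin 2) (Fin 2) ℝ :=
  Matrix.of fun i j => inner ℝ (coordVec q i y) (coordVec q j y)

/-- The Gaussian curvature of the surface `M` at `p`, computed in the chart at `p`. -/
def gaussianCurvature (p : M) : ℝ :=
  coordGaussianCurvature (metricCoeff p) (extChartAt (𝓡 2) p p)

variable [MeasurableSpace M]

/-- The Riemannian area of the domain of the chart at `q`: the measure `√(det gᵢⱼ) dy₁ dy₂` on the
range of the chart, transported to `M` (and zero outside the domain of the chart). -/
def chartArea (q : M) : Measure M :=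
  ((volume.restrict (extChartAt (𝓡 2) q).target).withDensity
    (fun y => ENNReal.ofReal (Real.sqrt (metricCoeff q y).det))).map (extChartAt (𝓡 2) q).symm

theorem chartArea_apply [BorelSpace M] (q : M) {A : Set M} (hA : MeasurableSet A) :
    chartArea q A =
      ∫⁻ y in (extChartAt (𝓡 2) q).target ∩ (extChartAt (𝓡 2) q).symm ⁻¹' A,
        ENNReal.ofReal (Real.sqrt (metricCoeff q y).det) := by
  have ht : MeasurableSet (extChartAt (𝓡 2) q).target :=
    (isOpen_extChartAt_target q).measurableSet
  have hm : AEMeasurable (extChartAt (𝓡 2) q).symm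
      (volume.restrict (extChartAt (𝓡 2) q).target) :=
    (continuousOn_extChartAt_symm q).aemeasurable ht
  have hm' := hm.mono_ac (withDensity_absolutelyContinuous
    (volume.restrict (extChartAt (𝓡 2) q).target)
    (fun y => ENNReal.ofReal (Real.sqrt (metricCoeff q y).det)))
  have hms : NullMeasurableSet ((extChartAt (𝓡 2) q).symm ⁻¹' A)
      (volume.restrict (extChartAt (𝓡 2) q).target) := hm.nullMeasurableSet_preimage hA
  rw [chartArea, Measure.map_apply_of_aemeasurable hm' hA, withDensity_apply', inter_comm,
    Measure.restrict_restrict₀ hms]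

variable (M) in
/-- The Riemannian area measure of the surface `M`. The measures `chartArea q` agree on the
overlaps of the charts; their supremum, the least measure that dominates all of them, is the
measure that they define together: on the domain of each chart it is `√(det gᵢⱼ) dy₁ dy₂`. -/
def area : Measure M := ⨆ q : M, chartArea q

end RiemannianSurface

end

/-! The area is bounded in geodesic polar coordinates around `p₀`. Along a unit speed radial
geodesic, let `b` be the component, normal to the velocity, of the Jacobi field obtained by turning
the initial direction. Then `b'' + κ b = 0`, `b(0) = 0`, `|b'(0)| ≤ 1`, and `|b(t)|` is the area
density of the polar coordinates `(t, θ)`. On a minimizing geodesic the point at time `s` has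
distance `s` from `p₀`, so the hypothesis becomes `|κ| ≤ k(s)` along it. If `G` majorises `|b'|`,
then `|b| ≤ s G` and `G' ≤ s k(s) G`, whence `|b(t)| ≤ t exp(∫ s k ds) ≤ t e^K` with `K` the total
integral. Integration over `[0, R] × [-π, π]` bounds the area of the ball of radius `R` by a
multiple of `R²`, and for large `r` the ball of radius `r` about `q` lies in the ball of radius `2r`
about `p₀`.

Only an upper bound is wanted, so polar coordinates need not be injective and neither the cut locus
nor conjugate points play a role: it suffices that minimizing geodesics from `p₀` reach every point,
and that the area of an image is at most the integral of the Jacobian.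

The ingredients are built from coordinates. `exists_flow` differentiates the flow of the geodesic
equation in the initial value. The transformation laws in `IsIsometryOn` make geodesics, curvature
and Jacobi fields independent of the chart. The Gauss lemma gives local minimizers
(`exists_local_minimizer`), and these are continued to `exists_minimizer`, which is Hopf–Rinow. The
scalar estimate is `abs_le_of_jacobi`; its hypotheses and conclusions at the two end times have the
same form, so it can be iterated from chart to chart along a geodesic (`exists_stateFamily`). This
leads to `exists_polar_chart`, a local statement about the Jacobian, and
`measure_biUnion_le_of_locally` glues the local area bounds to `area_closedBall_le`. -/

namespace RiemannianSurface

set_option maxSynthPendingDepth 3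

/-! ### Differentiability of local flows in the initial value. -/

section Flow

open Filter Metric
open scoped Topology NNReal

variable {E : Type*} [NormedAddCommGroup E] [NormedSpace ℝ E]

/-- Second order estimate for the difference of two trajectories of a `C^{1,1}` vector field. -/
theorem norm_trajectory_sub_sub_le {f : E → E} {f' : E → E →L[ℝ] E} {s : Set E}
    (hs : Convex ℝ s) {K C : ℝ≥0} (hf : ∀ x ∈ s, HasFDerivWithinAt f (f' x) s x)
    (hK : ∀ x ∈ s, ‖f' x‖ ≤ K) (hC : LipschitzOnWith C f' s)
    {x y : ℝ → E} {A : ℝ → E →L[ℝ] E} {T : ℝ}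
    (hx : ∀ t ∈ Icc 0 T, HasDerivWithinAt x (f (x t)) (Icc 0 T) t) (hxs : ∀ t ∈ Icc 0 T, x t ∈ s)
    (hy : ∀ t ∈ Icc 0 T, HasDerivWithinAt y (f (y t)) (Icc 0 T) t) (hys : ∀ t ∈ Icc 0 T, y t ∈ s)
    (hA : ∀ t ∈ Icc 0 T, HasDerivWithinAt A ((f' (x t)).comp (A t)) (Icc 0 T) t)
    (hA0 : A 0 = ContinuousLinearMap.id ℝ E) :
    ∀ t ∈ Icc 0 T, ‖y t - x t - A t (y 0 - x 0)‖ ≤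
      gronwallBound 0 K (C * (Real.exp (K * T)) ^ 2 * ‖y 0 - x 0‖ ^ 2) t := by
  have hLip : LipschitzOnWith K f s :=
    hs.lipschitzOnWith_of_nnnorm_hasFDerivWithin_le hf (fun x hx => by exact_mod_cast hK x hx)
  have mono : ∀ {z : ℝ → E} {z' : E} {t : ℝ}, t ∈ Ico 0 T → HasDerivWithinAt z z' (Icc 0 T) t →
      HasDerivWithinAt z z' (Ici t) t := fun ht h =>
    h.mono_of_mem_nhdsWithin (mem_of_superset (Icc_mem_nhdsGE ht.2) (Icc_subset_Icc_left ht.1))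
  have monoA : ∀ {z : ℝ → E →L[ℝ] E} {z' : E →L[ℝ] E} {t : ℝ}, t ∈ Ico 0 T →
      HasDerivWithinAt z z' (Icc 0 T) t → HasDerivWithinAt z z' (Ici t) t := fun ht h =>
    h.mono_of_mem_nhdsWithin (mem_of_superset (Icc_mem_nhdsGE ht.2) (Icc_subset_Icc_left ht.1))
  have hd : ∀ t ∈ Icc 0 T, ‖y t - x t‖ ≤ Real.exp (K * T) * ‖y 0 - x 0‖ := by
    intro t ht
    have h := dist_le_of_trajectories_ODE_of_mem (v := fun _ => f) (s := fun _ => s) (K := K)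
      (f := y) (g := x) (a := 0) (b := T) (δ := ‖y 0 - x 0‖) (fun _ _ => hLip)
      (fun t ht => (hy t ht).continuousWithinAt) (fun t ht => mono ht (hy t (Ico_subset_Icc_self ht)))
      (fun t ht => hys t (Ico_subset_Icc_self ht)) (fun t ht => (hx t ht).continuousWithinAt)
      (fun t ht => mono ht (hx t (Ico_subset_Icc_self ht)))
      (fun t ht => hxs t (Ico_subset_Icc_self ht)) (dist_eq_norm _ _).le t ht
    rw [dist_eq_norm, sub_zero, mul_comm] at h
    refine h.trans ?_
    gcongr
    exact ht.2
  have key := norm_le_gronwallBound_of_norm_deriv_right_le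
    (f := fun t => y t - x t - A t (y 0 - x 0))
    (f' := fun t => f (y t) - f (x t) - f' (x t) (A t (y 0 - x 0))) (δ := 0) (K := K)
    (ε := C * (Real.exp (K * T)) ^ 2 * ‖y 0 - x 0‖ ^ 2) (a := 0) (b := T) ?_ ?_ ?_ ?_
  · intro t ht
    simpa using key t ht
  · intro t ht
    exact ((hy t ht).continuousWithinAt.sub (hx t ht).continuousWithinAt).sub
      ((hA t ht).continuousWithinAt.clm_apply continuousWithinAt_const)
  · intro t ht
    have ht' := Ico_subset_Icc_self ht
    have := (monoA ht (hA t ht')).clm_apply (hasDerivWithinAt_const t _ (y 0 - x 0))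
    simpa using ((mono ht (hy t ht')).fun_sub (mono ht (hx t ht'))).fun_sub this
  · simp [hA0]
  · intro t ht
    have ht' := Ico_subset_Icc_self ht
    have hseg : segment ℝ (x t) (y t) ⊆ s := hs.segment_subset (hxs t ht') (hys t ht')
    have h2 : ‖f (y t) - f (x t) - f' (x t) (y t - x t)‖ ≤ C * ‖y t - x t‖ * ‖y t - x t‖ := by
      refine (convex_segment (x t) (y t)).norm_image_sub_le_of_norm_hasFDerivWithin_le'
        (f' := f') (fun z hz => (hf z (hseg hz)).mono hseg) (fun z hz => ?_)
        (left_mem_segment ℝ _ _) (right_mem_segment ℝ _ _)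
      refine (hC.norm_sub_le (hseg hz) (hxs t ht')).trans ?_
      gcongr
      exact norm_sub_le_of_mem_segment hz
    -- The error solves the linearised equation up to the Taylor remainder of `f` at `x t`, which is
    -- quadratic in `y t - x t`, hence by `hd` quadratic in `y 0 - x 0`. Grönwall then applies with
    -- zero initial error.
    have e1 : f (y t) - f (x t) - f' (x t) (A t (y 0 - x 0)) =
        f' (x t) (y t - x t - A t (y 0 - x 0)) +
          (f (y t) - f (x t) - f' (x t) (y t - x t)) := by
      simp only [map_sub]; abel
    rw [e1]
    refine (norm_add_le _ _).trans ?_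
    gcongr
    · exact (ContinuousLinearMap.le_opNorm _ _).trans (by gcongr; exact hK _ (hxs t ht'))
    · refine h2.trans ?_
      have := hd t ht'
      calc C * ‖y t - x t‖ * ‖y t - x t‖ = C * ‖y t - x t‖ ^ 2 := by ring
        _ ≤ C * (Real.exp (K * T) * ‖y 0 - x 0‖) ^ 2 := by gcongr
        _ = _ := by ring

theorem gronwallBound_zero_mul (K ε x : ℝ) :
    gronwallBound 0 K ε x = ε * gronwallBound 0 K 1 x := by
  by_cases h : K = 0
  · simp [h, gronwallBound_K0]
  · simp [gronwallBound_of_K_ne_0 h]; ring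

/-- The local flow of a `C²` vector field, with its derivative with respect to the initial value,
which solves the linearised equation. -/
theorem exists_flow [CompleteSpace E] {f : E → E} {z₀ : E} (hf : ContDiffAt ℝ 2 f z₀) {Ω : Set E}
    (hΩ : Ω ∈ 𝓝 z₀) :
    ∃ r > 0, ∃ ε > 0, ∃ (Φ : E → ℝ → E) (A : E → ℝ → E →L[ℝ] E),
      (∀ z ∈ ball z₀ r, Φ z 0 = z ∧ A z 0 = ContinuousLinearMap.id ℝ E ∧
        ∀ t ∈ Ioo (-ε) ε, Φ z t ∈ Ω ∧ HasDerivAt (Φ z) (f (Φ z t)) t ∧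
          HasDerivAt (A z) ((fderiv ℝ f (Φ z t)).comp (A z t)) t) ∧
      ∀ z ∈ ball z₀ r, ∀ t ∈ Ioo 0 ε,
        ContDiffAt ℝ 1 (fun p : E × ℝ => Φ p.1 p.2) (z, t) ∧
        HasStrictFDerivAt (fun p : E × ℝ => Φ p.1 p.2)
          ((A z t).coprod (ContinuousLinearMap.toSpanSingleton ℝ (f (Φ z t)))) (z, t) := by
  set I := ContinuousLinearMap.id ℝ E
  -- a convex neighbourhood with good bounds
  have hf1 : ContDiffAt ℝ 1 (fderiv ℝ f) z₀ := hf.fderiv_right (by norm_num)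
  obtain ⟨C, s₁, hs₁, hC⟩ := hf1.exists_lipschitzOnWith
  have hev : ∀ᶠ z in 𝓝 z₀, ContDiffAt ℝ 2 f z := hf.eventually (by norm_num)
  have hbd : ∀ᶠ z in 𝓝 z₀, ‖fderiv ℝ f z‖ < ‖fderiv ℝ f z₀‖ + 1 :=
    hf1.continuousAt.norm.eventually (gt_mem_nhds (lt_add_one _))
  obtain ⟨ρ, hρ, hB⟩ := Metric.eventually_nhds_iff_ball.1
    ((hev.and hbd).and ((eventually_mem_set.2 hs₁).and (eventually_mem_set.2 hΩ)))
  set B := ball z₀ ρ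
  set K : ℝ≥0 := ⟨‖fderiv ℝ f z₀‖ + 1, by positivity⟩
  have hfd : ∀ z ∈ B, HasFDerivAt f (fderiv ℝ f z) z := fun z hz =>
    ((hB z hz).1.1.differentiableAt (by norm_num)).hasFDerivAt
  have hKB : ∀ z ∈ B, ‖fderiv ℝ f z‖ ≤ K := fun z hz => (hB z hz).1.2.le
  have hCB : LipschitzOnWith C (fderiv ℝ f) B := hC.mono fun z hz => (hB z hz).2.1
  -- the extended field
  let F : E × (E →L[ℝ] E) → E × (E →L[ℝ] E) := fun p => (f p.1, (fderiv ℝ f p.1).comp p.2)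
  have hF : ContDiffAt ℝ 1 F (z₀, I) := by
    refine ContDiffAt.prodMk ?_ ?_
    · exact (hf.of_le (by norm_num)).comp (z₀, I) contDiffAt_fst
    · exact (hf1.comp (z₀, I) contDiffAt_fst).clm_comp contDiffAt_snd
  -- Solving the extended system from `(z, I)` yields the flow together with the candidate for its
  -- derivative, both continuous in `(z, t)`. That `F` is `C¹` is where two derivatives of `f` are
  -- used.
  obtain ⟨ε₁, hε₁, a, r₁, L, K', hr₁, hPL⟩ := IsPicardLindelof.of_contDiffAt_one hF
  obtain ⟨α, hα, hαc⟩ :=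
    (hPL 0).exists_forall_mem_closedBall_eq_hasDerivWithinAt_continuousOn
  simp only [zero_sub, zero_add] at hα hαc
  have hmem : ∀ z ∈ ball z₀ (r₁ : ℝ), (z, I) ∈ closedBall (z₀, I) (r₁ : ℝ) := by
    intro z hz
    rw [mem_closedBall, Prod.dist_eq]
    simpa using (mem_ball.1 hz).le
  have hcont0 : ContinuousOn (fun p : E × ℝ => α ((p.1, I), p.2))
      (ball z₀ (r₁ : ℝ) ×ˢ Ioo (-ε₁) ε₁) := by
    refine hαc.comp (by fun_prop) ?_
    rintro ⟨z, t⟩ ⟨hz, ht⟩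
    exact ⟨hmem z hz, Ioo_subset_Icc_self ht⟩
  have hat : ContinuousAt (fun p : E × ℝ => α ((p.1, I), p.2)) (z₀, 0) :=
    hcont0.continuousAt ((isOpen_ball.prod isOpen_Ioo).mem_nhds
      ⟨mem_ball_self hr₁, by simpa using hε₁, by simpa using hε₁⟩)
  have hz0 : α ((z₀, I), 0) = (z₀, I) := (hα (z₀, I) (mem_closedBall_self r₁.2)).1
  have hnear : ∀ᶠ p : E × ℝ in 𝓝 (z₀, 0), (α ((p.1, I), p.2)).1 ∈ B := by
    refine hat.fst.eventually ?_
    simp only [hz0]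
    exact ball_mem_nhds _ hρ
  rw [nhds_prod_eq, eventually_prod_iff] at hnear
  obtain ⟨pa, hpa, pb, hpb, hab⟩ := hnear
  obtain ⟨r₂, hr₂, hpa⟩ := Metric.eventually_nhds_iff_ball.1 hpa
  obtain ⟨ε₂, hε₂, hpb⟩ := Metric.eventually_nhds_iff_ball.1 hpb
  set r := min (r₁ : ℝ) r₂
  set ε := min ε₁ ε₂
  have hr : 0 < r := lt_min (by exact_mod_cast hr₁) hr₂
  have hε : 0 < ε := lt_min hε₁ hε₂
  let Φ : E → ℝ → E := fun z t => (α ((z, I), t)).1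
  let A : E → ℝ → E →L[ℝ] E := fun z t => (α ((z, I), t)).2
  have hΦB : ∀ z ∈ ball z₀ r, ∀ t ∈ Ioo (-ε) ε, Φ z t ∈ B := by
    intro z hz t ht
    refine hab (hpa z (ball_subset_ball (min_le_right _ _) hz)) (hpb t ?_)
    rw [Real.ball_eq_Ioo]
    exact ⟨by linarith [ht.1, min_le_right ε₁ ε₂], by linarith [ht.2, min_le_right ε₁ ε₂]⟩
  have h1 : ∀ z ∈ ball z₀ r, Φ z 0 = z ∧ A z 0 = I := by
    intro z hz
    have := (hα (z, I) (hmem z (ball_subset_ball (min_le_left _ _) hz))).1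
    simp [Φ, A, this]
  have h2 : ∀ z ∈ ball z₀ r, ∀ t ∈ Ioo (-ε) ε, HasDerivAt (Φ z) (f (Φ z t)) t ∧
      HasDerivAt (A z) ((fderiv ℝ f (Φ z t)).comp (A z t)) t := by
    intro z hz t ht
    have ht' : t ∈ Ioo (-ε₁) ε₁ :=
      ⟨by linarith [ht.1, min_le_left ε₁ ε₂], by linarith [ht.2, min_le_left ε₁ ε₂]⟩
    have h := ((hα (z, I) (hmem z (ball_subset_ball (min_le_left _ _) hz))).2 t
      (Ioo_subset_Icc_self ht')).hasDerivAt (Icc_mem_nhds ht'.1 ht'.2)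
    exact ⟨h.fst, h.snd⟩
  have hcont : ContinuousOn (fun p : E × ℝ => α ((p.1, I), p.2)) (ball z₀ r ×ˢ Ioo (-ε) ε) :=
    hcont0.mono (prod_mono (ball_subset_ball (min_le_left _ _))
      (Ioo_subset_Ioo (neg_le_neg (min_le_left _ _)) (min_le_left _ _)))
  -- derivative with respect to the initial value
  have h3 : ∀ z ∈ ball z₀ r, ∀ t ∈ Ioo 0 ε, HasFDerivAt (fun w => Φ w t) (A z t) z := by
    intro z hz t ht
    have hsub : Icc 0 t ⊆ Ioo (-ε) ε := fun u hu => ⟨by linarith [hu.1], by linarith [hu.2, ht.2]⟩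
    rw [hasFDerivAt_iff_isLittleO]
    have hO : (fun w => Φ w t - Φ z t - A z t (w - z)) =O[𝓝 z] fun w => ‖w - z‖ ^ 2 := by
      refine Asymptotics.IsBigO.of_bound
        (C * (Real.exp (K * t)) ^ 2 * gronwallBound 0 K 1 t) ?_
      filter_upwards [isOpen_ball.mem_nhds hz] with w hw
      have := norm_trajectory_sub_sub_le (convex_ball z₀ ρ) (K := K) (C := C)
        (fun x hx => (hfd x hx).hasFDerivWithinAt) hKB hCB (x := Φ z) (y := Φ w) (A := A z) (T := t)
        (fun u hu => (h2 z hz u (hsub hu)).1.hasDerivWithinAt) (fun u hu => hΦB z hz u (hsub hu))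
        (fun u hu => (h2 w hw u (hsub hu)).1.hasDerivWithinAt) (fun u hu => hΦB w hw u (hsub hu))
        (fun u hu => (h2 z hz u (hsub hu)).2.hasDerivWithinAt) (h1 z hz).2 t ⟨ht.1.le, le_rfl⟩
      rw [(h1 z hz).1, (h1 w hw).1, gronwallBound_zero_mul] at this
      refine this.trans_eq ?_
      rw [norm_pow, norm_norm]
      ring
    refine hO.trans_isLittleO ?_
    have : (fun w : E => ‖w - z‖ ^ 2) =o[𝓝 z] fun w => ‖w - z‖ ^ 1 := by
      have h0 : Tendsto (fun w => w - z) (𝓝 z) (𝓝 0) := by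
        simpa using (continuous_id.sub continuous_const).tendsto' (f := fun w => w - z) z 0 (by simp)
      exact (Asymptotics.isLittleO_norm_pow_norm_pow (by norm_num : 1 < 2)).comp_tendsto h0
    simpa only [pow_one] using (this.congr_right fun w => pow_one _).of_norm_right
  have hopen : IsOpen (ball z₀ r ×ˢ Ioo 0 ε) := isOpen_ball.prod isOpen_Ioo
  have hcont' := hcont.mono (prod_mono_right (s := ball z₀ r)
    (Ioo_subset_Ioo_left (by linarith : -ε ≤ 0)))
  have hsub : Ioo 0 ε ⊆ Ioo (-ε) ε := Ioo_subset_Ioo_left (by linarith)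
  have hcf : ContinuousOn (fun p : E × ℝ => f (Φ p.1 p.2)) (ball z₀ r ×ˢ Ioo 0 ε) := by
    have hfB : ContinuousOn f B := fun z hz => (hfd z hz).continuousAt.continuousWithinAt
    exact hfB.comp hcont'.fst fun p hp => hΦB p.1 hp.1 p.2 (hsub hp.2)
  have hcs : ContinuousOn (fun p : E × ℝ => ContinuousLinearMap.toSpanSingleton ℝ (f (Φ p.1 p.2)))
      (ball z₀ r ×ˢ Ioo 0 ε) :=
    (ContinuousLinearMap.toSpanSingletonCLE (𝕜 := ℝ) (E := E)).continuous.comp_continuousOn hcf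
  have h4 : ∀ p ∈ ball z₀ r ×ˢ Ioo 0 ε, HasStrictFDerivAt (fun p : E × ℝ => Φ p.1 p.2)
      ((A p.1 p.2).coprod (ContinuousLinearMap.toSpanSingleton ℝ (f (Φ p.1 p.2)))) p := by
    intro p hp
    -- Both partial derivatives exist on an open set and are continuous, so the flow is jointly
    -- differentiable. Times are positive because the Grönwall estimate behind `h3` runs forward
    -- only.
    refine hasStrictFDerivAt_uncurry_coprod (f := Φ) (f₁ := A)
      (f₂ := fun z t => ContinuousLinearMap.toSpanSingleton ℝ (f (Φ z t))) ?_ ?_ ?_ ?_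
    · filter_upwards [hopen.mem_nhds hp] with v hv using h3 v.1 hv.1 v.2 hv.2
    · filter_upwards [hopen.mem_nhds hp] with v hv
      exact (h2 v.1 hv.1 v.2 (hsub hv.2)).1.hasFDerivAt
    · exact hcont'.snd.continuousAt (hopen.mem_nhds hp)
    · exact hcs.continuousAt (hopen.mem_nhds hp)
  refine ⟨r, hr, ε, hε, Φ, A, fun z hz => ⟨(h1 z hz).1, (h1 z hz).2, fun t ht =>
    ⟨(hB _ (hΦB z hz t ht)).2.2, h2 z hz t ht⟩⟩, fun z hz t ht => ⟨?_, h4 (z, t) ⟨hz, ht⟩⟩⟩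
  rw [contDiffAt_one_iff]
  refine ⟨_, _, hopen.mem_nhds ⟨hz, ht⟩, ?_, fun p hp => (h4 p hp).hasFDerivAt⟩
  have : ContinuousOn (fun p : E × ℝ => (A p.1 p.2,
      ContinuousLinearMap.toSpanSingleton ℝ (f (Φ p.1 p.2)))) (ball z₀ r ×ˢ Ioo 0 ε) :=
    hcont'.snd.prodMk hcs
  exact (ContinuousLinearMap.coprodEquivL (S := ℝ) (𝕜 := ℝ) (E := E) (F := ℝ) (G := E)).continuous.comp_continuousOn this

end Flow

/-! ### Christoffel symbols, curvature and their behaviour under isometries. -/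

section LeviCivita

open Filter
open scoped Topology

variable {V : Type*} [NormedAddCommGroup V] [NormedSpace ℝ V]

/-- `Γ` is the field of Christoffel symbols of the Riemannian metric `g` on the open set `Ω`. -/
structure IsLeviCivita (g : V → V →L[ℝ] V →L[ℝ] ℝ) (Γ : V → V →L[ℝ] V →L[ℝ] V) (Ω : Set V) :
    Prop where
  isOpen : IsOpen Ω
  contDiffOn_metric : ContDiffOn ℝ ∞ g Ω
  contDiffOn_symbol : ContDiffOn ℝ ∞ Γ Ω
  symm : ∀ x ∈ Ω, ∀ u v, g x u v = g x v u
  pos : ∀ x ∈ Ω, ∀ u, u ≠ 0 → 0 < g x u u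
  koszul : ∀ x ∈ Ω, ∀ u v w,
    2 * g x (Γ x u v) w = fderiv ℝ g x u v w + fderiv ℝ g x v u w - fderiv ℝ g x w u v

/-- The Riemann tensor `R(u, v) w` of Christoffel symbols. -/
noncomputable def curvatureTensor (Γ : V → V →L[ℝ] V →L[ℝ] V) (x u v w : V) : V :=
  fderiv ℝ Γ x u v w - fderiv ℝ Γ x v u w + Γ x u (Γ x v w) - Γ x v (Γ x u w)

/-- The vector field of the geodesic equation. -/
noncomputable def spray (Γ : V → V →L[ℝ] V →L[ℝ] V) (p : V × V) : V × V := (p.2, -Γ p.1 p.2 p.2)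

namespace IsLeviCivita

variable {g : V → V →L[ℝ] V →L[ℝ] ℝ} {Γ : V → V →L[ℝ] V →L[ℝ] V} {Ω : Set V}
  (h : IsLeviCivita g Γ Ω) {x : V}

include h

theorem contDiffAt_metric (hx : x ∈ Ω) : ContDiffAt ℝ ∞ g x :=
  h.contDiffOn_metric.contDiffAt (h.isOpen.mem_nhds hx)

theorem contDiffAt_symbol (hx : x ∈ Ω) : ContDiffAt ℝ ∞ Γ x :=
  h.contDiffOn_symbol.contDiffAt (h.isOpen.mem_nhds hx)

theorem hasFDerivAt_metric (hx : x ∈ Ω) : HasFDerivAt g (fderiv ℝ g x) x :=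
  ((h.contDiffAt_metric hx).differentiableAt (by simp)).hasFDerivAt

theorem hasFDerivAt_symbol (hx : x ∈ Ω) : HasFDerivAt Γ (fderiv ℝ Γ x) x :=
  ((h.contDiffAt_symbol hx).differentiableAt (by simp)).hasFDerivAt

theorem ext (hx : x ∈ Ω) {a b : V} (hab : ∀ w, g x a w = g x b w) : a = b := by
  by_contra hne
  have := h.pos x hx (a - b) (sub_ne_zero.2 hne)
  have e := hab (a - b)
  simp only [map_sub, sub_apply] at this e
  linarith

theorem nonneg (hx : x ∈ Ω) (u : V) : 0 ≤ g x u u := by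
  rcases eq_or_ne u 0 with rfl | hu
  · simp
  · exact (h.pos x hx u hu).le

/-- The Cauchy-Schwarz inequality. -/
theorem sq_le_mul (hx : x ∈ Ω) (u v : V) : g x u v ^ 2 ≤ g x u u * g x v v := by
  rcases eq_or_ne v 0 with rfl | hv
  · simp
  have hp := h.pos x hx v hv
  have := h.nonneg hx (g x v v • u - g x u v • v)
  simp only [map_sub, sub_apply, map_smul, smul_apply,
    smul_eq_mul, h.symm x hx v u] at this
  by_contra hlt
  push Not at hlt
  nlinarith

theorem abs_le_sqrt_mul_sqrt (hx : x ∈ Ω) (u v : V) :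
    |g x u v| ≤ √(g x u u) * √(g x v v) := by
  rw [← Real.sqrt_mul (h.nonneg hx u)]
  exact Real.abs_le_sqrt (h.sq_le_mul hx u v)

theorem fderiv_symm (hx : x ∈ Ω) (w u v : V) : fderiv ℝ g x w u v = fderiv ℝ g x w v u := by
  have hg := h.hasFDerivAt_metric hx
  have h1 : HasFDerivAt (fun y => g y u v) (((fderiv ℝ g x).flip u).flip v) x := by
    have := (hg.clm_apply (hasFDerivAt_const u x)).clm_apply (hasFDerivAt_const v x)
    convert! this using 1
    ext; simp
  have h2 : HasFDerivAt (fun y => g y v u) (((fderiv ℝ g x).flip v).flip u) x := by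
    have := (hg.clm_apply (hasFDerivAt_const v x)).clm_apply (hasFDerivAt_const u x)
    convert! this using 1
    ext; simp
  have he : (fun y => g y u v) =ᶠ[𝓝 x] fun y => g y v u := by
    filter_upwards [h.isOpen.mem_nhds hx] with y hy using h.symm y hy u v
  have := h1.unique (h2.congr_of_eventuallyEq he)
  simpa using congr($this w)

theorem symbol_symm (hx : x ∈ Ω) (u v : V) : Γ x u v = Γ x v u := by
  refine h.ext hx fun w => ?_
  have h1 := h.koszul x hx u v w
  have h2 := h.koszul x hx v u w
  have h3 := h.fderiv_symm hx w u v
  linarith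

/-- The metric is parallel. -/
theorem fderiv_metric (hx : x ∈ Ω) (w u v : V) :
    fderiv ℝ g x w u v = g x (Γ x w u) v + g x u (Γ x w v) := by
  have h1 := h.koszul x hx w u v
  have h2 := h.koszul x hx w v u
  rw [h.symm x hx u]
  have e1 := h.fderiv_symm hx w v u
  have e2 := h.fderiv_symm hx u w v
  have e3 := h.fderiv_symm hx v w u
  linarith

theorem fderiv_symbol_symm (hx : x ∈ Ω) (w u v : V) :
    fderiv ℝ Γ x w u v = fderiv ℝ Γ x w v u := by
  have hg := h.hasFDerivAt_symbol hx
  have h1 : HasFDerivAt (fun y => Γ y u v) (((fderiv ℝ Γ x).flip u).flip v) x := by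
    have := (hg.clm_apply (hasFDerivAt_const u x)).clm_apply (hasFDerivAt_const v x)
    convert! this using 1
    ext; simp
  have h2 : HasFDerivAt (fun y => Γ y v u) (((fderiv ℝ Γ x).flip v).flip u) x := by
    have := (hg.clm_apply (hasFDerivAt_const v x)).clm_apply (hasFDerivAt_const u x)
    convert! this using 1
    ext; simp
  have he : (fun y => Γ y u v) =ᶠ[𝓝 x] fun y => Γ y v u := by
    filter_upwards [h.isOpen.mem_nhds hx] with y hy using h.symbol_symm hy u v
  have := h1.unique (h2.congr_of_eventuallyEq he)
  simpa using congr($this w)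

/-- The curvature operators `R(u, v)` are skew-symmetric. -/
theorem curvatureTensor_skew (hx : x ∈ Ω) (u v p q : V) :
    g x (curvatureTensor Γ x u v p) q + g x p (curvatureTensor Γ x u v q) = 0 := by
  have hg := h.hasFDerivAt_metric hx
  have hΓ := h.hasFDerivAt_symbol hx
  have hg2 : HasFDerivAt (fderiv ℝ g) (fderiv ℝ (fderiv ℝ g) x) x :=
    (((h.contDiffAt_metric hx).fderiv_right (m := 1) (by norm_cast)).differentiableAt
      (by simp)).hasFDerivAt
  have hsym : ∀ u v, fderiv ℝ (fderiv ℝ g) x u v = fderiv ℝ (fderiv ℝ g) x v u := fun u v =>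
    ((h.contDiffAt_metric hx).isSymmSndFDerivAt (by simp; norm_cast)) u v
  -- This is the derivative of the identity that the metric is parallel. Antisymmetrising in `u` and
  -- `v` removes the second derivative of `g`; what remains is the skew-symmetry.
  have key : ∀ u v, fderiv ℝ (fderiv ℝ g) x u v p q =
      fderiv ℝ g x u (Γ x v p) q + g x (fderiv ℝ Γ x u v p) q
        + fderiv ℝ g x u p (Γ x v q) + g x p (fderiv ℝ Γ x u v q) := by
    intro u v
    have h1 := ((hg2.clm_apply (hasFDerivAt_const v x)).clm_apply
      (hasFDerivAt_const p x)).clm_apply (hasFDerivAt_const q x)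
    have hp := (hΓ.clm_apply (hasFDerivAt_const v x)).clm_apply (hasFDerivAt_const p x)
    have hq := (hΓ.clm_apply (hasFDerivAt_const v x)).clm_apply (hasFDerivAt_const q x)
    have h2 := ((hg.clm_apply hp).clm_apply (hasFDerivAt_const q x)).add
      ((hg.clm_apply (hasFDerivAt_const p x)).clm_apply hq)
    have he : (fun y => fderiv ℝ g y v p q) =ᶠ[𝓝 x]
        fun y => g y (Γ y v p) q + g y p (Γ y v q) := by
      filter_upwards [h.isOpen.mem_nhds hx] with y hy using h.fderiv_metric hy v p q
    have := congr($(h1.unique (h2.congr_of_eventuallyEq he)) u)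
    simp at this
    linarith
  have k1 := key u v
  have k2 := key v u
  rw [hsym u v] at k1
  simp only [h.fderiv_metric hx] at k1 k2
  simp only [curvatureTensor, map_add, map_sub, add_apply,
    sub_apply]
  linarith

theorem contDiffAt_spray {p : V × V} (hp : p.1 ∈ Ω) : ContDiffAt ℝ ∞ (spray Γ) p := by
  have hΓ : ContDiffAt ℝ ∞ (fun p : V × V => Γ p.1) p :=
    (h.contDiffAt_symbol hp).comp p contDiffAt_fst
  exact contDiffAt_snd.prodMk ((hΓ.clm_apply contDiffAt_snd).clm_apply contDiffAt_snd).neg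

/-- The linearised geodesic equation, whose solutions are the Jacobi fields in coordinates. The
symmetry of `Γ` merges the two variations of the velocity into the factor 2. -/
theorem fderiv_spray {p : V × V} (hp : p.1 ∈ Ω) (q : V × V) :
    fderiv ℝ (spray Γ) p q =
      (q.2, -fderiv ℝ Γ p.1 q.1 p.2 p.2 - 2 • Γ p.1 p.2 q.2) := by
  have hΓ := (h.hasFDerivAt_symbol hp).comp p (hasFDerivAt_fst (𝕜 := ℝ) (E := V) (F := V))
  have h2 : HasFDerivAt (fun p : V × V => p.2) (ContinuousLinearMap.snd ℝ V V) p := hasFDerivAt_snd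
  have := (h2.prodMk ((hΓ.clm_apply h2).clm_apply h2).neg).fderiv
  have e : fderiv ℝ (spray Γ) p = _ := this
  rw [e]
  ext
  · simp
  · simp only [ContinuousLinearMap.prod_apply, neg_apply,
      add_apply, ContinuousLinearMap.comp_apply,
      ContinuousLinearMap.flip_apply, ContinuousLinearMap.coe_snd', ContinuousLinearMap.coe_fst',
      Function.comp_apply, h.symbol_symm hp q.2 p.2]
    rw [two_smul]; abel

/-- Derivative of the inner product of two vector fields along a curve. -/
theorem hasDerivAt_metric {c a b : ℝ → V} {c' a' b' : V} {t : ℝ} (hx : c t ∈ Ω)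
    (hc : HasDerivAt c c' t) (ha : HasDerivAt a a' t) (hb : HasDerivAt b b' t) :
    HasDerivAt (fun s => g (c s) (a s) (b s))
      (g (c t) (a' + Γ (c t) c' (a t)) (b t) + g (c t) (a t) (b' + Γ (c t) c' (b t))) t := by
  have h1 := (h.hasFDerivAt_metric hx).comp_hasDerivAt t hc
  have h2 := (h1.clm_apply ha).clm_apply hb
  convert! h2 using 1
  simp only [h.fderiv_metric hx, map_add, add_apply, Function.comp_apply]
  ring

/-- The second covariant derivative of a Jacobi field. -/
theorem hasDerivAt_covariantDeriv {x v y z : ℝ → V} {t : ℝ} (hx : x t ∈ Ω)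
    (h1 : HasDerivAt x (v t) t) (h2 : HasDerivAt v (-Γ (x t) (v t) (v t)) t)
    (h3 : HasDerivAt y (z t) t)
    (h4 : HasDerivAt z (-fderiv ℝ Γ (x t) (y t) (v t) (v t) - 2 • Γ (x t) (v t) (z t)) t) :
    HasDerivAt (fun s => z s + Γ (x s) (v s) (y s))
      (-curvatureTensor Γ (x t) (y t) (v t) (v t)
        - Γ (x t) (v t) (z t + Γ (x t) (v t) (y t))) t := by
  have hG := (h.hasFDerivAt_symbol hx).comp_hasDerivAt t h1
  have := h4.add ((hG.clm_apply h2).clm_apply h3)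
  convert! this using 1
  simp only [curvatureTensor, map_add, map_neg, add_apply,
    neg_apply, Function.comp_apply, two_smul,
    h.fderiv_symbol_symm hx (v t) (v t) (y t), h.symbol_symm hx (y t)]
  abel_nf

end IsLeviCivita

/-- `τ` is an isometry of the open set `W` with the metric `g` into `Ω'` with the metric `g'`. -/
structure IsIsometryOn (g g' : V → V →L[ℝ] V →L[ℝ] ℝ) (τ : V → V) (W Ω' : Set V) : Prop where
  isOpen : IsOpen W
  contDiffOn : ContDiffOn ℝ ∞ τ W
  mapsTo : MapsTo τ W Ω'
  surjective : ∀ x ∈ W, Function.Surjective (fderiv ℝ τ x)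
  pullback : ∀ x ∈ W, ∀ u v, g x u v = g' (τ x) (fderiv ℝ τ x u) (fderiv ℝ τ x v)

namespace IsIsometryOn

variable {g g' : V → V →L[ℝ] V →L[ℝ] ℝ} {Γ Γ' : V → V →L[ℝ] V →L[ℝ] V} {Ω Ω' W : Set V}
  {τ : V → V} (hτ : IsIsometryOn g g' τ W Ω') (h : IsLeviCivita g Γ Ω) (h' : IsLeviCivita g' Γ' Ω')
  (hW : W ⊆ Ω) {x : V}

include hτ

theorem contDiffAt (hx : x ∈ W) : ContDiffAt ℝ ∞ τ x :=
  hτ.contDiffOn.contDiffAt (hτ.isOpen.mem_nhds hx)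

theorem hasFDerivAt (hx : x ∈ W) : HasFDerivAt τ (fderiv ℝ τ x) x :=
  ((hτ.contDiffAt hx).differentiableAt (by simp)).hasFDerivAt

theorem contDiffAt_fderiv (hx : x ∈ W) : ContDiffAt ℝ ∞ (fderiv ℝ τ) x :=
  (hτ.contDiffAt hx).fderiv_right (m := ∞) (by norm_cast)

theorem hasFDerivAt_fderiv (hx : x ∈ W) :
    HasFDerivAt (fderiv ℝ τ) (fderiv ℝ (fderiv ℝ τ) x) x :=
  ((hτ.contDiffAt_fderiv hx).differentiableAt (by simp)).hasFDerivAt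

theorem fderiv_fderiv_symm (hx : x ∈ W) (u v : V) :
    fderiv ℝ (fderiv ℝ τ) x u v = fderiv ℝ (fderiv ℝ τ) x v u :=
  ((hτ.contDiffAt hx).isSymmSndFDerivAt (by simp; norm_cast)) u v

include h h' hW

/-- The transformation law of the Christoffel symbols. -/
theorem fderiv_symbol (hx : x ∈ W) (u v : V) :
    fderiv ℝ τ x (Γ x u v) =
      fderiv ℝ (fderiv ℝ τ) x u v + Γ' (τ x) (fderiv ℝ τ x u) (fderiv ℝ τ x v) := by
  have hxΩ := hW hx
  have hx' := hτ.mapsTo hx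
  have key : ∀ a u v, fderiv ℝ g x a u v =
      fderiv ℝ g' (τ x) (fderiv ℝ τ x a) (fderiv ℝ τ x u) (fderiv ℝ τ x v)
      + g' (τ x) (fderiv ℝ (fderiv ℝ τ) x a u) (fderiv ℝ τ x v)
      + g' (τ x) (fderiv ℝ τ x u) (fderiv ℝ (fderiv ℝ τ) x a v) := by
    intro a u v
    have h1 := ((h.hasFDerivAt_metric hxΩ).clm_apply (hasFDerivAt_const u x)).clm_apply
      (hasFDerivAt_const v x)
    have hg := (h'.hasFDerivAt_metric hx').comp x (hτ.hasFDerivAt hx)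
    have hd := hτ.hasFDerivAt_fderiv hx
    have h2 := (hg.clm_apply (hd.clm_apply (hasFDerivAt_const u x))).clm_apply
      (hd.clm_apply (hasFDerivAt_const v x))
    have he : (fun y => g y u v) =ᶠ[𝓝 x]
        fun y => g' (τ y) (fderiv ℝ τ y u) (fderiv ℝ τ y v) := by
      filter_upwards [hτ.isOpen.mem_nhds hx] with y hy using hτ.pullback y hy u v
    have := congr($(h1.unique (h2.congr_of_eventuallyEq he)) a)
    simp at this
    linarith
  -- Every test vector is an image `dτ w`, so the claim reduces to Koszul's formula on both sides.
  -- In the alternating sum of the three instances of `key`, the second derivatives of `τ` cancel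
  -- except for the term in `u, v`.
  refine h'.ext hx' fun w' => ?_
  obtain ⟨w, rfl⟩ := hτ.surjective x hx w'
  have k := h.koszul x hxΩ u v w
  have k' := h'.koszul _ hx' (fderiv ℝ τ x u) (fderiv ℝ τ x v) (fderiv ℝ τ x w)
  rw [hτ.pullback x hx, key, key, key] at k
  rw [hτ.fderiv_fderiv_symm hx v u, hτ.fderiv_fderiv_symm hx w u, hτ.fderiv_fderiv_symm hx w v,
    h'.symm _ hx' (fderiv ℝ (fderiv ℝ τ) x u w)] at k
  simp only [map_add, add_apply]
  linarith

/-- The transformation law of the curvature tensor. -/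
theorem fderiv_curvatureTensor (hx : x ∈ W) (u v w : V) :
    fderiv ℝ τ x (curvatureTensor Γ x u v w) =
      curvatureTensor Γ' (τ x) (fderiv ℝ τ x u) (fderiv ℝ τ x v) (fderiv ℝ τ x w) := by
  have hxΩ := hW hx
  have hx' := hτ.mapsTo hx
  have hd := hτ.hasFDerivAt_fderiv hx
  have hdd : HasFDerivAt (fderiv ℝ (fderiv ℝ τ)) (fderiv ℝ (fderiv ℝ (fderiv ℝ τ)) x) x :=
    (((hτ.contDiffAt_fderiv hx).fderiv_right (m := 1) (by norm_cast)).differentiableAt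
      (by simp)).hasFDerivAt
  have hsym : ∀ u v, fderiv ℝ (fderiv ℝ (fderiv ℝ τ)) x u v
      = fderiv ℝ (fderiv ℝ (fderiv ℝ τ)) x v u := fun u v =>
    ((hτ.contDiffAt_fderiv hx).isSymmSndFDerivAt (by simp; norm_cast)) u v
  have hlaw := fun u v => hτ.fderiv_symbol h h' hW hx u v
  -- The derivative of the transformation law of the symbols. The third derivative of `τ` is
  -- symmetric in `u, v` and drops out of the difference that forms the curvature.
  have key : ∀ u v, fderiv ℝ (fderiv ℝ τ) x u (Γ x v w) + fderiv ℝ τ x (fderiv ℝ Γ x u v w) =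
      fderiv ℝ (fderiv ℝ (fderiv ℝ τ)) x u v w
      + fderiv ℝ Γ' (τ x) (fderiv ℝ τ x u) (fderiv ℝ τ x v) (fderiv ℝ τ x w)
      + Γ' (τ x) (fderiv ℝ (fderiv ℝ τ) x u v) (fderiv ℝ τ x w)
      + Γ' (τ x) (fderiv ℝ τ x v) (fderiv ℝ (fderiv ℝ τ) x u w) := by
    intro u v
    have h1 := hd.clm_apply (((h.hasFDerivAt_symbol hxΩ).clm_apply
      (hasFDerivAt_const v x)).clm_apply (hasFDerivAt_const w x))
    have hG := (h'.hasFDerivAt_symbol hx').comp x (hτ.hasFDerivAt hx)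
    have h2 := ((hdd.clm_apply (hasFDerivAt_const v x)).clm_apply (hasFDerivAt_const w x)).add
      ((hG.clm_apply (hd.clm_apply (hasFDerivAt_const v x))).clm_apply
        (hd.clm_apply (hasFDerivAt_const w x)))
    have he : (fun y => fderiv ℝ τ y (Γ y v w)) =ᶠ[𝓝 x]
        fun y => fderiv ℝ (fderiv ℝ τ) y v w + Γ' (τ y) (fderiv ℝ τ y v) (fderiv ℝ τ y w) := by
      filter_upwards [hτ.isOpen.mem_nhds hx] with y hy
        using hτ.fderiv_symbol h h' hW hy v w
    have := congr($(h1.unique (h2.congr_of_eventuallyEq he)) u)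
    simp at this
    rw [add_comm, this]
    abel
  have k1 := key u v
  have k2 := key v u
  rw [hsym u v, hτ.fderiv_fderiv_symm hx u v] at k1
  have l1 := hlaw u (Γ x v w)
  have l2 := hlaw v (Γ x u w)
  rw [hlaw v w] at l1
  rw [hlaw u w] at l2
  simp only [curvatureTensor, map_add, map_sub, l1, l2]
  rw [← eq_sub_iff_add_eq'] at k1 k2
  rw [k1, k2]
  abel

end IsIsometryOn

end LeviCivita

/-! ### Dimension two: area form and Gaussian curvature. -/

section PlaneMetric

open Filter
open scoped Topology

/-- The determinant of two vectors of the plane. -/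
def det2 (u v : Plane) : ℝ := u 0 * v 1 - u 1 * v 0

/-- The Gram determinant of the coordinate vectors. -/
noncomputable def gram (g : Plane → Plane →L[ℝ] Plane →L[ℝ] ℝ) (x : Plane) : ℝ :=
  g x (stdVec 0) (stdVec 0) * g x (stdVec 1) (stdVec 1) - g x (stdVec 0) (stdVec 1) ^ 2

/-- The area form of a metric. -/
noncomputable def areaForm (g : Plane → Plane →L[ℝ] Plane →L[ℝ] ℝ) (x u v : Plane) : ℝ :=
  √(gram g x) * det2 u v

/-- The Gaussian curvature of a metric with Christoffel symbols `Γ`. -/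
noncomputable def gaussK (g : Plane → Plane →L[ℝ] Plane →L[ℝ] ℝ)
    (Γ : Plane → Plane →L[ℝ] Plane →L[ℝ] Plane) (x : Plane) : ℝ :=
  g x (curvatureTensor Γ x (stdVec 0) (stdVec 1) (stdVec 1)) (stdVec 0) / gram g x

theorem eq_smul_add_smul (u : Plane) : u = u 0 • stdVec 0 + u 1 • stdVec 1 := by
  ext i
  fin_cases i <;> simp [stdVec]

@[simp] theorem stdVec_zero_zero : stdVec 0 0 = 1 := by simp [stdVec]
@[simp] theorem stdVec_zero_one : stdVec 0 1 = 0 := by simp [stdVec]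
@[simp] theorem stdVec_one_zero : stdVec 1 0 = 0 := by simp [stdVec]
@[simp] theorem stdVec_one_one : stdVec 1 1 = 1 := by simp [stdVec]

theorem det2_map (A : Plane →L[ℝ] Plane) (u v : Plane) :
    det2 (A u) (A v) = det2 (A (stdVec 0)) (A (stdVec 1)) * det2 u v := by
  conv_lhs => rw [eq_smul_add_smul u, eq_smul_add_smul v]
  simp only [map_add, map_smul, det2, PiLp.add_apply, PiLp.smul_apply, smul_eq_mul]
  ring

theorem det_eq_det2 (A : Plane →L[ℝ] Plane) : A.det = det2 (A (stdVec 0)) (A (stdVec 1)) := by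
  rw [ContinuousLinearMap.det, ← LinearMap.det_toMatrix (EuclideanSpace.basisFun (Fin 2) ℝ).toBasis,
    Matrix.det_fin_two]
  simp [LinearMap.toMatrix_apply, det2, stdVec]
  ring

theorem metric_expand (B : Plane →L[ℝ] Plane →L[ℝ] ℝ) (u v : Plane) :
    B u v = u 0 * v 0 * B (stdVec 0) (stdVec 0) + u 0 * v 1 * B (stdVec 0) (stdVec 1)
      + u 1 * v 0 * B (stdVec 1) (stdVec 0) + u 1 * v 1 * B (stdVec 1) (stdVec 1) := by
  conv_lhs => rw [eq_smul_add_smul u, eq_smul_add_smul v]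
  simp only [map_add, map_smul, add_apply, smul_apply, smul_eq_mul]
  ring

namespace IsLeviCivita

variable {g : Plane → Plane →L[ℝ] Plane →L[ℝ] ℝ} {Γ : Plane → Plane →L[ℝ] Plane →L[ℝ] Plane}
  {Ω : Set Plane} (h : IsLeviCivita g Γ Ω) {x : Plane}

include h

theorem gram_mul_sq (hx : x ∈ Ω) (u v : Plane) :
    gram g x * det2 u v ^ 2 = g x u u * g x v v - g x u v ^ 2 := by
  rw [metric_expand (g x) u u, metric_expand (g x) v v, metric_expand (g x) u v,
    h.symm x hx (stdVec 1) (stdVec 0), gram, det2]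
  ring

/-- By Gram–Schmidt: the vector `g₀₀ e₁ - g₀₁ e₀` is nonzero and its squared length is `g₀₀` times
the Gram determinant. -/
theorem gram_pos (hx : x ∈ Ω) : 0 < gram g x := by
  have h0 : stdVec 0 ≠ 0 := fun h0 => by simpa using congr($h0 0)
  have hp := h.pos x hx (stdVec 0) h0
  have h1 : g x (stdVec 0) (stdVec 0) • stdVec 1 - g x (stdVec 0) (stdVec 1) • stdVec 0 ≠ 0 := by
    intro h1
    have := congr($h1 1)
    simp at this
    exact hp.ne' this
  have h2 := h.pos x hx _ h1
  rw [metric_expand, h.symm x hx (stdVec 1) (stdVec 0)] at h2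
  simp at h2
  rw [gram]
  by_contra hle
  push Not at hle
  nlinarith [mul_nonneg hp.le (sub_nonneg.2 hle)]

theorem areaForm_sq (hx : x ∈ Ω) (u v : Plane) :
    areaForm g x u v ^ 2 = g x u u * g x v v - g x u v ^ 2 := by
  rw [areaForm, mul_pow, Real.sq_sqrt (h.gram_pos hx).le, h.gram_mul_sq hx]

/-- The area form is parallel. -/
theorem hasDerivAt_areaForm {c a b : ℝ → Plane} {c' a' b' : Plane} {t : ℝ} (hx : c t ∈ Ω)
    (hc : HasDerivAt c c' t) (ha : HasDerivAt a a' t) (hb : HasDerivAt b b' t) :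
    HasDerivAt (fun s => areaForm g (c s) (a s) (b s))
      (areaForm g (c t) (a' + Γ (c t) c' (a t)) (b t)
        + areaForm g (c t) (a t) (b' + Γ (c t) c' (b t))) t := by
  have hd : ∀ i j, HasDerivAt (fun s => g (c s) (stdVec i) (stdVec j))
      (g (c t) (Γ (c t) c' (stdVec i)) (stdVec j)
        + g (c t) (stdVec i) (Γ (c t) c' (stdVec j))) t := by
    intro i j
    simpa using h.hasDerivAt_metric hx hc (hasDerivAt_const t (stdVec i))
      (hasDerivAt_const t (stdVec j))
  have hG := ((hd 0 0).fun_mul (hd 1 1)).fun_sub ((hd 0 1).fun_pow 2)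
  have hs := hG.sqrt (h.gram_pos hx).ne'
  have hcoord : ∀ {f : ℝ → Plane} {f' : Plane}, HasDerivAt f f' t → ∀ i,
      HasDerivAt (fun s => f s i) (f' i) t := fun hf i =>
    (EuclideanSpace.proj (𝕜 := ℝ) i).hasFDerivAt.comp_hasDerivAt t hf
  have hdet := ((hcoord ha 0).fun_mul (hcoord hb 1)).fun_sub ((hcoord ha 1).fun_mul (hcoord hb 0))
  have := hs.fun_mul hdet
  refine this.congr_deriv ?_
  have hpos := h.gram_pos hx
  change _ / (2 * √(gram g (c t))) * _ + √(gram g (c t)) * _ = _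
  set S := √(gram g (c t)) with hS
  have hS0 : S ≠ 0 := (Real.sqrt_pos.2 hpos).ne'
  have hSS : S * S = gram g (c t) := Real.mul_self_sqrt hpos.le
  set A := Γ (c t) c' with hA
  have e0 := h.symm (c t) hx (stdVec 1) (stdVec 0)
  -- Since the metric is parallel, the Gram determinant has logarithmic derivative `2 tr A`, so its
  -- root has `tr A`. This matches the identity `det2 (A a) b + det2 a (A b) = tr A * det2 a b`.
  have k : ∀ (N : ℝ), N = 2 * (A (stdVec 0) 0 + A (stdVec 1) 1) * gram g (c t) →
      N / (2 * S) = (A (stdVec 0) 0 + A (stdVec 1) 1) * S := by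
    intro N hN
    rw [hN, ← hSS]
    field_simp
  rw [k]
  · simp only [areaForm, det2, PiLp.add_apply, ← hS]
    have ea : ∀ i, A (a t) i = a t 0 * A (stdVec 0) i + a t 1 * A (stdVec 1) i := fun i => by
      conv_lhs => rw [eq_smul_add_smul (a t)]
      simp
    have eb : ∀ i, A (b t) i = b t 0 * A (stdVec 0) i + b t 1 * A (stdVec 1) i := fun i => by
      conv_lhs => rw [eq_smul_add_smul (b t)]
      simp
    rw [ea, ea, eb, eb]
    ring
  · simp only [metric_expand (g (c t)) (A _) _, metric_expand (g (c t)) _ (A _), e0, gram]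
    simp
    ring

/-- In dimension two `R(y, v)` is `det2 y v` times `R(e₀, e₁)`, a skew operator and thus fixed by
one number, the Gaussian curvature. This turns the vector Jacobi equation into the scalar one. -/
theorem areaForm_curvatureTensor (hx : x ∈ Ω) (y v : Plane) :
    areaForm g x (curvatureTensor Γ x y v v) v = gaussK g Γ x * g x v v * areaForm g x y v := by
  have hexp : ∀ w, curvatureTensor Γ x y v w =
      det2 y v • curvatureTensor Γ x (stdVec 0) (stdVec 1) w := by
    intro w
    have e : ∀ a b : Plane, curvatureTensor Γ x a b w = a 0 • b 0 • curvatureTensor Γ x (stdVec 0) (stdVec 0) w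
        + a 0 • b 1 • curvatureTensor Γ x (stdVec 0) (stdVec 1) w
        + a 1 • b 0 • curvatureTensor Γ x (stdVec 1) (stdVec 0) w
        + a 1 • b 1 • curvatureTensor Γ x (stdVec 1) (stdVec 1) w := by
      intro a b
      conv_lhs => rw [eq_smul_add_smul a, eq_smul_add_smul b]
      simp only [curvatureTensor, map_add, map_smul, add_apply, smul_apply]
      module
    have e1 : curvatureTensor Γ x (stdVec 1) (stdVec 0) w
        = -curvatureTensor Γ x (stdVec 0) (stdVec 1) w := by
      simp only [curvatureTensor]; abel
    have e2 : ∀ u, curvatureTensor Γ x u u w = 0 := fun u => by simp only [curvatureTensor]; abel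
    rw [e y v, e1, e2, e2, det2]
    module
  set R : Plane → Plane := curvatureTensor Γ x (stdVec 0) (stdVec 1) with hR
  have hadd : R v = v 0 • R (stdVec 0) + v 1 • R (stdVec 1) := by
    conv_lhs => rw [eq_smul_add_smul v]
    simp only [hR, curvatureTensor, map_add, map_smul]
    module
  have s00 : g x (R (stdVec 0)) (stdVec 0) + g x (stdVec 0) (R (stdVec 0)) = 0 :=
    h.curvatureTensor_skew hx _ _ _ _
  have s11 : g x (R (stdVec 1)) (stdVec 1) + g x (stdVec 1) (R (stdVec 1)) = 0 :=
    h.curvatureTensor_skew hx _ _ _ _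
  have s01 : g x (R (stdVec 0)) (stdVec 1) + g x (stdVec 0) (R (stdVec 1)) = 0 :=
    h.curvatureTensor_skew hx _ _ _ _
  have e0 := h.symm x hx (stdVec 1) (stdVec 0)
  have hG := h.gram_pos hx
  rw [hexp v, gaussK]
  change areaForm g x (det2 y v • R v) v = g x (R (stdVec 1)) (stdVec 0) / _ * _ * _
  have hG' : g x (stdVec 0) (stdVec 0) * g x (stdVec 1) (stdVec 1) - g x (stdVec 0) (stdVec 1) ^ 2
      = gram g x := rfl
  rw [hadd, areaForm, areaForm, metric_expand (g x) v v]
  rw [metric_expand (g x) (R (stdVec 0)) (stdVec 0), metric_expand (g x) (stdVec 0) (R (stdVec 0))]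
    at s00
  rw [metric_expand (g x) (R (stdVec 1)) (stdVec 1), metric_expand (g x) (stdVec 1) (R (stdVec 1))]
    at s11
  rw [metric_expand (g x) (R (stdVec 0)) (stdVec 1), metric_expand (g x) (stdVec 0) (R (stdVec 1))]
    at s01
  rw [metric_expand (g x) (R (stdVec 1)) (stdVec 0)]
  simp only [e0, stdVec_zero_zero, stdVec_zero_one, stdVec_one_zero, stdVec_one_one, det2,
    PiLp.add_apply, PiLp.smul_apply, smul_eq_mul] at *
  generalize g x (stdVec 0) (stdVec 0) = E at *
  generalize g x (stdVec 0) (stdVec 1) = F at *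
  generalize g x (stdVec 1) (stdVec 1) = G at *
  generalize R (stdVec 0) 0 = a at *
  generalize R (stdVec 0) 1 = b at *
  generalize R (stdVec 1) 0 = p at *
  generalize R (stdVec 1) 1 = q at *
  have hD := hG.ne'
  generalize gram g x = D at *
  -- `c` is `⟨R e₁, e₀⟩`, the numerator of the curvature. The skewness relations are linear in the
  -- four entries of `R`, and Cramer's rule expresses each entry through `c`.
  set c := p * E + q * F with hc
  have ha : a = c * F / D := by
    rw [eq_div_iff hD, ← hG']
    linear_combination (G / 2) * s00 - F * s01
  have hb : b = -c * E / D := by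
    rw [eq_div_iff hD, ← hG']
    linear_combination E * s01 - (F / 2) * s00
  have hp : p = c * G / D := by
    rw [eq_div_iff hD, ← hG', hc]
    linear_combination -(F / 2) * s11
  have hq : q = -c * F / D := by
    rw [eq_div_iff hD, ← hG', hc]
    linear_combination (E / 2) * s11
  have hc' : p * 1 * E + p * 0 * F + q * 1 * F + q * 0 * G = c := by rw [hc]; ring
  rw [hc']
  clear_value c
  rw [ha, hb, hp, hq]
  ring

end IsLeviCivita

namespace IsIsometryOn

variable {g g' : Plane → Plane →L[ℝ] Plane →L[ℝ] ℝ}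
  {Γ Γ' : Plane → Plane →L[ℝ] Plane →L[ℝ] Plane} {Ω Ω' W : Set Plane}
  {τ : Plane → Plane} (hτ : IsIsometryOn g g' τ W Ω') (h : IsLeviCivita g Γ Ω)
  (h' : IsLeviCivita g' Γ' Ω') (hW : W ⊆ Ω) {x : Plane}

include hτ h h' hW

omit h hW in
theorem gram_eq (hx : x ∈ W) :
    gram g x = gram g' (τ x) * det2 (fderiv ℝ τ x (stdVec 0)) (fderiv ℝ τ x (stdVec 1)) ^ 2 := by
  rw [h'.gram_mul_sq (hτ.mapsTo hx), gram]
  simp only [hτ.pullback x hx]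

/-- `σ` is the sign of the Jacobian of `τ`. Later only absolute values of area forms occur, so no
orientation of the surface is needed. -/
theorem areaForm_map (hx : x ∈ W) :
    ∃ σ : ℝ, |σ| = 1 ∧ ∀ u v,
      areaForm g' (τ x) (fderiv ℝ τ x u) (fderiv ℝ τ x v) = σ * areaForm g x u v := by
  set d := det2 (fderiv ℝ τ x (stdVec 0)) (fderiv ℝ τ x (stdVec 1)) with hd
  have hg := hτ.gram_eq h' hx
  have hp := h.gram_pos (hW hx)
  have hp' := h'.gram_pos (hτ.mapsTo hx)
  have hd0 : d ≠ 0 := by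
    rintro h0
    rw [← hd, h0] at hg
    simp at hg
    linarith
  have hs : √(gram g x) = √(gram g' (τ x)) * |d| := by
    rw [hg, Real.sqrt_mul hp'.le, Real.sqrt_sq_eq_abs]
  refine ⟨d / |d|, by rw [abs_div, abs_abs, div_self (abs_ne_zero.2 hd0)], fun u v => ?_⟩
  rw [areaForm, areaForm, det2_map, hs, ← hd]
  have := abs_ne_zero.2 hd0
  field_simp

/-- Both curvatures are the proportionality factor in `areaForm_curvatureTensor`; curvature tensor,
metric and area form all transport along `τ`, and the sign `σ` occurs on both sides. -/
theorem gaussK_eq (hx : x ∈ W) : gaussK g' Γ' (τ x) = gaussK g Γ x := by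
  obtain ⟨σ, hσ, harea⟩ := hτ.areaForm_map h h' hW hx
  have hσ0 : σ ≠ 0 := by rintro rfl; simp at hσ
  have k := h.areaForm_curvatureTensor (hW hx) (stdVec 0) (stdVec 1)
  have k' := h'.areaForm_curvatureTensor (hτ.mapsTo hx) (fderiv ℝ τ x (stdVec 0))
    (fderiv ℝ τ x (stdVec 1))
  rw [← hτ.fderiv_curvatureTensor h h' hW hx, harea, harea, k, ← hτ.pullback x hx] at k'
  have h1 : stdVec 1 ≠ 0 := fun h1 => by simpa using congr($h1 1)
  have hg1 := (h.pos x (hW hx) _ h1).ne'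
  have ha : areaForm g x (stdVec 0) (stdVec 1) ≠ 0 := by
    have := Real.sqrt_pos.2 (h.gram_pos (hW hx))
    simp [areaForm, det2, this.ne']
  have hne : σ * g x (stdVec 1) (stdVec 1) * areaForm g x (stdVec 0) (stdVec 1) ≠ 0 := by
    positivity
  apply mul_right_cancel₀ hne
  linear_combination -k'

end IsIsometryOn

end PlaneMetric

/-! ### From coefficient matrices to bilinear forms. -/

section MatrixMetric

open Filter
open scoped Topology

/-- The `i`-th coordinate of the plane, as a continuous linear form. -/
noncomputable abbrev coordForm (i : Fin 2) : Plane →L[ℝ] ℝ := EuclideanSpace.proj i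

/-- The bilinear form with a given coefficient matrix. -/
noncomputable def toForm (m : Matrix (Fin 2) (Fin 2) ℝ) : Plane →L[ℝ] Plane →L[ℝ] ℝ :=
  ∑ i, ∑ j, m i j • (coordForm i).smulRight (coordForm j)

/-- The vector-valued bilinear form with given coefficients. -/
noncomputable def toSymbol (c : Fin 2 → Fin 2 → Fin 2 → ℝ) : Plane →L[ℝ] Plane →L[ℝ] Plane :=
  ∑ l, ∑ i, ∑ j, c l i j • (coordForm i).smulRight ((coordForm j).smulRight (stdVec l))

theorem toForm_apply (m : Matrix (Fin 2) (Fin 2) ℝ) (u v : Plane) :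
    toForm m u v = ∑ i, ∑ j, m i j * (u i * v j) := by
  simp [toForm]

theorem toSymbol_apply (c : Fin 2 → Fin 2 → Fin 2 → ℝ) (u v : Plane) (l : Fin 2) :
    toSymbol c u v l = ∑ i, ∑ j, c l i j * (u i * v j) := by
  fin_cases l <;> simp [toSymbol, Fin.sum_univ_two]

variable {g : Plane → Matrix (Fin 2) (Fin 2) ℝ} {Ω : Set Plane}

theorem fderiv_apply_eq (f : Plane → ℝ) (y u : Plane) :
    fderiv ℝ f y u = ∑ i, u i * partialDeriv i f y := by
  conv_lhs => rw [eq_smul_add_smul u]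
  simp [partialDeriv, Fin.sum_univ_two]

theorem contDiffOn_partialDeriv (hΩ : IsOpen Ω) {f : Plane → ℝ} (hf : ContDiffOn ℝ ∞ f Ω)
    (i : Fin 2) : ContDiffOn ℝ ∞ (partialDeriv i f) Ω :=
  ((hf.fderiv_of_isOpen (m := ∞) hΩ (by norm_cast)).clm_apply contDiffOn_const)

theorem contDiffOn_christoffel (hΩ : IsOpen Ω) (hg : ∀ i j, ContDiffOn ℝ ∞ (fun y => g y i j) Ω)
    (hdet : ∀ y ∈ Ω, (g y).det ≠ 0) (l i j : Fin 2) :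
    ContDiffOn ℝ ∞ (christoffel g l i j) Ω := by
  have hd : ContDiffOn ℝ ∞ (fun y => (g y).det) Ω := by
    simp only [Matrix.det_fin_two]
    exact ((hg 0 0).mul (hg 1 1)).sub ((hg 0 1).mul (hg 1 0))
  have hinv : ∀ l m, ContDiffOn ℝ ∞ (fun y => (g y)⁻¹ l m) Ω := by
    intro l m
    have : ∀ y, (g y)⁻¹ l m = ((g y).det)⁻¹ * (g y).adjugate l m := fun y => by
      simp [Matrix.inv_def]
    simp only [this, Matrix.adjugate_fin_two]
    refine (hd.inv hdet).mul ?_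
    fin_cases l <;> fin_cases m
    · exact hg 1 1
    · exact (hg 0 1).neg
    · exact (hg 1 0).neg
    · exact hg 0 0
  have hp : ∀ i j m, ContDiffOn ℝ ∞ (partialDeriv i (fun z => g z j m)) Ω := fun i j m =>
    contDiffOn_partialDeriv hΩ (hg j m) i
  exact contDiffOn_const.mul (ContDiffOn.sum fun m _ =>
    (hinv l m).mul (((hp i j m).add (hp j i m)).sub (hp m i j)))

theorem fderiv_toForm (hΩ : IsOpen Ω) (hg : ∀ i j, ContDiffOn ℝ ∞ (fun y => g y i j) Ω)
    {y : Plane} (hy : y ∈ Ω) (w u v : Plane) :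
    fderiv ℝ (fun z => toForm (g z)) y w u v =
      ∑ i, ∑ j, (∑ k, w k * partialDeriv k (fun z => g z i j) y) * (u i * v j) := by
  have hd : ∀ i j, HasFDerivAt (fun y => g y i j) (fderiv ℝ (fun y => g y i j) y) y := fun i j =>
    (((hg i j).contDiffAt (hΩ.mem_nhds hy)).differentiableAt (by simp)).hasFDerivAt
  have : HasFDerivAt (fun z => toForm (g z)) (∑ i, ∑ j, (fderiv ℝ (fun y => g y i j) y).smulRight
      ((coordForm i).smulRight (coordForm j))) y := by
    refine HasFDerivAt.fun_sum fun i _ => HasFDerivAt.fun_sum fun j _ => ?_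
    exact (hd i j).smul_const _
  rw [this.fderiv]
  simp [fderiv_apply_eq]

theorem fderiv_toSymbol {c : Plane → Fin 2 → Fin 2 → Fin 2 → ℝ} (hΩ : IsOpen Ω)
    (hc : ∀ l i j, ContDiffOn ℝ ∞ (fun y => c y l i j) Ω)
    {y : Plane} (hy : y ∈ Ω) (w u v : Plane) (l : Fin 2) :
    fderiv ℝ (fun z => toSymbol (c z)) y w u v l =
      ∑ i, ∑ j, (∑ k, w k * partialDeriv k (fun z => c z l i j) y) * (u i * v j) := by
  have hd : ∀ l i j, HasFDerivAt (fun y => c y l i j) (fderiv ℝ (fun y => c y l i j) y) y :=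
    fun l i j =>
    (((hc l i j).contDiffAt (hΩ.mem_nhds hy)).differentiableAt (by simp)).hasFDerivAt
  have : HasFDerivAt (fun z => toSymbol (c z)) (∑ l, ∑ i, ∑ j,
      (fderiv ℝ (fun y => c y l i j) y).smulRight
      ((coordForm i).smulRight ((coordForm j).smulRight (stdVec l)))) y := by
    refine HasFDerivAt.fun_sum fun l _ => HasFDerivAt.fun_sum fun i _ =>
      HasFDerivAt.fun_sum fun j _ => ?_
    exact (hd l i j).smul_const _
  rw [this.fderiv]
  fin_cases l <;> simp [fderiv_apply_eq, Fin.sum_univ_two]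

/-- The Christoffel symbols of a smooth metric given by its coefficients. -/
theorem isLeviCivita_christoffel (hΩ : IsOpen Ω)
    (hg : ∀ i j, ContDiffOn ℝ ∞ (fun y => g y i j) Ω)
    (hsymm : ∀ y i j, g y i j = g y j i)
    (hpos : ∀ y ∈ Ω, ∀ u, u ≠ 0 → 0 < toForm (g y) u u) (hdet : ∀ y ∈ Ω, (g y).det ≠ 0) :
    IsLeviCivita (fun y => toForm (g y))
      (fun y => toSymbol fun l i j => christoffel g l i j y) Ω where
  isOpen := hΩ
  contDiffOn_metric := ContDiffOn.sum fun i _ => ContDiffOn.sum fun j _ =>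
    (hg i j).smul contDiffOn_const
  contDiffOn_symbol := ContDiffOn.sum fun l _ => ContDiffOn.sum fun i _ => ContDiffOn.sum fun j _ =>
    (contDiffOn_christoffel hΩ hg hdet l i j).smul contDiffOn_const
  symm y _ u v := by
    simp only [toForm_apply, Fin.sum_univ_two, hsymm y 1 0]
    ring
  pos := hpos
  koszul y hy u v w := by
    have hu : IsUnit (g y).det := (hdet y hy).isUnit
    have hI : ∀ m' m, ∑ l, g y m l * (g y)⁻¹ l m' = if m = m' then 1 else 0 := fun m' m => by
      have := congr($(Matrix.mul_nonsing_inv (g y) hu) m m')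
      rwa [Matrix.mul_apply, Matrix.one_apply] at this
    have i00 := hI 0 0
    have i01 := hI 0 1
    have i10 := hI 1 0
    have i11 := hI 1 1
    have hp : ∀ k, partialDeriv k (fun z => g z 1 0) y = partialDeriv k (fun z => g z 0 1) y :=
      fun k => by simp only [hsymm _ 1 0]
    simp only [fderiv_toForm hΩ hg hy, toForm_apply (g y), toSymbol_apply, christoffel,
      Fin.sum_univ_two, hp]
    simp only [Fin.sum_univ_two, Fin.isValue, if_true, zero_ne_one, one_ne_zero, if_false,
      hsymm y 1 0] at i00 i01 i10 i11 ⊢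
    generalize (g y)⁻¹ 0 0 = a00 at *
    generalize (g y)⁻¹ 0 1 = a01 at *
    generalize (g y)⁻¹ 1 0 = a10 at *
    generalize (g y)⁻¹ 1 1 = a11 at *
    generalize g y 0 0 = g00 at *
    generalize g y 0 1 = g01 at *
    generalize g y 1 1 = g11 at *
    generalize partialDeriv 0 (fun z => g z 0 0) y = d000
    generalize partialDeriv 0 (fun z => g z 0 1) y = d001
    generalize partialDeriv 0 (fun z => g z 1 1) y = d011
    generalize partialDeriv 1 (fun z => g z 0 0) y = d100
    generalize partialDeriv 1 (fun z => g z 0 1) y = d101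
    generalize partialDeriv 1 (fun z => g z 1 1) y = d111
    generalize u 0 = u0
    generalize u 1 = u1
    generalize v 0 = v0
    generalize v 1 = v1
    generalize w 0 = w0
    generalize w 1 = w1
    -- `P0` and `P1` are twice the Christoffel symbols of the first kind, contracted with `u` and
    -- `v`. Lowering the index again only uses that `g` times its inverse is the identity.
    set P0 := u0 * v0 * d000 + (u0 * v1 + u1 * v0) * d100 + u1 * v1 * (2 * d101 - d011) with hP0
    set P1 := u0 * v0 * (2 * d001 - d100) + (u0 * v1 + u1 * v0) * d011 + u1 * v1 * d111 with hP1
    linear_combination (w0 * P0) * i00 + (w0 * P1) * i10 + (w1 * P0) * i01 + (w1 * P1) * i11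

/-- Connects the index formula for the curvature with the coordinate-free `gaussK`, for which
invariance is proved. -/
theorem gaussK_christoffel (hΩ : IsOpen Ω)
    (hg : ∀ i j, ContDiffOn ℝ ∞ (fun y => g y i j) Ω)
    (hsymm : ∀ y i j, g y i j = g y j i) (hdet : ∀ y ∈ Ω, (g y).det ≠ 0) {y : Plane} (hy : y ∈ Ω) :
    gaussK (fun y => toForm (g y)) (fun y => toSymbol fun l i j => christoffel g l i j y) y =
      coordGaussianCurvature g y := by
  have hR : ∀ l, curvatureTensor (fun y => toSymbol fun l i j => christoffel g l i j y) y
      (stdVec 0) (stdVec 1) (stdVec 1) l = riemannTensor g l 0 1 1 y := by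
    intro l
    simp only [curvatureTensor, PiLp.add_apply, PiLp.sub_apply,
      fderiv_toSymbol (c := fun y l i j => christoffel g l i j y) hΩ
        (contDiffOn_christoffel hΩ hg hdet) hy, toSymbol_apply, Fin.sum_univ_two, riemannTensor]
    simp
    ring
  rw [gaussK, coordGaussianCurvature]
  congr 1
  · rw [toForm_apply]
    simp only [hR, Fin.sum_univ_two]
    simp
    ring
  · simp only [gram, toForm_apply, Fin.sum_univ_two, Matrix.det_fin_two, hsymm y 1 0]
    simp
    ring

end MatrixMetric

/-! ### The metric of the surface in charts, and changes of charts. -/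

section Charts

open Filter
open scoped Topology

variable {M : Type*} [TopologicalSpace M] [ChartedSpace Plane M] [IsManifold (𝓡 2) ∞ M]

/-- The differential of the inverse of the chart at `q`. -/
noncomputable def coordMap (q : M) (y : Plane) :
    Plane →L[ℝ] TangentSpace (𝓡 2) ((extChartAt (𝓡 2) q).symm y) :=
  mfderiv (𝓡 2) (𝓡 2) (extChartAt (𝓡 2) q).symm y

theorem mdifferentiableAt_chart_symm (q : M) {y : Plane} (hy : y ∈ (extChartAt (𝓡 2) q).target) :
    MDifferentiableAt (𝓡 2) (𝓡 2) (extChartAt (𝓡 2) q).symm y :=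
  ((contMDiffOn_extChartAt_symm (I := 𝓡 2) (n := ∞) q).contMDiffAt
    ((isOpen_extChartAt_target q).mem_nhds hy)).mdifferentiableAt (by simp)

theorem coordMap_injective (q : M) {y : Plane} (hy : y ∈ (extChartAt (𝓡 2) q).target) :
    Function.Injective (coordMap q y) := by
  have := mfderiv_extChartAt_comp_mfderivWithin_extChartAt_symm (I := 𝓡 2) hy
  intro u v huv
  have h1 := congr($this u)
  have h2 := congr($this v)
  simp only [modelWithCornersSelf_coe, range_id, mfderivWithin_univ] at h1 h2
  exact (h1.symm.trans (congrArg (mfderiv (𝓡 2) (𝓡 2) (extChartAt (𝓡 2) q)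
    ((extChartAt (𝓡 2) q).symm y)) huv)).trans h2

theorem contMDiffOn_coordVec (q : M) (i : Fin 2) :
    ContMDiffOn (𝓡 2) ((𝓡 2).prod 𝓘(ℝ, Plane)) ∞
      (fun y => (⟨(extChartAt (𝓡 2) q).symm y, coordVec q i y⟩ : TangentBundle (𝓡 2) M))
      (extChartAt (𝓡 2) q).target := by
  have hs : UniqueMDiffOn (𝓡 2) (extChartAt (𝓡 2) q).target :=
    (isOpen_extChartAt_target q).uniqueMDiffOn
  have h1 := (contMDiffOn_extChartAt_symm (I := 𝓡 2) (n := ∞) q).contMDiffOn_tangentMapWithin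
    (m := ∞) (by norm_cast) hs
  have h2 : ContMDiffOn (𝓡 2) ((𝓡 2).prod 𝓘(ℝ, Plane)) ∞
      (fun y : Plane => (⟨y, stdVec i⟩ : TangentBundle (𝓡 2) Plane))
      (extChartAt (𝓡 2) q).target := fun y hy =>
    contMDiffWithinAt_vectorSpace_iff_contDiffWithinAt.2 contDiffWithinAt_const
  refine (h1.comp h2 fun y hy => hy).congr fun y hy => ?_
  simp only [Function.comp_apply, tangentMapWithin, coordVec,
    mfderivWithin_of_isOpen (isOpen_extChartAt_target q) hy]

variable [RiemannianBundle (fun x : M => TangentSpace (𝓡 2) x)]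

/-- The Riemannian metric in the chart at `q`. -/
noncomputable def chartMetric (q : M) (y : Plane) : Plane →L[ℝ] Plane →L[ℝ] ℝ :=
  toForm (metricCoeff q y)

/-- The Christoffel symbols in the chart at `q`. -/
noncomputable def chartSymbol (q : M) (y : Plane) : Plane →L[ℝ] Plane →L[ℝ] Plane :=
  toSymbol fun l i j => christoffel (metricCoeff q) l i j y

omit [IsManifold (𝓡 2) ∞ M] in
theorem chartMetric_apply (q : M) (y u v : Plane) :
    chartMetric q y u v = inner ℝ (coordMap q y u) (coordMap q y v) := by
  have hu : coordMap q y u = u 0 • coordVec q 0 y + u 1 • coordVec q 1 y := by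
    conv_lhs => rw [eq_smul_add_smul u, map_add, map_smul, map_smul]
    rfl
  have hv : coordMap q y v = v 0 • coordVec q 0 y + v 1 • coordVec q 1 y := by
    conv_lhs => rw [eq_smul_add_smul v, map_add, map_smul, map_smul]
    rfl
  rw [hu, hv, chartMetric, toForm_apply]
  simp only [Fin.sum_univ_two, metricCoeff, Matrix.of_apply, inner_add_left, inner_add_right,
    real_inner_smul_left, real_inner_smul_right]
  ring

omit [IsManifold (𝓡 2) ∞ M] in
theorem metricCoeff_symm (q : M) (y : Plane) (i j : Fin 2) :
    metricCoeff q y i j = metricCoeff q y j i := by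
  simp only [metricCoeff, Matrix.of_apply]
  exact real_inner_comm _ _

omit [IsManifold (𝓡 2) ∞ M] in
theorem gram_chartMetric (q : M) (y : Plane) :
    gram (chartMetric q) y = (metricCoeff q y).det := by
  simp only [gram, chartMetric, toForm_apply, Fin.sum_univ_two, Matrix.det_fin_two,
    metricCoeff_symm q y 1 0]
  simp
  ring

theorem chartMetric_pos (q : M) {y : Plane} (hy : y ∈ (extChartAt (𝓡 2) q).target) (u : Plane)
    (hu : u ≠ 0) : 0 < chartMetric q y u u := by
  rw [chartMetric_apply]
  refine real_inner_self_pos.2 fun h0 => hu (coordMap_injective q hy ?_)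
  rw [h0, map_zero]

theorem metricCoeff_det_ne_zero (q : M) {y : Plane} (hy : y ∈ (extChartAt (𝓡 2) q).target) :
    (metricCoeff q y).det ≠ 0 := by
  intro hdet
  obtain ⟨v, hv, hmv⟩ := Matrix.exists_mulVec_eq_zero_iff.2 hdet
  have hpos := chartMetric_pos q hy (WithLp.toLp 2 v) (by simpa using hv)
  rw [chartMetric, toForm_apply] at hpos
  have h0 := congr($hmv 0)
  have h1 := congr($hmv 1)
  simp only [Matrix.mulVec, dotProduct, Fin.sum_univ_two, Pi.zero_apply] at h0 h1 hpos
  exact hpos.ne' (by linear_combination v 0 * h0 + v 1 * h1)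

variable [IsContMDiffRiemannianBundle (𝓡 2) ∞ Plane (fun x : M => TangentSpace (𝓡 2) x)]

theorem contDiffOn_metricCoeff (q : M) (i j : Fin 2) :
    ContDiffOn ℝ ∞ (fun y => metricCoeff q y i j) (extChartAt (𝓡 2) q).target := by
  rw [← contMDiffOn_iff_contDiffOn]
  exact ContMDiffOn.inner_bundle (contMDiffOn_coordVec q i) (contMDiffOn_coordVec q j)

theorem isLeviCivita_chart (q : M) :
    IsLeviCivita (chartMetric q) (chartSymbol q) (extChartAt (𝓡 2) q).target :=
  isLeviCivita_christoffel (isOpen_extChartAt_target q) (contDiffOn_metricCoeff q)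
    (metricCoeff_symm q) (fun _ hy => chartMetric_pos q hy) fun _ hy => metricCoeff_det_ne_zero q hy

theorem gaussK_chart (q : M) {y : Plane} (hy : y ∈ (extChartAt (𝓡 2) q).target) :
    gaussK (chartMetric q) (chartSymbol q) y = coordGaussianCurvature (metricCoeff q) y :=
  gaussK_christoffel (isOpen_extChartAt_target q) (contDiffOn_metricCoeff q)
    (metricCoeff_symm q) (fun _ hy => metricCoeff_det_ne_zero q hy) hy

/-- The change of coordinates from the chart at `q` to the chart at `q'`. -/
noncomputable def transition (q q' : M) : Plane → Plane :=
  extChartAt (𝓡 2) q' ∘ (extChartAt (𝓡 2) q).symm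

/-- The domain of the change of coordinates. -/
def overlap (q q' : M) : Set Plane :=
  (extChartAt (𝓡 2) q).target ∩ (extChartAt (𝓡 2) q).symm ⁻¹' (extChartAt (𝓡 2) q').source

omit [IsManifold (𝓡 2) ∞ M] [RiemannianBundle (fun x : M => TangentSpace (𝓡 2) x)]
  [IsContMDiffRiemannianBundle (𝓡 2) ∞ Plane (fun x : M => TangentSpace (𝓡 2) x)] in
theorem isOpen_overlap (q q' : M) : IsOpen (overlap q q') :=
  (continuousOn_extChartAt_symm q).isOpen_inter_preimage (isOpen_extChartAt_target q)
    (isOpen_extChartAt_source q')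

omit [RiemannianBundle (fun x : M => TangentSpace (𝓡 2) x)]
  [IsContMDiffRiemannianBundle (𝓡 2) ∞ Plane (fun x : M => TangentSpace (𝓡 2) x)] in
theorem contDiffOn_transition (q q' : M) : ContDiffOn ℝ ∞ (transition q q') (overlap q q') := by
  have := contDiffOn_ext_coord_change (I := 𝓡 2) (n := ∞) q' q
  rwa [PartialEquiv.trans_source, PartialEquiv.symm_source] at this

omit [IsManifold (𝓡 2) ∞ M] [RiemannianBundle (fun x : M => TangentSpace (𝓡 2) x)]
  [IsContMDiffRiemannianBundle (𝓡 2) ∞ Plane (fun x : M => TangentSpace (𝓡 2) x)] in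
theorem transition_mapsTo (q q' : M) : MapsTo (transition q q') (overlap q q') (overlap q' q) := by
  rintro y ⟨hy, hy'⟩
  refine ⟨(extChartAt (𝓡 2) q').map_source hy', ?_⟩
  simp only [transition, Function.comp_apply, mem_preimage, (extChartAt (𝓡 2) q').left_inv hy']
  exact (extChartAt (𝓡 2) q).map_target hy

omit [IsManifold (𝓡 2) ∞ M] [RiemannianBundle (fun x : M => TangentSpace (𝓡 2) x)]
  [IsContMDiffRiemannianBundle (𝓡 2) ∞ Plane (fun x : M => TangentSpace (𝓡 2) x)] in
theorem transition_transition (q q' : M) {y : Plane} (hy : y ∈ overlap q q') :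
    transition q' q (transition q q' y) = y := by
  simp only [transition, Function.comp_apply, (extChartAt (𝓡 2) q').left_inv hy.2,
    (extChartAt (𝓡 2) q).right_inv hy.1]

omit [IsManifold (𝓡 2) ∞ M] [RiemannianBundle (fun x : M => TangentSpace (𝓡 2) x)]
  [IsContMDiffRiemannianBundle (𝓡 2) ∞ Plane (fun x : M => TangentSpace (𝓡 2) x)] in
theorem symm_transition (q q' : M) {y : Plane} (hy : y ∈ overlap q q') :
    (extChartAt (𝓡 2) q').symm (transition q q' y) = (extChartAt (𝓡 2) q).symm y :=
  (extChartAt (𝓡 2) q').left_inv hy.2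

omit [RiemannianBundle (fun x : M => TangentSpace (𝓡 2) x)]
  [IsContMDiffRiemannianBundle (𝓡 2) ∞ Plane (fun x : M => TangentSpace (𝓡 2) x)] in
theorem hasFDerivAt_transition (q q' : M) {y : Plane} (hy : y ∈ overlap q q') :
    HasFDerivAt (transition q q') (fderiv ℝ (transition q q') y) y :=
  (((contDiffOn_transition q q').contDiffAt ((isOpen_overlap q q').mem_nhds hy)).differentiableAt
    (by simp)).hasFDerivAt

omit [IsContMDiffRiemannianBundle (𝓡 2) ∞ Plane (fun x : M => TangentSpace (𝓡 2) x)] in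
theorem chartMetric_transition (q q' : M) {y : Plane} (hy : y ∈ overlap q q') (u v : Plane) :
    chartMetric q y u v = chartMetric q' (transition q q' y)
      (fderiv ℝ (transition q q') y u) (fderiv ℝ (transition q q') y v) := by
  have hev : (extChartAt (𝓡 2) q).symm =ᶠ[𝓝 y] (extChartAt (𝓡 2) q').symm ∘ transition q q' := by
    filter_upwards [(isOpen_overlap q q').mem_nhds hy] with z hz
    exact (symm_transition q q' hz).symm
  have hd : MDifferentiableAt (𝓡 2) (𝓡 2) (transition q q') y :=
    (hasFDerivAt_transition q q' hy).differentiableAt.mdifferentiableAt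
  have hc := mfderiv_comp y (mdifferentiableAt_chart_symm q' (transition_mapsTo q q' hy).1) hd
  rw [← hev.mfderiv_eq, mfderiv_eq_fderiv] at hc
  rw [chartMetric_apply, chartMetric_apply]
  -- The two expressions for the base point are equal but not by definition, so the tangent vectors
  -- are compared in the common model plane.
  have key : ∀ (p p' : M) (hp : p = p') (a b : TangentSpace (𝓡 2) p)
      (a' b' : TangentSpace (𝓡 2) p'), (show Plane from a) = (show Plane from a') →
      (show Plane from b) = (show Plane from b') → inner ℝ a b = inner ℝ a' b' := by
    rintro p _ rfl a b a' b' h1 h2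
    have h1' : a = a' := h1
    have h2' : b = b' := h2
    rw [h1', h2']
  refine key _ _ (symm_transition q q' hy).symm _ _ _ _ ?_ ?_
  · exact congr($hc u)
  · exact congr($hc v)

omit [IsContMDiffRiemannianBundle (𝓡 2) ∞ Plane (fun x : M => TangentSpace (𝓡 2) x)] in
theorem isIsometryOn_transition (q q' : M) :
    IsIsometryOn (chartMetric q) (chartMetric q') (transition q q') (overlap q q')
      (extChartAt (𝓡 2) q').target where
  isOpen := isOpen_overlap q q'
  contDiffOn := contDiffOn_transition q q'
  mapsTo := fun y hy => (transition_mapsTo q q' hy).1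
  surjective := fun y hy => by
    have h1 := (hasFDerivAt_transition q' q (transition_mapsTo q q' hy))
    have h2 := (hasFDerivAt_transition q q' hy)
    have hback : transition q q' ∘ transition q' q =ᶠ[𝓝 (transition q q' y)] id := by
      filter_upwards [(isOpen_overlap q' q).mem_nhds (transition_mapsTo q q' hy)] with z hz
      exact transition_transition q' q hz
    have h3 : HasFDerivAt (transition q q') (fderiv ℝ (transition q q') y)
        (transition q' q (transition q q' y)) := by rwa [transition_transition q q' hy]
    have := (h3.comp _ h1).unique ((hasFDerivAt_id _).congr_of_eventuallyEq hback)
    intro w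
    exact ⟨_, congr($this w)⟩
  pullback := fun y hy u v => chartMetric_transition q q' hy u v

/-- The curvature at `p` is defined in the chart at `p` itself. Along a geodesic that chart varies,
whereas the Jacobi equation is written in one fixed chart `q`. -/
theorem gaussK_transition (q : M) {p : M} (hp : p ∈ (extChartAt (𝓡 2) q).source) :
    gaussK (chartMetric q) (chartSymbol q) (extChartAt (𝓡 2) q p) = gaussianCurvature p := by
  have hy : extChartAt (𝓡 2) q p ∈ overlap q p :=
    ⟨(extChartAt (𝓡 2) q).map_source hp, by
      simp only [mem_preimage, (extChartAt (𝓡 2) q).left_inv hp, mem_extChartAt_source]⟩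
  have := (isIsometryOn_transition q p).gaussK_eq (isLeviCivita_chart q) (isLeviCivita_chart p)
    (fun y hy => hy.1) hy
  rw [← this, gaussianCurvature, transition, Function.comp_apply,
    (extChartAt (𝓡 2) q).left_inv hp, gaussK_chart p (mem_extChartAt_target p)]

end Charts

/-! ### Action of a change of charts on states and variations of geodesics. -/

section StateMap

open Filter
open scoped Topology

variable {V : Type*} [NormedAddCommGroup V] [NormedSpace ℝ V]

/-- The map induced by `τ` on positions and velocities. -/
noncomputable def stateMap (τ : V → V) (p : V × V) : V × V := (τ p.1, fderiv ℝ τ p.1 p.2)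

/-- The covariant derivative of a variation `q` of a curve with state `p`. -/
noncomputable def covDeriv (Γ : V → V →L[ℝ] V →L[ℝ] V) (p q : V × V) : V := q.2 + Γ p.1 p.2 q.1

namespace IsIsometryOn

variable {g g' : V → V →L[ℝ] V →L[ℝ] ℝ} {Γ Γ' : V → V →L[ℝ] V →L[ℝ] V} {Ω Ω' W : Set V}
  {τ : V → V} (hτ : IsIsometryOn g g' τ W Ω') (h : IsLeviCivita g Γ Ω) (h' : IsLeviCivita g' Γ' Ω')
  (hW : W ⊆ Ω) {p : V × V}

include hτ

theorem contDiffAt_stateMap (hp : p.1 ∈ W) : ContDiffAt ℝ ∞ (stateMap τ) p :=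
  ((hτ.contDiffAt hp).comp p contDiffAt_fst).prodMk
    (((hτ.contDiffAt_fderiv hp).comp p contDiffAt_fst).clm_apply contDiffAt_snd)

theorem hasFDerivAt_stateMap (hp : p.1 ∈ W) :
    HasFDerivAt (stateMap τ) (fderiv ℝ (stateMap τ) p) p :=
  ((hτ.contDiffAt_stateMap hp).differentiableAt (by simp)).hasFDerivAt

theorem fderiv_stateMap (hp : p.1 ∈ W) (q : V × V) :
    fderiv ℝ (stateMap τ) p q =
      (fderiv ℝ τ p.1 q.1, fderiv ℝ (fderiv ℝ τ) p.1 q.1 p.2 + fderiv ℝ τ p.1 q.2) := by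
  have h1 := (hτ.hasFDerivAt hp).comp p (hasFDerivAt_fst (𝕜 := ℝ) (E := V) (F := V))
  have h2 := (hτ.hasFDerivAt_fderiv hp).comp p (hasFDerivAt_fst (𝕜 := ℝ) (E := V) (F := V))
  have h3 : HasFDerivAt (fun p : V × V => p.2) (ContinuousLinearMap.snd ℝ V V) p := hasFDerivAt_snd
  have e : fderiv ℝ (stateMap τ) p = _ := (h1.prodMk (h2.clm_apply h3)).fderiv
  rw [e]
  ext
  · simp
  · simp [add_comm]

include h h' hW

theorem fderiv_stateMap_spray (hp : p.1 ∈ W) :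
    fderiv ℝ (stateMap τ) p (spray Γ p) = spray Γ' (stateMap τ p) := by
  rw [hτ.fderiv_stateMap hp]
  simp only [spray, stateMap, map_neg, hτ.fderiv_symbol h h' hW hp]
  rw [neg_add, add_neg_cancel_left]

theorem covDeriv_stateMap (hp : p.1 ∈ W) (q : V × V) :
    covDeriv Γ' (stateMap τ p) (fderiv ℝ (stateMap τ) p q) = fderiv ℝ τ p.1 (covDeriv Γ p q) := by
  rw [hτ.fderiv_stateMap hp]
  simp only [covDeriv, stateMap, map_add, hτ.fderiv_symbol h h' hW hp,
    hτ.fderiv_fderiv_symm hp q.1 p.2]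
  abel

end IsIsometryOn

/-- Local uniqueness for the geodesic equation. -/
theorem IsLeviCivita.eventuallyEq_of_spray {g : V → V →L[ℝ] V →L[ℝ] ℝ}
    {Γ : V → V →L[ℝ] V →L[ℝ] V} {Ω : Set V} (h : IsLeviCivita g Γ Ω) {z w : ℝ → V × V} {t : ℝ}
    (hz : ∀ᶠ s in 𝓝 t, HasDerivAt z (spray Γ (z s)) s)
    (hw : ∀ᶠ s in 𝓝 t, HasDerivAt w (spray Γ (w s)) s) (hΩ : (z t).1 ∈ Ω) (heq : z t = w t) :
    z =ᶠ[𝓝 t] w := by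
  obtain ⟨K, s, hs, hK⟩ := ((h.contDiffAt_spray hΩ).of_le
    (m := 1) (by norm_cast)).exists_lipschitzOnWith
  refine ODE_solution_unique_of_eventually (v := fun _ => spray Γ) (s := fun _ => s) (K := K)
    (Eventually.of_forall fun _ => hK) (hz.and ?_) (hw.and ?_) heq
  · exact hz.self_of_nhds.continuousAt.eventually hs
  · rw [heq] at hs
    exact hw.self_of_nhds.continuousAt.eventually hs

/-- Conservation of the speed of a geodesic. -/
theorem IsLeviCivita.hasDerivAt_speed {g : V → V →L[ℝ] V →L[ℝ] ℝ}
    {Γ : V → V →L[ℝ] V →L[ℝ] V} {Ω : Set V} (h : IsLeviCivita g Γ Ω) {z : ℝ → V × V} {t : ℝ}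
    (hz : HasDerivAt z (spray Γ (z t)) t) (hΩ : (z t).1 ∈ Ω) :
    HasDerivAt (fun s => g (z s).1 (z s).2 (z s).2) 0 t := by
  have := h.hasDerivAt_metric (c := fun s => (z s).1) (a := fun s => (z s).2)
    (b := fun s => (z s).2) hΩ hz.fst hz.snd hz.snd
  convert! this using 1
  simp [spray]

end StateMap

/-! ### Unit speed geodesics on the surface and their uniqueness. -/

section Geodesics

open Filter
open scoped Topology

variable {M : Type*} [MetricSpace M] [ChartedSpace Plane M] [IsManifold (𝓡 2) ∞ M]

/-- Position and velocity of a curve in the chart at `q`. -/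
noncomputable def chartState (q : M) (γ : ℝ → M) (t : ℝ) : Plane × Plane :=
  (extChartAt (𝓡 2) q (γ t), deriv (fun s => extChartAt (𝓡 2) q (γ s)) t)

omit [IsManifold (𝓡 2) ∞ M] in
theorem chartState_congr (q : M) {γ γ' : ℝ → M} {t : ℝ} (h : γ =ᶠ[𝓝 t] γ') :
    chartState q γ =ᶠ[𝓝 t] chartState q γ' := by
  filter_upwards [eventually_eventually_nhds.2 h] with s hs
  rw [chartState, chartState, hs.self_of_nhds, EventuallyEq.deriv_eq
    (hs.mono fun u hu => by rw [hu])]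

variable [RiemannianBundle (fun x : M => TangentSpace (𝓡 2) x)]

/-- Near `t`, the curve `γ` stays in the chart at `q` and is a unit speed geodesic. -/
def IsGeodesicAt (q : M) (γ : ℝ → M) (t : ℝ) : Prop :=
  ∀ᶠ s in 𝓝 t, γ s ∈ (extChartAt (𝓡 2) q).source ∧
    HasDerivAt (chartState q γ) (spray (chartSymbol q) (chartState q γ s)) s ∧
    chartMetric q (chartState q γ s).1 (chartState q γ s).2 (chartState q γ s).2 = 1

/-- Unit speed geodesics. -/
def IsGeodesicOn (γ : ℝ → M) (I : Set ℝ) : Prop := ∀ t ∈ I, ∃ q, IsGeodesicAt q γ t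

omit [IsManifold (𝓡 2) ∞ M]

theorem IsGeodesicAt.congr {q : M} {γ γ' : ℝ → M} {t : ℝ} (h : IsGeodesicAt q γ t)
    (he : γ =ᶠ[𝓝 t] γ') : IsGeodesicAt q γ' t := by
  filter_upwards [h, eventually_eventually_nhds.2 he] with s hs hs'
  have hc := chartState_congr q hs'
  rw [← hc.self_of_nhds, ← hs'.self_of_nhds]
  exact ⟨hs.1, hs.2.1.congr_of_eventuallyEq hc.symm, hs.2.2⟩

theorem IsGeodesicAt.eventually {q : M} {γ : ℝ → M} {t : ℝ} (h : IsGeodesicAt q γ t) :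
    ∀ᶠ s in 𝓝 t, IsGeodesicAt q γ s := eventually_eventually_nhds.2 h

theorem IsGeodesicAt.mem_source {q : M} {γ : ℝ → M} {t : ℝ} (h : IsGeodesicAt q γ t) :
    γ t ∈ (extChartAt (𝓡 2) q).source := h.self_of_nhds.1

theorem IsGeodesicAt.hasDerivAt {q : M} {γ : ℝ → M} {t : ℝ} (h : IsGeodesicAt q γ t) :
    HasDerivAt (chartState q γ) (spray (chartSymbol q) (chartState q γ t)) t :=
  h.self_of_nhds.2.1

theorem IsGeodesicAt.speed {q : M} {γ : ℝ → M} {t : ℝ} (h : IsGeodesicAt q γ t) :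
    chartMetric q (chartState q γ t).1 (chartState q γ t).2 (chartState q γ t).2 = 1 :=
  h.self_of_nhds.2.2

theorem IsGeodesicAt.continuousAt {q : M} {γ : ℝ → M} {t : ℝ} (h : IsGeodesicAt q γ t) :
    ContinuousAt γ t := by
  have h1 : ContinuousAt (fun s => (chartState q γ s).1) t := h.hasDerivAt.continuousAt.fst
  have h2 : ContinuousAt (extChartAt (𝓡 2) q).symm (chartState q γ t).1 :=
    continuousAt_extChartAt_symm' h.mem_source
  refine (ContinuousAt.comp (f := fun s => (chartState q γ s).1) h2 h1).congr ?_
  filter_upwards [h] with s hs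
  exact (extChartAt (𝓡 2) q).left_inv hs.1

theorem IsGeodesicOn.continuousAt {γ : ℝ → M} {I : Set ℝ} (h : IsGeodesicOn γ I) {t : ℝ}
    (ht : t ∈ I) : ContinuousAt γ t :=
  let ⟨_, hq⟩ := h t ht
  hq.continuousAt

theorem IsGeodesicOn.mono {γ : ℝ → M} {I J : Set ℝ} (h : IsGeodesicOn γ I) (hJ : J ⊆ I) :
    IsGeodesicOn γ J := fun t ht => h t (hJ ht)

/-- A curve that is given in a chart by a solution of the geodesic equation. -/
theorem isGeodesicAt_of_hasDerivAt (q : M) {z : ℝ → Plane × Plane} {t : ℝ}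
    (hz : ∀ᶠ s in 𝓝 t, (z s).1 ∈ (extChartAt (𝓡 2) q).target ∧
      HasDerivAt z (spray (chartSymbol q) (z s)) s ∧ chartMetric q (z s).1 (z s).2 (z s).2 = 1) :
    IsGeodesicAt q (fun s => (extChartAt (𝓡 2) q).symm (z s).1) t ∧
      chartState q (fun s => (extChartAt (𝓡 2) q).symm (z s).1) t = z t := by
  have hst : ∀ᶠ s in 𝓝 t,
      chartState q (fun s => (extChartAt (𝓡 2) q).symm (z s).1) s = z s := by
    filter_upwards [eventually_eventually_nhds.2 hz] with s hs
    have he : (fun u => extChartAt (𝓡 2) q ((extChartAt (𝓡 2) q).symm (z u).1)) =ᶠ[𝓝 s]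
        fun u => (z u).1 := by
      filter_upwards [hs] with u hu using (extChartAt (𝓡 2) q).right_inv hu.1
    have hd : HasDerivAt (fun u => (z u).1) (z s).2 s := hs.self_of_nhds.2.1.fst
    rw [chartState, he.deriv_eq, (extChartAt (𝓡 2) q).right_inv hs.self_of_nhds.1, hd.deriv]
  refine ⟨?_, hst.self_of_nhds⟩
  filter_upwards [hz, eventually_eventually_nhds.2 hst] with s hs hs'
  rw [hs'.self_of_nhds]
  exact ⟨(extChartAt (𝓡 2) q).map_target hs.1, hs.2.1.congr_of_eventuallyEq hs', hs.2.2⟩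

variable [IsManifold (𝓡 2) ∞ M]
variable [IsContMDiffRiemannianBundle (𝓡 2) ∞ Plane (fun x : M => TangentSpace (𝓡 2) x)]

omit [RiemannianBundle (fun x : M => TangentSpace (𝓡 2) x)]
  [IsContMDiffRiemannianBundle (𝓡 2) ∞ Plane (fun x : M => TangentSpace (𝓡 2) x)] in
/-- Change of chart for the state of a curve. -/
theorem chartState_transition (q q' : M) {γ : ℝ → M} {t : ℝ} (hγ : ContinuousAt γ t)
    (hq : γ t ∈ (extChartAt (𝓡 2) q).source) (hq' : γ t ∈ (extChartAt (𝓡 2) q').source)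
    (hd : DifferentiableAt ℝ (fun s => extChartAt (𝓡 2) q (γ s)) t) :
    chartState q' γ t = stateMap (transition q q') (chartState q γ t) := by
  have hmem : extChartAt (𝓡 2) q (γ t) ∈ overlap q q' :=
    ⟨(extChartAt (𝓡 2) q).map_source hq, by
      simpa only [mem_preimage, (extChartAt (𝓡 2) q).left_inv hq] using hq'⟩
  have he : (fun s => extChartAt (𝓡 2) q' (γ s)) =ᶠ[𝓝 t]
      fun s => transition q q' (extChartAt (𝓡 2) q (γ s)) := by
    filter_upwards [hγ.eventually ((isOpen_extChartAt_source q).mem_nhds hq)] with s hs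
    simp only [transition, Function.comp_apply, (extChartAt (𝓡 2) q).left_inv hs]
  have h1 := (hasFDerivAt_transition q q' hmem).comp_hasDerivAt t hd.hasDerivAt
  have h2 : deriv (fun s => transition q q' (extChartAt (𝓡 2) q (γ s))) t = _ := h1.deriv
  have e : extChartAt (𝓡 2) q' (γ t) = transition q q' (extChartAt (𝓡 2) q (γ t)) :=
    he.self_of_nhds
  rw [chartState, he.deriv_eq, h2, e]
  rfl

omit [IsManifold (𝓡 2) ∞ M] [RiemannianBundle (fun x : M => TangentSpace (𝓡 2) x)]
  [IsContMDiffRiemannianBundle (𝓡 2) ∞ Plane (fun x : M => TangentSpace (𝓡 2) x)] in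
theorem mem_overlap {q q' p : M} (hq : p ∈ (extChartAt (𝓡 2) q).source)
    (hq' : p ∈ (extChartAt (𝓡 2) q').source) : extChartAt (𝓡 2) q p ∈ overlap q q' :=
  ⟨(extChartAt (𝓡 2) q).map_source hq, by
      simpa only [mem_preimage, (extChartAt (𝓡 2) q).left_inv hq] using hq'⟩

omit [IsContMDiffRiemannianBundle (𝓡 2) ∞ Plane (fun x : M => TangentSpace (𝓡 2) x)] in
theorem IsGeodesicAt.chartState_eq {q q' : M} {γ : ℝ → M} {t : ℝ} (h : IsGeodesicAt q γ t)
    (hq' : γ t ∈ (extChartAt (𝓡 2) q').source) :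
    chartState q' γ t = stateMap (transition q q') (chartState q γ t) :=
  have hd : HasDerivAt (fun s => (chartState q γ s).1) _ t := h.hasDerivAt.fst
  chartState_transition q q' h.continuousAt h.mem_source hq' hd.differentiableAt

/-- The notion of a geodesic does not depend on the chart. -/
theorem IsGeodesicAt.change {q q' : M} {γ : ℝ → M} {t : ℝ} (h : IsGeodesicAt q γ t)
    (hq' : γ t ∈ (extChartAt (𝓡 2) q').source) : IsGeodesicAt q' γ t := by
  have hmem : ∀ᶠ s in 𝓝 t, γ s ∈ (extChartAt (𝓡 2) q').source :=
    h.continuousAt.eventually ((isOpen_extChartAt_source q').mem_nhds hq')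
  have hiso := isIsometryOn_transition q q'
  have hst : ∀ᶠ s in 𝓝 t, chartState q' γ s = stateMap (transition q q') (chartState q γ s) := by
    filter_upwards [h.eventually, hmem] with s hs hs'
    exact hs.chartState_eq hs'
  filter_upwards [h.eventually, hmem, eventually_eventually_nhds.2 hst] with s hs hs' he
  have hov : (chartState q γ s).1 ∈ overlap q q' := mem_overlap hs.mem_source hs'
  refine ⟨hs', ?_, ?_⟩
  · rw [he.self_of_nhds, ← hiso.fderiv_stateMap_spray (isLeviCivita_chart q)
      (isLeviCivita_chart q') (fun _ hy => hy.1) hov]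
    exact ((hiso.hasFDerivAt_stateMap hov).comp_hasDerivAt s hs.hasDerivAt).congr_of_eventuallyEq he
  · rw [he.self_of_nhds, ← hs.speed]
    exact (hiso.pullback _ hov _ _).symm

theorem IsGeodesicOn.isGeodesicAt {γ : ℝ → M} {I : Set ℝ} (h : IsGeodesicOn γ I) {t : ℝ}
    (ht : t ∈ I) {q : M} (hq : γ t ∈ (extChartAt (𝓡 2) q).source) : IsGeodesicAt q γ t :=
  let ⟨_, h'⟩ := h t ht
  h'.change hq

omit [IsManifold (𝓡 2) ∞ M]
  [IsContMDiffRiemannianBundle (𝓡 2) ∞ Plane (fun x : M => TangentSpace (𝓡 2) x)] in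
theorem IsGeodesicAt.eq_symm {q : M} {γ : ℝ → M} {t : ℝ} (h : IsGeodesicAt q γ t) :
    γ t = (extChartAt (𝓡 2) q).symm (chartState q γ t).1 :=
  ((extChartAt (𝓡 2) q).left_inv h.mem_source).symm

/-- Geodesics with the same state coincide locally. -/
theorem IsGeodesicAt.eventuallyEq {q : M} {γ γ' : ℝ → M} {t : ℝ} (h : IsGeodesicAt q γ t)
    (h' : IsGeodesicAt q γ' t) (he : chartState q γ t = chartState q γ' t) : γ =ᶠ[𝓝 t] γ' := by
  have := (isLeviCivita_chart q).eventuallyEq_of_spray (h.mono fun s hs => hs.2.1)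
    (h'.mono fun s hs => hs.2.1) ((extChartAt (𝓡 2) q).map_source h.mem_source) he
  filter_upwards [this, h.eventually, h'.eventually] with s hs h1 h2
  rw [h1.eq_symm, h2.eq_symm, hs]

/-- Geodesics that coincide near one point coincide. -/
theorem IsGeodesicOn.eqOn {γ γ' : ℝ → M} {I : Set ℝ} (hI : IsPreconnected I)
    (h : IsGeodesicOn γ I) (h' : IsGeodesicOn γ' I) {t : ℝ} (ht : t ∈ I) (he : γ =ᶠ[𝓝 t] γ') :
    ∀ s ∈ I, γ =ᶠ[𝓝 s] γ' := by
  -- The set of local coincidence is open. At a limit point of it in `I` the states agree by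
  -- continuity, and local uniqueness applies.
  refine hI.subset_of_closure_inter_subset (u := {s | γ =ᶠ[𝓝 s] γ'})
    isOpen_setOfPred_eventually_nhds ⟨t, ht, he⟩ ?_
  rintro s ⟨hs, hsI⟩
  have hc := h.continuousAt hsI
  have hc' := h'.continuousAt hsI
  have hfr : ∃ᶠ u in 𝓝 s, γ =ᶠ[𝓝 u] γ' := mem_closure_iff_frequently.1 hs
  have heq : γ s = γ' s := tendsto_nhds_unique_of_frequently_eq hc hc'
    (hfr.mono fun u hu => hu.self_of_nhds)
  obtain ⟨q, hq⟩ := h s hsI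
  have hq' : IsGeodesicAt q γ' s := h'.isGeodesicAt hsI (heq ▸ hq.mem_source)
  refine hq.eventuallyEq hq' ?_
  exact tendsto_nhds_unique_of_frequently_eq hq.hasDerivAt.continuousAt
    hq'.hasDerivAt.continuousAt (hfr.mono fun u hu => (chartState_congr q hu).self_of_nhds)

end Geodesics

/-! ### Length of curves in a chart. -/

section Length

open Filter Manifold
open scoped Topology

variable {M : Type*} [MetricSpace M] [ChartedSpace Plane M] [IsManifold (𝓡 2) ∞ M]
  [RiemannianBundle (fun x : M => TangentSpace (𝓡 2) x)]

/-- The speed of a curve, computed in a chart. -/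
theorem enorm_mfderiv_eq (q : M) {γ : ℝ → M} {t : ℝ}
    (hγ : MDifferentiableAt 𝓘(ℝ) (𝓡 2) γ t) (hq : γ t ∈ (extChartAt (𝓡 2) q).source) :
    ‖mfderiv 𝓘(ℝ) (𝓡 2) γ t 1‖ₑ = ENNReal.ofReal (√(chartMetric q (extChartAt (𝓡 2) q (γ t))
      (deriv (fun s => extChartAt (𝓡 2) q (γ s)) t)
      (deriv (fun s => extChartAt (𝓡 2) q (γ s)) t))) ∧
    DifferentiableAt ℝ (fun s => extChartAt (𝓡 2) q (γ s)) t := by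
  have hsrc : γ t ∈ (chartAt Plane q).source := by rwa [extChartAt_source] at hq
  set c : ℝ → Plane := fun s => extChartAt (𝓡 2) q (γ s) with hc
  have hcd : MDifferentiableAt 𝓘(ℝ) (𝓡 2) c t :=
    MDifferentiableAt.comp t (mdifferentiableAt_extChartAt hsrc) hγ
  have hcd' : DifferentiableAt ℝ c t := hcd.differentiableAt
  refine ⟨?_, hcd'⟩
  have hct : c t ∈ (extChartAt (𝓡 2) q).target := (extChartAt (𝓡 2) q).map_source hq
  have hev : γ =ᶠ[𝓝 t] (extChartAt (𝓡 2) q).symm ∘ c := by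
    filter_upwards [hγ.continuousAt.eventually ((isOpen_extChartAt_source q).mem_nhds hq)]
      with s hs
    exact ((extChartAt (𝓡 2) q).left_inv hs).symm
  have hch := mfderiv_comp t (mdifferentiableAt_chart_symm q hct) hcd
  rw [← hev.mfderiv_eq, mfderiv_eq_fderiv] at hch
  have key : ∀ (p p' : M) (hp : p = p') (a : TangentSpace (𝓡 2) p)
      (a' : TangentSpace (𝓡 2) p'), (show Plane from a) = (show Plane from a') →
      ‖a‖ₑ = ‖a'‖ₑ := by
    rintro p _ rfl a a' h1
    have h1' : a = a' := h1
    rw [h1']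
  have h2 : ‖mfderiv 𝓘(ℝ) (𝓡 2) γ t 1‖ₑ = ‖coordMap q (c t) (deriv c t)‖ₑ := by
    refine key _ _ ((extChartAt (𝓡 2) q).left_inv hq).symm _ _ ?_
    exact congr($hch 1)
  rw [h2, chartMetric_apply, ← norm_eq_sqrt_real_inner, ofReal_norm]

variable [IsRiemannianManifold (𝓡 2) M]

/-- Upper bound for the distance by the length of a curve in a chart. -/
theorem dist_le_of_chart_curve (q : M) {c : ℝ → Plane} {a b L : ℝ} (hab : a ≤ b) (hL : 0 ≤ L)
    (hc : ContDiffOn ℝ 1 c (Icc a b)) (hct : ∀ t ∈ Icc a b, c t ∈ (extChartAt (𝓡 2) q).target)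
    (hbd : ∀ t ∈ Ioo a b, √(chartMetric q (c t) (deriv c t) (deriv c t)) ≤ L) :
    dist ((extChartAt (𝓡 2) q).symm (c a)) ((extChartAt (𝓡 2) q).symm (c b)) ≤ L * (b - a) := by
  set γ : ℝ → M := fun t => (extChartAt (𝓡 2) q).symm (c t) with hγ
  have hsm : ContMDiffOn 𝓘(ℝ) (𝓡 2) 1 γ (Icc a b) :=
    ((contMDiffOn_extChartAt_symm (I := 𝓡 2) (n := ∞) q).of_le (by norm_cast)).comp
      hc.contMDiffOn hct
  have h1 : edist (γ a) (γ b) ≤ ENNReal.ofReal (L * (b - a)) := by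
    rw [IsRiemannianManifold.out (I := 𝓡 2)]
    refine (riemannianEDist_le_pathELength hsm rfl rfl hab).trans ?_
    rw [pathELength_eq_lintegral_mfderiv_Ioo]
    calc ∫⁻ t in Ioo a b, ‖mfderiv 𝓘(ℝ) (𝓡 2) γ t 1‖ₑ
        ≤ ∫⁻ t in Ioo a b, ENNReal.ofReal L := by
          refine setLIntegral_mono measurable_const fun t ht => ?_
          have htI := Ioo_subset_Icc_self ht
          have hmd : MDifferentiableAt 𝓘(ℝ) (𝓡 2) γ t :=
            (hsm.contMDiffAt (Icc_mem_nhds ht.1 ht.2)).mdifferentiableAt (by simp)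
          rw [(enorm_mfderiv_eq q hmd ((extChartAt (𝓡 2) q).map_target (hct t htI))).1]
          have he : (fun s => extChartAt (𝓡 2) q (γ s)) =ᶠ[𝓝 t] c := by
            filter_upwards [Icc_mem_nhds ht.1 ht.2] with s hs
            exact (extChartAt (𝓡 2) q).right_inv (hct s hs)
          have e : extChartAt (𝓡 2) q (γ t) = c t := he.self_of_nhds
          rw [he.deriv_eq, e]
          exact ENNReal.ofReal_le_ofReal (hbd t ht)
      _ = ENNReal.ofReal (L * (b - a)) := by
          rw [setLIntegral_const, Real.volume_Ioo, ENNReal.ofReal_mul hL]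
  rw [edist_dist] at h1
  exact (ENNReal.ofReal_le_ofReal_iff (mul_nonneg hL (sub_nonneg.2 hab))).1 h1

end Length

/-! ### The Gauss lemma and normal neighborhoods. -/

section Gauss

open Filter Metric
open scoped Topology

variable {V : Type*} [NormedAddCommGroup V] [NormedSpace ℝ V]

theorem eq_of_hasDerivAt_zero {E : Type*} [NormedAddCommGroup E] [NormedSpace ℝ E] {f : ℝ → E}
    {a b s t : ℝ} (hf : ∀ u ∈ Ioo a b, HasDerivAt f 0 u) (hs : s ∈ Ioo a b) (ht : t ∈ Ioo a b) :
    f s = f t :=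
  isOpen_Ioo.is_const_of_deriv_eq_zero isPreconnected_Ioo
    (fun u hu => (hf u hu).differentiableAt.differentiableWithinAt)
    (fun u hu => (hf u hu).deriv) hs ht

theorem eq_add_smul_of_hasDerivAt {E : Type*} [NormedAddCommGroup E] [NormedSpace ℝ E] {f : ℝ → E}
    {a b t : ℝ} {v : E} (hf : ∀ u ∈ Ioo a b, HasDerivAt f v u) (h0 : (0 : ℝ) ∈ Ioo a b)
    (ht : t ∈ Ioo a b) : f t = f 0 + t • v := by
  have : f t - t • v = f 0 - (0 : ℝ) • v := by
    refine eq_of_hasDerivAt_zero (f := fun u => f u - u • v) (a := a) (b := b) (fun u hu => ?_) ht h0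
    simpa using (hf u hu).fun_sub ((hasDerivAt_id u).smul_const v)
  rw [zero_smul, sub_zero] at this
  rw [← this, sub_add_cancel]

namespace IsLeviCivita

variable {g : V → V →L[ℝ] V →L[ℝ] ℝ} {Γ : V → V →L[ℝ] V →L[ℝ] V} {Ω : Set V}
  (h : IsLeviCivita g Γ Ω) {z q : ℝ → V × V} {t : ℝ}

include h

/-- The Jacobi equation. -/
theorem hasDerivAt_covDeriv (hΩ : (z t).1 ∈ Ω) (hz : HasDerivAt z (spray Γ (z t)) t)
    (hq : HasDerivAt q (fderiv ℝ (spray Γ) (z t) (q t)) t) :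
    HasDerivAt (fun s => covDeriv Γ (z s) (q s))
      (-curvatureTensor Γ (z t).1 (q t).1 (z t).2 (z t).2
        - Γ (z t).1 (z t).2 (covDeriv Γ (z t) (q t))) t := by
  rw [h.fderiv_spray hΩ] at hq
  exact h.hasDerivAt_covariantDeriv (x := fun s => (z s).1) (v := fun s => (z s).2)
    (y := fun s => (q s).1) (z := fun s => (q s).2) hΩ hz.fst hz.snd hq.fst hq.snd

/-- By the Jacobi equation the derivative is `-⟨R(J, v) v, v⟩`, which vanishes because `R(J, v)` is
skew. Hence `⟨J, v⟩` is affine in time. -/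
theorem hasDerivAt_metric_covDeriv (hΩ : (z t).1 ∈ Ω) (hz : HasDerivAt z (spray Γ (z t)) t)
    (hq : HasDerivAt q (fderiv ℝ (spray Γ) (z t) (q t)) t) :
    HasDerivAt (fun s => g (z s).1 (covDeriv Γ (z s) (q s)) (z s).2) 0 t := by
  have := h.hasDerivAt_metric (c := fun s => (z s).1) (b := fun s => (z s).2) hΩ hz.fst
    (h.hasDerivAt_covDeriv hΩ hz hq) hz.snd
  convert! this using 1
  have hsk := h.curvatureTensor_skew hΩ (q t).1 (z t).2 (z t).2 (z t).2
  rw [h.symm _ hΩ (z t).2] at hsk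
  simp only [spray, sub_add_cancel, neg_add_cancel, map_neg, map_zero, neg_apply, add_zero]
  linarith

theorem hasDerivAt_metric_variation (hΩ : (z t).1 ∈ Ω) (hz : HasDerivAt z (spray Γ (z t)) t)
    (hq : HasDerivAt q (fderiv ℝ (spray Γ) (z t) (q t)) t) :
    HasDerivAt (fun s => g (z s).1 (q s).1 (z s).2)
      (g (z t).1 (covDeriv Γ (z t) (q t)) (z t).2) t := by
  rw [h.fderiv_spray hΩ] at hq
  have := h.hasDerivAt_metric (c := fun s => (z s).1) (a := fun s => (q s).1)
    (b := fun s => (z s).2) hΩ hz.fst hq.fst hz.snd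
  convert! this using 1
  simp [spray, covDeriv]

/-- The Gauss lemma. -/
theorem gauss {ε : ℝ} (hε : 0 < ε) (hΩ : ∀ s ∈ Ioo (-ε) ε, (z s).1 ∈ Ω)
    (hz : ∀ s ∈ Ioo (-ε) ε, HasDerivAt z (spray Γ (z s)) s)
    (hq : ∀ s ∈ Ioo (-ε) ε, HasDerivAt q (fderiv ℝ (spray Γ) (z s) (q s)) s)
    (h0 : (q 0).1 = 0) (ht : t ∈ Ioo (-ε) ε) :
    g (z t).1 (q t).1 (z t).2 = t * g (z 0).1 (q 0).2 (z 0).2 := by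
  have m0 : (0 : ℝ) ∈ Ioo (-ε) ε := by constructor <;> linarith
  have h1 : ∀ s ∈ Ioo (-ε) ε, HasDerivAt (fun s => g (z s).1 (q s).1 (z s).2)
      (g (z 0).1 (q 0).2 (z 0).2) s := by
    intro s hs
    have := h.hasDerivAt_metric_variation (hΩ s hs) (hz s hs) (hq s hs)
    have e : g (z s).1 (covDeriv Γ (z s) (q s)) (z s).2 =
        g (z 0).1 (covDeriv Γ (z 0) (q 0)) (z 0).2 :=
      eq_of_hasDerivAt_zero (f := fun s => g (z s).1 (covDeriv Γ (z s) (q s)) (z s).2)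
        (fun u hu => h.hasDerivAt_metric_covDeriv (hΩ u hu) (hz u hu) (hq u hu)) hs m0
    rw [e] at this
    simpa [covDeriv, h0] using this
  have := eq_add_smul_of_hasDerivAt h1 m0 ht
  simpa [h0] using this

theorem speed_eq {ε : ℝ} (hε : 0 < ε) (hΩ : ∀ s ∈ Ioo (-ε) ε, (z s).1 ∈ Ω)
    (hz : ∀ s ∈ Ioo (-ε) ε, HasDerivAt z (spray Γ (z s)) s) (ht : t ∈ Ioo (-ε) ε) :
    g (z t).1 (z t).2 (z t).2 = g (z 0).1 (z 0).2 (z 0).2 :=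
  eq_of_hasDerivAt_zero (f := fun s => g (z s).1 (z s).2 (z s).2)
    (fun u hu => h.hasDerivAt_speed (hz u hu) (hΩ u hu)) ht (by constructor <;> linarith)

/-- Geodesics emanating from points near `x₀` and reaching points near `x₀`. -/
theorem exists_normal_neighborhood [CompleteSpace V] {x₀ : V} (hx : x₀ ∈ Ω) :
    ∃ U ∈ 𝓝 x₀, U ⊆ Ω ∧ ∃ τ ε : ℝ, 0 < τ ∧ τ < ε ∧ ∃ (W : V → V → V) (z : V → V → ℝ → V × V),
      ∀ p ∈ U, ∀ y ∈ U, ContDiffAt ℝ 1 (W p) y ∧ W p p = 0 ∧ (W p y = 0 → p = y) ∧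
        (∀ c, τ * |g p (fderiv ℝ (W p) y c) (W p y)| ≤
          √(g y c c) * √(g p (W p y) (W p y))) ∧
        z p y 0 = (p, W p y) ∧ (z p y τ).1 = y ∧
        ∀ t ∈ Ioo (-ε) ε, (z p y t).1 ∈ Ω ∧ HasDerivAt (z p y) (spray Γ (z p y t)) t := by
  set z₀ : V × V := (x₀, 0)
  have hsp : ContDiffAt ℝ ∞ (spray Γ) z₀ := h.contDiffAt_spray hx
  obtain ⟨K, S, hS, hK⟩ := (hsp.of_le (m := 1) (by norm_cast)).exists_lipschitzOnWith
  have hΩ₀ : S ∩ Prod.fst ⁻¹' Ω ∈ 𝓝 z₀ :=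
    inter_mem hS (continuousAt_fst.preimage_mem_nhds (h.isOpen.mem_nhds hx))
  obtain ⟨r, hr, ε, hε, Φ, A, hΦ, hd⟩ :=
    exists_flow (hsp.of_le (m := 2) (by norm_cast)) hΩ₀
  have m0 : (0 : ℝ) ∈ Ioo (-ε) ε := by constructor <;> linarith
  -- equilibria
  have heq : ∀ p : V, ((p, 0) : V × V) ∈ ball z₀ r → ∀ t ∈ Ioo (-ε) ε, Φ (p, 0) t = (p, 0) := by
    intro p hp t ht
    obtain ⟨h0, -, h1⟩ := hΦ _ hp
    have hmem : ((p, 0) : V × V) ∈ S := by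
      have := (h1 0 m0).1.1
      rwa [h0] at this
    refine ODE_solution_unique_of_mem_Ioo (v := fun _ => spray Γ) (s := fun _ => S) (K := K)
      (fun _ _ => hK) m0 (fun s hs => ⟨(h1 s hs).2.1, (h1 s hs).1.1⟩)
      (g := fun _ => ((p, 0) : V × V)) (fun s hs => ⟨?_, hmem⟩) h0 ht
    have : spray Γ ((p, 0) : V × V) = 0 := by simp [spray]
    rw [this]
    exact hasDerivAt_const _ _
  have hz₀ : z₀ ∈ ball z₀ r := mem_ball_self hr
  set τ := ε / 2 with hτ
  have hτ0 : 0 < τ := by positivity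
  have hτε : τ < ε := by linarith
  have mτ : τ ∈ Ioo (-ε) ε := ⟨by linarith, hτε⟩
  have mτ' : τ ∈ Ioo 0 ε := ⟨hτ0, hτε⟩
  -- the flow map and its derivative at the base point
  have hA₀ : ∀ q, A z₀ τ q = (q.1 + τ • q.2, q.2) := by
    intro q
    obtain ⟨-, hA0, h1⟩ := hΦ _ hz₀
    have hder : ∀ s ∈ Ioo (-ε) ε, HasDerivAt (fun s => A z₀ s q) ((A z₀ s q).2, 0) s := by
      intro s hs
      have := (h1 s hs).2.2.clm_apply (hasDerivAt_const s q)
      rw [heq x₀ hz₀ s hs] at this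
      convert! this using 1
      simp [h.fderiv_spray (p := (x₀, 0)) hx]
    have h2 : ∀ s ∈ Ioo (-ε) ε, (A z₀ s q).2 = q.2 := by
      intro s hs
      have := eq_of_hasDerivAt_zero (f := fun s => (A z₀ s q).2) (fun u hu => (hder u hu).snd) hs m0
      simpa [hA0] using this
    have h3 := eq_add_smul_of_hasDerivAt (f := fun s => (A z₀ s q).1) (v := q.2)
      (fun u hu => by
        have h4 : HasDerivAt (fun s => (A z₀ s q).1) (A z₀ u q).2 u := (hder u hu).fst
        rwa [h2 u hu] at h4) m0 mτ
    refine Prod.ext ?_ (h2 τ mτ)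
    simpa [hA0] using h3
  -- `F` sends a point with a velocity to the two ends of the geodesic over time `τ`. At zero
  -- velocity its derivative is `(a, b) ↦ (a, a + τ b)`, so it is locally invertible, and `W p y` is
  -- the velocity that leads from `p` to `y`. A fixed small `τ` replaces time 1.
  let F : V × V → V × V := fun p => (p.1, (Φ p τ).1)
  have hcd : ContDiffAt ℝ 1 F z₀ := by
    refine contDiffAt_fst.prodMk (contDiffAt_fst.comp z₀ ?_)
    exact (hd z₀ hz₀ τ mτ').1.comp z₀ (contDiffAt_id.prodMk contDiffAt_const)
  have hΦd : ∀ p ∈ ball z₀ r, HasFDerivAt (fun p => Φ p τ) (A p τ) p := by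
    intro p hp
    have h1 : HasFDerivAt (𝕜 := ℝ) (fun p : V × V => (p, τ)) _ p :=
      (hasFDerivAt_id p).prodMk (hasFDerivAt_const τ p)
    have := (hd p hp τ mτ').2.hasFDerivAt.comp p h1
    convert! this using 1
    ext x <;> simp
  let L : (V × V) ≃L[ℝ] (V × V) := ContinuousLinearEquiv.equivOfInverse
    ((ContinuousLinearMap.fst ℝ V V).prod
      (ContinuousLinearMap.fst ℝ V V + τ • ContinuousLinearMap.snd ℝ V V))
    ((ContinuousLinearMap.fst ℝ V V).prod
      (τ⁻¹ • (ContinuousLinearMap.snd ℝ V V - ContinuousLinearMap.fst ℝ V V)))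
    (fun x => by simp [hτ0.ne']) (fun x => by simp [hτ0.ne'])
  have hFd : HasFDerivAt F (L : V × V →L[ℝ] V × V) z₀ := by
    have := (hasFDerivAt_fst (𝕜 := ℝ) (p := z₀)).prodMk (hΦd z₀ hz₀).fst
    convert! this using 1
    ext x <;> simp [L, hA₀]
  have hFz : F z₀ = (x₀, x₀) := by simp only [F, z₀, heq x₀ hz₀ τ mτ]
  let G := hcd.localInverse hFd one_ne_zero
  have hG : ContDiffAt ℝ 1 G (F z₀) := hcd.to_localInverse hFd one_ne_zero
  have hst := hcd.hasStrictFDerivAt' hFd one_ne_zero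
  have hri : ∀ᶠ p in 𝓝 (F z₀), F (G p) = p := hst.eventually_right_inverse
  have hli : ∀ᶠ p in 𝓝 z₀, G (F p) = p := hst.eventually_left_inverse
  have hGz : G (F z₀) = z₀ := hcd.localInverse_apply_image hFd one_ne_zero
  have hball : ∀ᶠ p in 𝓝 (F z₀), G p ∈ ball z₀ r :=
    hG.continuousAt.eventually (by rw [hGz]; exact ball_mem_nhds _ hr)
  have hall := ((hG.eventually (by simp)).and (hri.and hball)).eventually_nhds
  rw [hFz] at hall
  obtain ⟨U₁, hU₁, U₂, hU₂, hU⟩ := eventually_prod_iff.1 (nhds_prod_eq (x := x₀) (y := x₀) ▸ hall)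
  have hdiag : ∀ᶠ p in 𝓝 x₀, G (F (p, 0)) = (p, 0) ∧ ((p, 0) : V × V) ∈ ball z₀ r := by
    have hc : Tendsto (fun p : V => ((p, 0) : V × V)) (𝓝 x₀) (𝓝 z₀) :=
      (continuous_id.prodMk continuous_const).tendsto x₀
    exact (hc.eventually hli).and (hc.eventually (ball_mem_nhds _ hr))
  refine ⟨{p | U₁ p ∧ U₂ p ∧ (G (F (p, 0)) = (p, 0) ∧ ((p, 0) : V × V) ∈ ball z₀ r) ∧ p ∈ Ω},
    hU₁.and (hU₂.and (hdiag.and (h.isOpen.mem_nhds hx))), fun p hp => hp.2.2.2, τ, ε, hτ0, hτε,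
    fun p y => (G (p, y)).2, fun p y => Φ (p, (G (p, y)).2), ?_⟩
  rintro p ⟨hp1, -, ⟨hp3, hp4⟩, hpΩ⟩ y ⟨-, hy2, -, hyΩ⟩
  have hpy := hU hp1 hy2
  obtain ⟨hGc, hGr, hGb⟩ := hpy.self_of_nhds
  have hG1 : G (p, y) = (p, (G (p, y)).2) :=
    Prod.ext (by have := congrArg Prod.fst hGr; exact this) rfl
  rw [hG1] at hGb hGr
  have hFp : F (p, 0) = (p, p) := by simp only [F, heq p hp4 τ mτ]
  have hWc : ContDiffAt ℝ 1 (fun y => (G (p, y)).2) y :=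
    contDiffAt_snd.comp y (hGc.comp y (contDiffAt_const.prodMk contDiffAt_id))
  obtain ⟨hΦ0, hA0, hΦt⟩ := hΦ _ hGb
  have hy : (Φ (p, (G (p, y)).2) τ).1 = y := congrArg Prod.snd hGr
  refine ⟨hWc, ?_, ?_, ?_, hΦ0, hy, fun t ht => ⟨(hΦt t ht).1.2, (hΦt t ht).2.1⟩⟩
  · rw [hFp] at hp3
    exact congrArg Prod.snd hp3
  · intro h0
    replace h0 : (G (p, y)).2 = 0 := h0
    rw [h0, heq p hp4 τ mτ] at hy
    exact hy
  · intro c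
    set w := (G (p, y)).2
    set D := fderiv ℝ (fun y => (G (p, y)).2) y
    have hWd : HasFDerivAt (fun y => (G (p, y)).2) D y :=
      (hWc.differentiableAt (by simp)).hasFDerivAt
    -- The geodesic with velocity `W p y` ends at `y` for all nearby `y`. Differentiating in
    -- direction `c`, the Jacobi field with initial value 0 and initial derivative `D c` equals `c`
    -- at time `τ`.
    have hid : (A (p, w) τ (0, D c)).1 = c := by
      have h1 : HasFDerivAt (fun y => (Φ (p, (G (p, y)).2) τ).1) _ y :=
        ((hΦd (p, w) hGb).comp y ((hasFDerivAt_const p y).prodMk hWd)).fst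
      have h2 : (fun y => (Φ (p, (G (p, y)).2) τ).1) =ᶠ[𝓝 y] id := by
        have hc : Tendsto (fun y : V => ((p, y) : V × V)) (𝓝 y) (𝓝 (p, y)) :=
          (continuous_const.prodMk continuous_id).tendsto y
        filter_upwards [hc.eventually hpy] with u hu
        have e : G (p, u) = (p, (G (p, u)).2) := 
          Prod.ext (by have := congrArg Prod.fst hu.2.1; exact this) rfl
        rw [← e]
        exact congrArg Prod.snd hu.2.1
      have h3 := h1.unique ((hasFDerivAt_id y).congr_of_eventuallyEq h2)
      simpa using congr($h3 c)
    -- For this field the Gauss lemma reads `⟨c, v(τ)⟩ = τ ⟨D c, w⟩`. Cauchy–Schwarz and constancy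
    -- of the speed finish: the norm of `W p` has gradient at most `1 / τ`.
    have hga := h.gauss (z := Φ (p, w)) (q := fun t => A (p, w) t (0, D c)) hε
      (fun s hs => (hΦt s hs).1.2) (fun s hs => (hΦt s hs).2.1)
      (fun s hs => by simpa using (hΦt s hs).2.2.clm_apply (hasDerivAt_const s ((0, D c) : V × V)))
      (by simp [hA0]) mτ
    have hsp := h.speed_eq (z := Φ (p, w)) hε
      (fun s hs => (hΦt s hs).1.2) (fun s hs => (hΦt s hs).2.1) mτ
    simp only [hΦ0, hA0, hy, hid, ContinuousLinearMap.id_apply] at hga hsp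
    rw [← abs_of_pos hτ0, ← abs_mul, ← hga, ← hsp]
    exact h.abs_le_sqrt_mul_sqrt hyΩ _ _

end IsLeviCivita

end Gauss

/-! ### The distance as a length distance; properness. -/

section Paths

open Filter Manifold Metric
open scoped Topology

variable {M : Type*} [MetricSpace M] [ChartedSpace Plane M]
  [RiemannianBundle (fun x : M => TangentSpace (𝓡 2) x)] [IsRiemannianManifold (𝓡 2) M]

theorem exists_path {P Y : M} {r : ℝ} (h : dist P Y < r) :
    ∃ γ : ℝ → M, γ 0 = P ∧ γ 1 = Y ∧ ContMDiff 𝓘(ℝ) (𝓡 2) 1 γ ∧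
      pathELength (𝓡 2) γ 0 1 < ENNReal.ofReal r := by
  have h1 : riemannianEDist (𝓡 2) P Y < ENNReal.ofReal r := by
    rw [← IsRiemannianManifold.out (I := 𝓡 2), edist_dist]
    exact (ENNReal.ofReal_lt_ofReal_iff (dist_nonneg.trans_lt h)).2 h
  obtain ⟨γ, h0, h1, hγ, hl, -⟩ :=
    exists_lt_locally_constant_of_riemannianEDist_lt h1 (zero_lt_one (α := ℝ))
  exact ⟨γ, h0, h1, hγ, hl⟩

theorem edist_le_pathELength {γ : ℝ → M} (hγ : ContMDiff 𝓘(ℝ) (𝓡 2) 1 γ) {a b : ℝ} (hab : a ≤ b) :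
    edist (γ a) (γ b) ≤ pathELength (𝓡 2) γ a b := by
  rw [IsRiemannianManifold.out (I := 𝓡 2)]
  exact riemannianEDist_le_pathELength hγ.contMDiffOn rfl rfl hab

theorem dist_lt_of_pathELength_lt {γ : ℝ → M} (hγ : ContMDiff 𝓘(ℝ) (𝓡 2) 1 γ) {r : ℝ}
    (hl : pathELength (𝓡 2) γ 0 1 < ENNReal.ofReal r) {a b : ℝ} (ha : 0 ≤ a) (hab : a ≤ b)
    (hb : b ≤ 1) : dist (γ a) (γ b) < r := by
  have h1 := (edist_le_pathELength hγ hab).trans_lt ((pathELength_mono ha hb).trans_lt hl)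
  rw [edist_dist] at h1
  exact (ENNReal.ofReal_lt_ofReal_iff_of_nonneg dist_nonneg).1 h1

/-- The distance is a length distance. -/
theorem exists_dist_le_dist_lt {p x : M} {r δ : ℝ} (hr : 0 ≤ r) (hδ : 0 < δ)
    (h : dist p x < r + δ) : ∃ y, dist p y ≤ r ∧ dist y x < δ := by
  by_cases hx : dist p x ≤ r
  · exact ⟨x, hx, by simpa using hδ⟩
  obtain ⟨γ, h0, h1, hγ, hl⟩ := exists_path h
  have hc : ContinuousOn (fun t => dist p (γ t)) (Icc 0 1) :=
    (continuous_const.dist hγ.continuous).continuousOn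
  obtain ⟨t, ht, htr⟩ := intermediate_value_Icc zero_le_one hc
    (show r ∈ Icc (dist p (γ 0)) (dist p (γ 1)) by
      rw [h0, h1, dist_self]; exact ⟨hr, (not_le.1 hx).le⟩)
  refine ⟨γ t, htr.le, ?_⟩
  have e1 := edist_le_pathELength hγ ht.1
  have e2 := edist_le_pathELength hγ ht.2
  rw [h0] at e1
  rw [h1] at e2
  have e3 : edist p (γ t) + edist (γ t) x < ENNReal.ofReal (r + δ) :=
    (add_le_add e1 e2).trans_lt (by rwa [pathELength_add ht.1 ht.2])
  have htr' : dist p (γ t) = r := htr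
  rw [edist_dist, edist_dist, ← ENNReal.ofReal_add dist_nonneg dist_nonneg,
    ENNReal.ofReal_lt_ofReal_iff_of_nonneg (by positivity), htr'] at e3
  linarith

variable (M) in
/-- The Hopf–Rinow theorem: a complete surface is proper. -/
theorem properSpace_of_complete [CompleteSpace M] : ProperSpace M := by
  have : LocallyCompactSpace M := ChartedSpace.locallyCompactSpace Plane M
  refine ⟨fun p r => ?_⟩
  by_contra hr
  set S : Set ℝ := {s | IsCompact (closedBall p s)} with hS
  have hdown : ∀ s ∈ S, ∀ s' ≤ s, s' ∈ S := fun s hs s' hs' =>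
    hs.of_isClosed_subset isClosed_closedBall (closedBall_subset_closedBall hs')
  have hbd : ∀ s ∈ S, s ≤ r := fun s hs => by
    by_contra! h
    exact hr (hdown s hs r h.le)
  have h0 : (0 : ℝ) ∈ S := by simp [hS]
  have hba : BddAbove S := ⟨r, hbd⟩
  set R := sSup S with hR
  have hR0 : 0 ≤ R := le_csSup hba h0
  have hlt : ∀ s < R, s ∈ S := fun s hs => by
    obtain ⟨s', hs', h⟩ := exists_lt_of_lt_csSup ⟨0, h0⟩ hs
    exact hdown s' hs' s h.le
  have hRS : R ∈ S := by
    -- For `R > 0`, every point of the ball of radius `R` is within `2δ ≤ ε / 2` of the compact ball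
    -- of radius `R - δ`, because the distance is a length. So an `ε / 2`-net of the smaller ball is
    -- an `ε`-net of the larger one.
    rcases hR0.eq_or_lt with h | hpos
    · rwa [← h]
    refine (TotallyBounded.isCompact_of_isClosed ?_ isClosed_closedBall)
    refine totallyBounded_iff.2 fun ε hε => ?_
    set δ := min (ε / 4) (R / 2) with hδ
    have hδ0 : 0 < δ := by positivity
    have hδ1 : δ ≤ ε / 4 := min_le_left _ _
    have hδ2 : δ ≤ R / 2 := min_le_right _ _
    obtain ⟨t, ht, hcov⟩ := totallyBounded_iff.1 (hlt (R - δ) (by linarith)).totallyBounded (ε / 2)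
      (by positivity)
    refine ⟨t, ht, fun x hx => ?_⟩
    rw [mem_closedBall, dist_comm] at hx
    obtain ⟨y, hy, hyx⟩ := exists_dist_le_dist_lt (p := p) (x := x) (r := R - δ) (δ := 2 * δ)
      (by linarith) (by linarith) (by linarith)
    obtain ⟨c, hc, hyc⟩ := mem_iUnion₂.1 (hcov (show y ∈ closedBall p (R - δ) by
      rwa [mem_closedBall, dist_comm]))
    refine mem_iUnion₂.2 ⟨c, hc, ?_⟩
    rw [mem_ball] at hyc ⊢
    have := dist_triangle x y c
    rw [dist_comm x y] at this
    linarith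
  -- Local compactness lets the compact ball grow a little, which contradicts the choice of `R` as
  -- supremum.
  obtain ⟨δ, hδ, hcomp⟩ := hRS.exists_isCompact_cthickening
  have : R + δ / 2 ∈ S := by
    refine hcomp.of_isClosed_subset isClosed_closedBall fun x hx => ?_
    rw [mem_closedBall, dist_comm] at hx
    obtain ⟨y, hy, hyx⟩ := exists_dist_le_dist_lt (p := p) (x := x) hR0 hδ (by linarith)
    refine thickening_subset_cthickening _ _ (mem_thickening_iff.2 ⟨y, ?_, by rwa [dist_comm]⟩)
    rwa [mem_closedBall, dist_comm]
  have := le_csSup hba this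
  linarith

/-- Take the point of the compact ball of radius `s` about `a` that is nearest to `x`; nearly
shortest paths show that it is no farther from `x` than `dist a x - s`. -/
theorem exists_dist_eq [ProperSpace M] {a x : M} {s : ℝ} (hs : 0 ≤ s) (hsd : s ≤ dist a x) :
    ∃ y, dist a y = s ∧ dist y x = dist a x - s := by
  obtain ⟨y, hy, hmin⟩ := (isCompact_closedBall a s).exists_isMinOn ⟨a, mem_closedBall_self hs⟩
    (continuous_id.dist (continuous_const (y := x))).continuousOn
  have h1 : dist y x ≤ dist a x - s := by
    refine le_of_forall_pos_le_add fun δ hδ => ?_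
    obtain ⟨u, hu, hux⟩ := exists_dist_le_dist_lt (p := a) (x := x) (r := s)
      (δ := dist a x - s + δ) hs (by linarith) (by linarith)
    have := isMinOn_iff.1 hmin u (by rwa [mem_closedBall, dist_comm])
    exact this.trans hux.le
  have h2 := dist_triangle a y x
  rw [mem_closedBall, dist_comm] at hy
  exact ⟨y, by linarith, by linarith⟩

end Paths

/-! ### Short geodesics are minimizing. -/

section Minimizers

open Filter Manifold Metric
open scoped Topology

variable {M : Type*} [MetricSpace M] [ChartedSpace Plane M] [IsManifold (𝓡 2) ∞ M]
  [RiemannianBundle (fun x : M => TangentSpace (𝓡 2) x)] [IsRiemannianManifold (𝓡 2) M]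

/-- A function whose gradient is at most `L` is `L`-Lipschitz. -/
theorem sub_le_of_gradient_le (q : M) {f : Plane → ℝ} {P Y : M} {r L : ℝ} (hL : 0 ≤ L)
    (hf : ∀ x, dist P x < r → x ∈ (extChartAt (𝓡 2) q).source ∧
      ContDiffAt ℝ 1 f (extChartAt (𝓡 2) q x) ∧
      ∀ c, |fderiv ℝ f (extChartAt (𝓡 2) q x) c| ≤
        L * √(chartMetric q (extChartAt (𝓡 2) q x) c c))
    (hY : dist P Y < r) :
    f (extChartAt (𝓡 2) q Y) - f (extChartAt (𝓡 2) q P) ≤ L * dist P Y := by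
  have key : ∀ r' ∈ Ioo (dist P Y) r,
      f (extChartAt (𝓡 2) q Y) - f (extChartAt (𝓡 2) q P) ≤ L * r' := by
    rintro r' ⟨h1, h2⟩
    obtain ⟨γ, h0, h1', hγ, hl⟩ := exists_path h1
    -- A path of length below `r' < r` cannot leave the ball where the gradient bound is known.
    have hin : ∀ t ∈ Icc (0 : ℝ) 1, dist P (γ t) < r := fun t ht => by
      have := dist_lt_of_pathELength_lt hγ hl le_rfl ht.1 ht.2
      rw [h0] at this
      linarith
    have hcd : ContDiffOn ℝ 1 (fun t => f (extChartAt (𝓡 2) q (γ t))) (Icc 0 1) := by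
      intro t ht
      obtain ⟨hs, hft, -⟩ := hf _ (hin t ht)
      have hs' : γ t ∈ (chartAt Plane q).source := by rwa [extChartAt_source] at hs
      have hc1 : ContMDiffAt 𝓘(ℝ) (𝓡 2) 1 (fun t => extChartAt (𝓡 2) q (γ t)) t :=
        ((contMDiffAt_extChartAt' (n := ∞) hs').of_le (by norm_cast)).comp t (hγ t)
      exact (hft.comp t hc1.contDiffAt).contDiffWithinAt
    have hle := enorm_sub_le_lintegral_deriv_of_contDiffOn_Icc hcd zero_le_one
    have hbound : ∫⁻ t in Icc (0 : ℝ) 1, ‖deriv (fun t => f (extChartAt (𝓡 2) q (γ t))) t‖ₑ ≤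
        ENNReal.ofReal L * pathELength (𝓡 2) γ 0 1 := by
      rw [pathELength_eq_lintegral_mfderiv_Icc, ← lintegral_const_mul' _ _ ENNReal.ofReal_ne_top]
      refine setLIntegral_mono' measurableSet_Icc fun t ht => ?_
      obtain ⟨hs, hft, hgr⟩ := hf _ (hin t ht)
      obtain ⟨he, hd⟩ := enorm_mfderiv_eq q ((hγ t).mdifferentiableAt (by simp)) hs
      have hfd : HasFDerivAt f (fderiv ℝ f (extChartAt (𝓡 2) q (γ t))) (extChartAt (𝓡 2) q (γ t)) :=
        (hft.differentiableAt (by simp)).hasFDerivAt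
      have hd' : deriv (fun t => f (extChartAt (𝓡 2) q (γ t))) t = _ :=
        (hfd.comp_hasDerivAt t hd.hasDerivAt).deriv
      rw [he, hd', ← ENNReal.ofReal_mul hL, Real.enorm_eq_ofReal_abs]
      exact ENNReal.ofReal_le_ofReal (hgr _)
    have h3 := (hle.trans hbound).trans (mul_le_mul_right hl.le (ENNReal.ofReal L))
    rw [← ENNReal.ofReal_mul hL, Real.enorm_eq_ofReal_abs, h0, h1',
      ENNReal.ofReal_le_ofReal_iff (mul_nonneg hL (dist_nonneg.trans h1.le))] at h3
    exact (le_abs_self _).trans h3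
  have ht : Tendsto (fun r' => L * r') (𝓝[>] dist P Y) (𝓝 (L * dist P Y)) :=
    ((continuous_const.mul continuous_id).tendsto _).mono_left nhdsWithin_le_nhds
  exact ge_of_tendsto ht (by
    filter_upwards [Ioo_mem_nhdsGT hY] with r' hr' using key r' hr')

theorem IsGeodesicAt.contDiffAt {M : Type*} [MetricSpace M] [ChartedSpace Plane M]
    [RiemannianBundle (fun x : M => TangentSpace (𝓡 2) x)] {q : M} {γ : ℝ → M} {t : ℝ}
    (h : IsGeodesicAt q γ t) :
    ContDiffAt ℝ 1 (fun s => (chartState q γ s).1) t := by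
  obtain ⟨u, hu, hus⟩ := h.exists_mem
  refine contDiffAt_one_iff.2 ⟨fun s => ContinuousLinearMap.toSpanSingleton ℝ (chartState q γ s).2,
    u, hu, ?_, ?_⟩
  · intro s hs
    have hc : ContinuousAt (fun s => (chartState q γ s).2) s :=
      ((hus s hs).2.1.continuousAt).snd
    exact ((ContinuousLinearMap.toSpanSingletonCLE (𝕜 := ℝ)).continuous.continuousAt.comp
      hc).continuousWithinAt
  · intro s hs
    have : HasDerivAt (fun s => (chartState q γ s).1) (chartState q γ s).2 s := (hus s hs).2.1.fst
    exact this.hasFDerivAt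

theorem dist_le_of_isGeodesicAt {q : M} {γ : ℝ → M} {a b : ℝ} (hab : a ≤ b)
    (h : ∀ t ∈ Icc a b, IsGeodesicAt q γ t) : dist (γ a) (γ b) ≤ b - a := by
  have h1 := dist_le_of_chart_curve q (c := fun s => (chartState q γ s).1) hab zero_le_one
    (fun t ht => (h t ht).contDiffAt.contDiffWithinAt)
    (fun t ht => (extChartAt (𝓡 2) q).map_source (h t ht).mem_source) (fun t ht => by
      have ht' := h t (Ioo_subset_Icc_self ht)
      have hd : HasDerivAt (fun s => (chartState q γ s).1) (chartState q γ t).2 t :=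
        ht'.hasDerivAt.fst
      rw [hd.deriv, ht'.speed, Real.sqrt_one])
  rw [← (h a (left_mem_Icc.2 hab)).eq_symm, ← (h b (right_mem_Icc.2 hab)).eq_symm] at h1
  simpa using h1

variable [IsContMDiffRiemannianBundle (𝓡 2) ∞ Plane (fun x : M => TangentSpace (𝓡 2) x)]

/-- Points close to a given point are joined by minimizing geodesics. -/
theorem exists_local_minimizer (q : M) : ∃ ρ > 0, ∀ P ∈ ball q ρ, ∀ Y ∈ ball q ρ, P ≠ Y →
    ∃ (σ : ℝ → M) (η : ℝ), 0 < η ∧ IsGeodesicOn σ (Ioo (-η) (dist P Y + η)) ∧ σ 0 = P ∧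
      σ (dist P Y) = Y ∧
      ∀ s ∈ Icc 0 (dist P Y), dist P (σ s) ≤ s ∧ dist (σ s) Y ≤ dist P Y - s := by
  have hLC := isLeviCivita_chart q
  obtain ⟨U, hU, hUt, τ, ε, hτ, hτε, W, z, hall⟩ :=
    hLC.exists_normal_neighborhood (mem_extChartAt_target q)
  have hpre : (extChartAt (𝓡 2) q).source ∩ extChartAt (𝓡 2) q ⁻¹' U ∈ 𝓝 q :=
    inter_mem (extChartAt_source_mem_nhds q) ((continuousAt_extChartAt q).preimage_mem_nhds hU)
  obtain ⟨R, hR, hball⟩ := Metric.mem_nhds_iff.1 hpre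
  -- With radius `R / 3`, the ball of radius `2R / 3` about `P` contains `Y` and stays inside `ball
  -- q R`, where `W p` is controlled.
  refine ⟨R / 3, by positivity, fun P hP Y hY hne => ?_⟩
  rw [mem_ball] at hP hY
  have hPm := hball (show P ∈ ball q R by rw [mem_ball]; linarith)
  have hYm := hball (show Y ∈ ball q R by rw [mem_ball]; linarith)
  set p := extChartAt (𝓡 2) q P with hp
  set y := extChartAt (𝓡 2) q Y with hy
  have hpt := hUt hPm.2
  obtain ⟨-, -, hWne, -, hz0, hzτ, hz⟩ := hall p hPm.2 y hYm.2
  have hW : W p y ≠ 0 := fun h0 => hne ((extChartAt (𝓡 2) q).injOn hPm.1 hYm.1 (hWne h0))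
  set ℓ := √(chartMetric q p (W p y) (W p y)) with hℓ
  have hℓ0 : 0 < ℓ := Real.sqrt_pos.2 (hLC.pos p hpt _ hW)
  have hℓ2 : ℓ ^ 2 = chartMetric q p (W p y) (W p y) := Real.sq_sqrt (hLC.nonneg hpt _)
  have hτε' : τ ∈ Ioo (-ε) ε := ⟨by linarith, hτε⟩
  -- the rescaled geodesic
  set zt : ℝ → Plane × Plane := fun s => ((z p y (s / ℓ)).1, ℓ⁻¹ • (z p y (s / ℓ)).2) with hzt
  have hdom : ∀ s ∈ Ioo (-(ε * ℓ)) (ε * ℓ), s / ℓ ∈ Ioo (-ε) ε := fun s hs =>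
    ⟨by rw [lt_div_iff₀ hℓ0]; linarith [hs.1], by rw [div_lt_iff₀ hℓ0]; exact hs.2⟩
  have hztd : ∀ s ∈ Ioo (-(ε * ℓ)) (ε * ℓ), (zt s).1 ∈ (extChartAt (𝓡 2) q).target ∧
      HasDerivAt zt (spray (chartSymbol q) (zt s)) s ∧
      chartMetric q (zt s).1 (zt s).2 (zt s).2 = 1 := by
    intro s hs
    obtain ⟨h1, h2⟩ := hz _ (hdom s hs)
    have h3 : HasDerivAt (fun s => z p y (s / ℓ)) _ s :=
      h2.scomp s ((hasDerivAt_id s).div_const ℓ)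
    refine ⟨h1, ?_, ?_⟩
    · have h4 : HasDerivAt (fun s => (z p y (s / ℓ)).1) _ s := h3.fst
      have h5 : HasDerivAt (fun s => (z p y (s / ℓ)).2) _ s := h3.snd
      have h6 : HasDerivAt zt _ s := h4.prodMk (h5.const_smul ℓ⁻¹)
      convert! h6 using 1
      simp [spray, hzt]
    · have hsp := hLC.speed_eq (hτ.trans hτε) (fun u hu => (hz u hu).1) (fun u hu => (hz u hu).2)
        (hdom s hs)
      simp only [hz0] at hsp
      simp only [hzt, map_smul, smul_apply, smul_eq_mul, hsp, ← hℓ2]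
      field_simp
  set σ : ℝ → M := fun s => (extChartAt (𝓡 2) q).symm (zt s).1 with hσ
  have hgeo : ∀ s ∈ Ioo (-(ε * ℓ)) (ε * ℓ), IsGeodesicAt q σ s := fun s hs =>
    (isGeodesicAt_of_hasDerivAt q (by
      filter_upwards [Ioo_mem_nhds hs.1 hs.2] with u hu using hztd u hu)).1
  have hεℓ : 0 < ε * ℓ := mul_pos (hτ.trans hτε) hℓ0
  have hlt : τ * ℓ < ε * ℓ := mul_lt_mul_of_pos_right hτε hℓ0
  have hτℓ : 0 < τ * ℓ := mul_pos hτ hℓ0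
  have hσ0 : σ 0 = P := by
    simp only [hσ, hzt, zero_div, hz0]
    exact (extChartAt (𝓡 2) q).left_inv hPm.1
  have hσd : σ (τ * ℓ) = Y := by
    simp only [hσ, hzt, mul_div_cancel_right₀ _ hℓ0.ne', hzτ]
    exact (extChartAt (𝓡 2) q).left_inv hYm.1
  have hdist : ∀ a b, 0 ≤ a → a ≤ b → b ≤ τ * ℓ → dist (σ a) (σ b) ≤ b - a :=
    fun a b ha hab hb => dist_le_of_isGeodesicAt (q := q) hab fun t ht =>
      hgeo t ⟨by linarith [ht.1], by linarith [ht.2]⟩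
  -- the length is the distance
  have hd : dist P Y = τ * ℓ := by
    refine le_antisymm ?_ ?_
    · have := hdist 0 (τ * ℓ) le_rfl hτℓ.le le_rfl
      rwa [hσ0, hσd, sub_zero] at this
    · refine le_of_forall_pos_le_add fun δ hδ => ?_
      set B := chartMetric q p with hB
      have hBn : ∀ u, 0 ≤ B u u := hLC.nonneg hpt
      set δ' := δ / τ with hδ'
      have hδ'0 : 0 < δ' := by positivity
      -- The norm of `W p` is not smooth at `p`, where `W p` vanishes, so it is regularised by `δ'`.
      -- Its gradient bound `1 / τ` from the Gauss lemma gives `ℓ - δ' ≤ dist P Y / τ`, that is, `τ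
      -- ℓ ≤ dist P Y + δ`.
      set f : Plane → ℝ := fun u => √(B (W p u) (W p u) + δ' ^ 2) with hf
      have hpos : ∀ u, 0 < B (W p u) (W p u) + δ' ^ 2 := fun u =>
        add_pos_of_nonneg_of_pos (hBn _) (by positivity)
      have hPY : dist P Y < 2 * R / 3 := by
        have := dist_triangle_right P Y q
        linarith
      have hlip := sub_le_of_gradient_le q (f := f) (P := P) (Y := Y) (r := 2 * R / 3) (L := τ⁻¹)
        (by positivity) (fun x hx => ?_) hPY
      · obtain ⟨-, hWp, -⟩ := hall p hPm.2 p hPm.2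
        have e1 : f p = δ' := by
          simp only [hf, hWp, map_zero, zero_add, Real.sqrt_sq hδ'0.le]
        have e2 : ℓ ≤ f y := Real.sqrt_le_sqrt (by nlinarith)
        rw [e1] at hlip
        have h4 : ℓ ≤ τ⁻¹ * dist P Y + δ / τ := by linarith
        have h5 := mul_le_mul_of_nonneg_left h4 hτ.le
        calc τ * ℓ ≤ _ := h5
          _ = dist P Y + δ := by field_simp
      · have hxm := hball (show x ∈ ball q R by
          rw [mem_ball]
          have := dist_triangle x P q
          rw [dist_comm x P] at this
          linarith)
        set u := extChartAt (𝓡 2) q x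
        obtain ⟨hWc, -, -, hgr, -⟩ := hall p hPm.2 u hxm.2
        have hWd : HasFDerivAt (W p) (fderiv ℝ (W p) u) u :=
          (hWc.differentiableAt (by simp)).hasFDerivAt
        have hBc : ContDiffAt ℝ 1 (fun u => B (W p u) (W p u) + δ' ^ 2) u :=
          ((contDiffAt_const.clm_apply hWc).clm_apply hWc).add contDiffAt_const
        refine ⟨hxm.1, hBc.sqrt (hpos u).ne', fun c => ?_⟩
        have hBd : HasFDerivAt (fun u => B (W p u) (W p u) + δ' ^ 2) _ u :=
          ((((hasFDerivAt_const B u).clm_apply hWd).clm_apply hWd).add_const _)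
        have hfd : fderiv ℝ f u = _ := (hBd.sqrt (hpos u).ne').fderiv
        have e3 : fderiv ℝ f u c = (f u)⁻¹ * B (fderiv ℝ (W p) u c) (W p u) := by
          rw [hfd]
          simp [hf, hB, hLC.symm p hpt (W p u) (fderiv ℝ (W p) u c)]
          ring
        have hfu : 0 < f u := Real.sqrt_pos.2 (hpos u)
        have h6 := hgr c
        have h7 : √(B (W p u) (W p u)) ≤ f u := Real.sqrt_le_sqrt (by nlinarith)
        have h8 : τ * |B (fderiv ℝ (W p) u c) (W p u)| ≤ √(chartMetric q u c c) * f u :=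
          h6.trans (mul_le_mul_of_nonneg_left h7 (Real.sqrt_nonneg _))
        rw [e3, abs_mul, abs_of_pos (inv_pos.2 hfu), inv_mul_le_iff₀ hfu]
        rw [← le_div_iff₀' hτ] at h8
        refine h8.trans_eq ?_
        field_simp
  refine ⟨σ, ε * ℓ - τ * ℓ, by linarith, fun s hs => ⟨q, hgeo s ⟨?_, ?_⟩⟩, hσ0, hd ▸ hσd, ?_⟩
  · linarith [hs.1]
  · rw [hd] at hs
    linarith [hs.2]
  · intro s hs
    rw [hd] at hs ⊢
    constructor
    · simpa [hσ0] using hdist 0 s le_rfl hs.1 hs.2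
    · simpa [hσd] using hdist s (τ * ℓ) hs.1 hs.2 le_rfl

end Minimizers

/-! ### Continuation of minimizing geodesics. -/

section HopfRinow

open Filter Manifold Metric
open scoped Topology

variable {M : Type*} [MetricSpace M] [ChartedSpace Plane M]

theorem chartState_comp_add (q : M) (γ : ℝ → M) (c t : ℝ) :
    chartState q (fun s => γ (s + c)) t = chartState q γ (t + c) := by
  rw [chartState, chartState, deriv_comp_add_const (f := fun s => extChartAt (𝓡 2) q (γ s))]

variable [RiemannianBundle (fun x : M => TangentSpace (𝓡 2) x)]

theorem IsGeodesicAt.comp_add {q : M} {γ : ℝ → M} {c t : ℝ} (h : IsGeodesicAt q γ (t + c)) :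
    IsGeodesicAt q (fun s => γ (s + c)) t := by
  have ht : Tendsto (fun s : ℝ => s + c) (𝓝 t) (𝓝 (t + c)) :=
    (continuous_id.add continuous_const).tendsto t
  filter_upwards [ht.eventually h] with s hs
  have he : chartState q (fun s => γ (s + c)) = fun s => chartState q γ (s + c) :=
    funext fun s => chartState_comp_add q γ c s
  rw [he]
  exact ⟨hs.1, hs.2.1.comp_add_const s c, hs.2.2⟩

variable [IsManifold (𝓡 2) ∞ M] [IsRiemannianManifold (𝓡 2) M]
  [IsContMDiffRiemannianBundle (𝓡 2) ∞ Plane (fun x : M => TangentSpace (𝓡 2) x)]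

/-- Two curves that start at the same point with velocities `-T₁` and `T₂` diverge with speed less
than `2` if `|T₁ + T₂| < 2`. -/
theorem eventually_dist_lt (q : M) {x y : ℝ → Plane} {T₁ T₂ : Plane} (hx : HasDerivAt x T₁ 0)
    (hy : HasDerivAt y T₂ 0) (hxy : x 0 = y 0) (hxt : x 0 ∈ (extChartAt (𝓡 2) q).target)
    (hlt : chartMetric q (x 0) (T₁ + T₂) (T₁ + T₂) < 4) :
    ∀ᶠ s in 𝓝[>] (0 : ℝ),
      dist ((extChartAt (𝓡 2) q).symm (x (-s))) ((extChartAt (𝓡 2) q).symm (y s)) < 2 * s := by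
  have hLC := isLeviCivita_chart q
  obtain ⟨m, hm1, hm2⟩ := exists_between hlt
  have hm0 : 0 ≤ m := (hLC.nonneg hxt _).trans hm1.le
  have hcont : ContinuousAt (fun p : Plane × Plane => chartMetric q p.1 p.2 p.2)
      (x 0, T₁ + T₂) :=
    (((hLC.contDiffAt_metric hxt).continuousAt.comp (x := (x 0, T₁ + T₂))
      continuousAt_fst).clm_apply continuousAt_snd).clm_apply continuousAt_snd
  have hfst : ∀ᶠ p : Plane × Plane in 𝓝 (x 0, T₁ + T₂), p.1 ∈ (extChartAt (𝓡 2) q).target :=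
    (continuousAt_fst (p := (x 0, T₁ + T₂))).eventually (hLC.isOpen.mem_nhds hxt)
  have hnear : ∀ᶠ p : Plane × Plane in 𝓝 (x 0, T₁ + T₂),
      p.1 ∈ (extChartAt (𝓡 2) q).target ∧ chartMetric q p.1 p.2 p.2 < m :=
    hfst.and (hcont.eventually (gt_mem_nhds hm1))
  obtain ⟨r, hr, hball⟩ := Metric.eventually_nhds_iff_ball.1 hnear
  rw [← ball_prod_same] at hball
  have hneg : Tendsto (fun s : ℝ => -s) (𝓝[>] 0) (𝓝 0) := by
    have : Tendsto (fun s : ℝ => -s) (𝓝 0) (𝓝 0) := by simpa using (continuous_neg.tendsto (0 : ℝ))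
    exact this.mono_left nhdsWithin_le_nhds
  have hid : Tendsto (fun s : ℝ => s) (𝓝[>] 0) (𝓝 0) := nhdsWithin_le_nhds
  have e1 := (hx.continuousAt.tendsto.comp hneg).eventually (ball_mem_nhds _ hr)
  have e2 := (hy.continuousAt.tendsto.comp hid).eventually (ball_mem_nhds _ hr)
  have hd : HasDerivAt (fun s => y s - x (-s)) (T₁ + T₂) 0 := by
    have hx' : HasDerivAt x T₁ (-0) := by rwa [neg_zero]
    have := hy.fun_sub (hx'.scomp 0 (hasDerivAt_neg (0 : ℝ)))
    convert! this using 1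
    rw [neg_smul, one_smul, sub_neg_eq_add, add_comm]
  have e3 := hd.tendsto_slope_zero_right.eventually (ball_mem_nhds _ hr)
  filter_upwards [e1, e2, e3, self_mem_nhdsWithin] with s h1 h2 h3 hs0
  replace hs0 : 0 < s := hs0
  simp only [zero_add, neg_zero, hxy, sub_self, sub_zero, Function.comp_apply] at h1 h2 h3
  rw [← hxy] at h1 h2
  -- The straight segment in the chart from `x (-s)` to `y s` has velocity `s v`, and `v` tends to
  -- `T₁ + T₂`. Its length is therefore at most `s √m` with `√m < 2`.
  set v := s⁻¹ • (y s - x (-s)) with hv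
  have hsv : y s - x (-s) = s • v := by rw [hv, smul_inv_smul₀ hs0.ne']
  have hin : ∀ u ∈ Icc (0 : ℝ) 1, x (-s) + u • (s • v) ∈ ball (x 0) r := by
    intro u hu
    rw [← hsv]
    exact (convex_ball _ _).add_smul_sub_mem h1 h2 hu
  have hm : ∀ u ∈ Icc (0 : ℝ) 1, x (-s) + u • (s • v) ∈ (extChartAt (𝓡 2) q).target ∧
      chartMetric q (x (-s) + u • (s • v)) v v < m := fun u hu =>
    hball (x (-s) + u • (s • v), v) (mk_mem_prod (hin u hu) h3)
  have hcd : ContDiffOn ℝ 1 (fun u : ℝ => x (-s) + u • (s • v)) (Icc 0 1) :=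
    (contDiff_const.add (contDiff_id.smul contDiff_const)).contDiffOn
  have hspeed : ∀ u ∈ Ioo (0 : ℝ) 1, √(chartMetric q (x (-s) + u • (s • v))
      (deriv (fun u : ℝ => x (-s) + u • (s • v)) u)
      (deriv (fun u : ℝ => x (-s) + u • (s • v)) u)) ≤ s * √m := by
    intro u hu
    have hdu : HasDerivAt (fun u : ℝ => x (-s) + u • (s • v)) (s • v) u := by
      simpa using ((hasDerivAt_id u).smul_const (s • v)).const_add (x (-s))
    rw [hdu.deriv]
    have := (hm u (Ioo_subset_Icc_self hu)).2
    simp only [map_smul, smul_apply, smul_eq_mul]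
    rw [← mul_assoc, Real.sqrt_mul (by positivity), Real.sqrt_mul_self hs0.le]
    exact mul_le_mul_of_nonneg_left (Real.sqrt_le_sqrt this.le) hs0.le
  have hle := dist_le_of_chart_curve q zero_le_one (mul_nonneg hs0.le (Real.sqrt_nonneg m)) hcd
    (fun u hu => (hm u hu).1) hspeed
  have hend : x (-s) + s • v = y s := by rw [← hsv]; abel
  simp only [zero_smul, add_zero, one_smul, hend, sub_zero, mul_one] at hle
  have hm4 : √m < 2 := by
    rw [Real.sqrt_lt' (by norm_num)]
    linarith
  nlinarith

/-- A concatenation of geodesics that is minimizing near the corner has no corner. -/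
theorem IsGeodesicAt.eventuallyEq_of_le_dist {q : M} {γ σ : ℝ → M} (hγ : IsGeodesicAt q γ 0)
    (hσ : IsGeodesicAt q σ 0) (h0 : γ 0 = σ 0)
    (hmin : ∃ᶠ s in 𝓝[>] (0 : ℝ), 2 * s ≤ dist (γ (-s)) (σ s)) : γ =ᶠ[𝓝 0] σ := by
  have hLC := isLeviCivita_chart q
  refine hγ.eventuallyEq hσ ?_
  set x := fun s => (chartState q γ s).1
  set y := fun s => (chartState q σ s).1
  set T₁ := (chartState q γ 0).2 with hT₁
  set T₂ := (chartState q σ 0).2 with hT₂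
  have hxy : x 0 = y 0 := by simp only [x, y, chartState, h0]
  have hx : HasDerivAt x T₁ 0 := hγ.hasDerivAt.fst
  have hy : HasDerivAt y T₂ 0 := hσ.hasDerivAt.fst
  have hxt : x 0 ∈ (extChartAt (𝓡 2) q).target := (extChartAt (𝓡 2) q).map_source hγ.mem_source
  have hs1 : chartMetric q (x 0) T₁ T₁ = 1 := hγ.speed
  have hs2 : chartMetric q (x 0) T₂ T₂ = 1 := hxy ▸ hσ.speed
  have hsym := hLC.symm _ hxt T₁ T₂
  -- For unit vectors `|T₁ - T₂|² = 4 - |T₁ + T₂|²`, so this inequality forces `T₁ = T₂`.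
  suffices hge : 4 ≤ chartMetric q (x 0) (T₁ + T₂) (T₁ + T₂) by
    have hT : T₁ = T₂ := by
      by_contra hne
      have := hLC.pos _ hxt (T₁ - T₂) (sub_ne_zero.2 hne)
      simp only [map_add, map_sub, add_apply, sub_apply] at hge this
      linarith
    exact Prod.ext hxy hT
  by_contra! hlt
  have hneg : Tendsto (fun s : ℝ => -s) (𝓝[>] 0) (𝓝 0) := by
    have : Tendsto (fun s : ℝ => -s) (𝓝 0) (𝓝 0) := by simpa using (continuous_neg.tendsto (0 : ℝ))
    exact this.mono_left nhdsWithin_le_nhds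
  have hid : Tendsto (fun s : ℝ => s) (𝓝[>] 0) (𝓝 0) := nhdsWithin_le_nhds
  obtain ⟨s, hs, h1, h2, h3⟩ := (hmin.and_eventually ((eventually_dist_lt q hx hy hxy hxt hlt).and
    ((hneg.eventually hγ.eventually).and (hid.eventually hσ.eventually)))).exists
  have hγs : (extChartAt (𝓡 2) q).symm (x (-s)) = γ (-s) := h2.eq_symm.symm
  have hσs : (extChartAt (𝓡 2) q).symm (y s) = σ s := h3.eq_symm.symm
  rw [hγs, hσs] at h1
  exact absurd h1 (not_lt.2 hs)

/-- Extension of a minimizing geodesic. -/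
theorem exists_extension {p x : M} {γ : ℝ → M} {t η e : ℝ} (ht : 0 < t) (hη : 0 < η)
    (hγ : IsGeodesicOn γ (Ioo (-η) (t + η))) (hγ0 : γ 0 = p)
    (hγd : ∀ s ∈ Icc 0 t, dist p (γ s) = s) (hγx : dist (γ t) x = dist p x - t) {y : M}
    (he : 0 < e) (hy : dist (γ t) y = e) (hyx : dist y x = dist p x - (t + e)) {σ : ℝ → M}
    {η' : ℝ} (hη' : 0 < η') (hσ : IsGeodesicOn σ (Ioo (-η') (e + η'))) (hσ0 : σ 0 = γ t)
    (hσe : σ e = y) (hσd : ∀ s ∈ Icc 0 e, dist (γ t) (σ s) ≤ s ∧ dist (σ s) y ≤ e - s) :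
    ∃ (γ₂ : ℝ → M) (η₂ : ℝ), 0 < η₂ ∧ IsGeodesicOn γ₂ (Ioo (-η₂) (t + e + η₂)) ∧ γ₂ 0 = p ∧
      (∀ s ∈ Icc 0 (t + e), dist p (γ₂ s) = s) ∧ dist (γ₂ (t + e)) x = dist p x - (t + e) := by
  -- At most `t + s` by passing through `γ t`; at least, because continuing through `y` to `x` would
  -- otherwise be shorter than `dist p x`.
  have hpσ : ∀ s ∈ Icc 0 e, dist p (σ s) = t + s := by
    intro s hs
    obtain ⟨h1, h2⟩ := hσd s hs
    have h3 := dist_triangle p (γ t) (σ s)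
    have h4 := dist_triangle p (σ s) x
    have h5 := dist_triangle (σ s) y x
    rw [hγd t ⟨ht.le, le_rfl⟩] at h3
    linarith
  have htI : t ∈ Ioo (-η) (t + η) := ⟨by linarith, by linarith⟩
  have h0I : (0 : ℝ) ∈ Ioo (-η') (e + η') := ⟨by linarith, by linarith⟩
  obtain ⟨q, hq⟩ := hγ t htI
  have hσq : IsGeodesicAt q σ 0 := hσ.isGeodesicAt h0I (by rw [hσ0]; exact hq.mem_source)
  -- The points at time `s` before and after the corner have distances `t - s` and `t + s` from `p`,
  -- so they are at least `2s` apart.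
  have hev : (fun s => γ (s + t)) =ᶠ[𝓝 0] σ := by
    refine IsGeodesicAt.eventuallyEq_of_le_dist (q := q)
      (IsGeodesicAt.comp_add (by rwa [zero_add])) hσq (by simp [hσ0]) (Eventually.frequently ?_)
    filter_upwards [Ioo_mem_nhdsGT (lt_min ht he)] with s hs
    have hst := hs.2.trans_le (min_le_left t e)
    have hse := hs.2.trans_le (min_le_right t e)
    have h1 := dist_triangle p (γ (-s + t)) (σ s)
    rw [hpσ s ⟨hs.1.le, hse.le⟩, hγd (-s + t) ⟨by linarith, by linarith [hs.1]⟩] at h1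
    linarith
  have hev' : γ =ᶠ[𝓝 t] fun s => σ (s + -t) := by
    have h1 : Tendsto (fun s : ℝ => s + -t) (𝓝 t) (𝓝 0) := by
      have h2 : Continuous fun s : ℝ => s + -t := by fun_prop
      simpa using h2.tendsto t
    filter_upwards [h1.eventually hev] with s hs
    simpa using hs
  let γ₂ : ℝ → M := fun s => if s ≤ t then γ s else σ (s + -t)
  have hlo : ∀ s ≤ t, γ₂ s = γ s := fun s hs => if_pos hs
  have hhi : ∀ s, t ≤ s → γ₂ s = σ (s + -t) := fun s hs => by
    rcases hs.eq_or_lt with rfl | h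
    · rw [hlo t le_rfl, add_neg_cancel, hσ0]
    · exact if_neg (not_le.2 h)
  have hev₂ : ∀ s ≤ t, γ =ᶠ[𝓝 s] γ₂ := by
    intro s hs
    rcases hs.eq_or_lt with rfl | h
    · filter_upwards [hev'] with u hu
      rcases le_total u s with h | h
      · rw [hlo u h]
      · rw [hhi u h, hu]
    · filter_upwards [Iio_mem_nhds h] with u hu using (hlo u hu.le).symm
  refine ⟨γ₂, min η η', lt_min hη hη', fun s hs => ?_, by rw [hlo 0 ht.le, hγ0], fun s hs => ?_, ?_⟩
  · rcases le_or_gt s t with h | h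
    · obtain ⟨q, hq⟩ := hγ s ⟨by linarith [hs.1, min_le_left η η'], by linarith⟩
      exact ⟨q, hq.congr (hev₂ s h)⟩
    · obtain ⟨q, hq⟩ := hσ (s + -t) ⟨by linarith, by linarith [hs.2, min_le_right η η']⟩
      refine ⟨q, hq.comp_add.congr ?_⟩
      filter_upwards [Ioi_mem_nhds h] with u hu using (hhi u hu.le).symm
  · rcases le_total s t with h | h
    · rw [hlo s h, hγd s ⟨hs.1, h⟩]
    · rw [hhi s h, hpσ _ ⟨by linarith, by linarith [hs.2]⟩]
      ring
  · rw [hhi _ (by linarith), add_neg_cancel_comm, hσe, hyx]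

/-- The Hopf–Rinow theorem: any two points are joined by a minimizing geodesic. -/
theorem exists_minimizer [ProperSpace M] {p x : M} (hne : p ≠ x) :
    ∃ (γ : ℝ → M) (η : ℝ), 0 < η ∧ IsGeodesicOn γ (Ioo (-η) (dist p x + η)) ∧ γ 0 = p ∧
      γ (dist p x) = x ∧ ∀ s ∈ Icc 0 (dist p x), dist p (γ s) = s := by
  set d := dist p x with hd
  have hd0 : 0 < d := dist_pos.2 hne
  choose ρ hρ hloc using fun q : M => exists_local_minimizer q
  -- The Lebesgue number gives a step length that works at every point of the ball, so finitely many
  -- extensions reach `x`.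
  obtain ⟨δ, hδ, hleb⟩ := lebesgue_number_lemma_of_metric (isCompact_closedBall p d)
    (c := fun q : M => ball q (ρ q)) (fun _ => isOpen_ball)
    (fun q _ => mem_iUnion.2 ⟨q, mem_ball_self (hρ q)⟩)
  have hstep : ∀ P ∈ closedBall p d, ∀ Y, 0 < dist P Y → dist P Y < δ →
      ∃ (σ : ℝ → M) (η : ℝ), 0 < η ∧ IsGeodesicOn σ (Ioo (-η) (dist P Y + η)) ∧ σ 0 = P ∧
      σ (dist P Y) = Y ∧
      ∀ s ∈ Icc 0 (dist P Y), dist P (σ s) ≤ s ∧ dist (σ s) Y ≤ dist P Y - s := by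
    intro P hP Y hPY hlt
    obtain ⟨q, hq⟩ := hleb P hP
    exact hloc q P (hq (mem_ball_self hδ)) Y (hq (by rwa [mem_ball, dist_comm])) (dist_pos.1 hPY)
  -- The invariant is that `γ` minimizes from `p` and aims at `x`: the remaining distance is `d`
  -- minus the elapsed time. The index is shifted to `n + 1` because `exists_extension` needs a
  -- geodesic of positive length.
  have hind : ∀ n : ℕ, ∃ (γ : ℝ → M) (η : ℝ), 0 < η ∧
      IsGeodesicOn γ (Ioo (-η) (min ((n + 1) * (δ / 2)) d + η)) ∧ γ 0 = p ∧
      (∀ s ∈ Icc 0 (min ((n + 1) * (δ / 2)) d), dist p (γ s) = s) ∧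
      dist (γ (min ((n + 1) * (δ / 2)) d)) x = d - min ((n + 1) * (δ / 2)) d := by
    intro n
    induction n with
    | zero =>
      set t := min (((0 : ℕ) + 1) * (δ / 2)) d with ht
      have ht0 : 0 < t := by positivity
      have htd : t ≤ d := min_le_right _ _
      have htδ : t < δ := (min_le_left _ _).trans_lt (by push_cast; linarith)
      obtain ⟨y, hy, hyx⟩ := exists_dist_eq (a := p) (x := x) ht0.le htd
      obtain ⟨σ, η, hη, hσ, h0, he, hσd⟩ :=
        hstep p (mem_closedBall_self hd0.le) y (by rwa [hy]) (by rwa [hy])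
      rw [hy] at hσ he hσd
      refine ⟨σ, η, hη, hσ, h0, fun s hs => ?_, by rw [he, hyx]⟩
      obtain ⟨h1, h2⟩ := hσd s hs
      have := dist_triangle p (σ s) y
      linarith
    | succ n ih =>
      obtain ⟨γ, η, hη, hγ, hγ0, hγd, hγx⟩ := ih
      set t := min ((n + 1) * (δ / 2)) d with ht
      set t' := min (((n + 1 : ℕ) + 1) * (δ / 2)) d with ht'
      have ht0 : 0 < t := by positivity
      have htd : t ≤ d := min_le_right _ _
      have htd' : t' ≤ d := min_le_right _ _
      rcases htd.eq_or_lt with htd0 | htlt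
      · have e : t' = t := by
          rw [htd0, ht']
          refine min_eq_right ?_
          have h1 : d ≤ (n + 1) * (δ / 2) := by
            rw [← htd0, ht]
            exact min_le_left _ _
          push_cast
          nlinarith
        rw [e]
        exact ⟨γ, η, hη, hγ, hγ0, hγd, hγx⟩
      · have hteq : t = (n + 1) * (δ / 2) := by
          rcases min_choice ((n + 1) * (δ / 2)) d with h | h
          · exact h
          · rw [← ht] at h
            exact absurd h htlt.ne
        have hlt : t < t' := lt_min (by rw [hteq]; push_cast; nlinarith) htlt
        have hle : t' - t < δ := by
          have : t' ≤ ((n + 1 : ℕ) + 1) * (δ / 2) := min_le_left _ _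
          push_cast at this
          nlinarith
        obtain ⟨y, hy, hyx⟩ := exists_dist_eq (a := γ t) (x := x) (s := t' - t)
          (by linarith) (by linarith)
        obtain ⟨σ, η', hη', hσ, h0, he, hσd⟩ := hstep (γ t) (by
          rw [mem_closedBall, dist_comm, hγd t ⟨ht0.le, le_rfl⟩]
          exact htd) y (by rw [hy]; linarith) (by rwa [hy])
        rw [hy] at hσ he hσd
        have := exists_extension ht0 hη hγ hγ0 hγd hγx (sub_pos.2 hlt) hy
          (by rw [hyx, hγx]; ring) hη' hσ h0 he hσd
        rwa [add_sub_cancel] at this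
  obtain ⟨n, hn⟩ := exists_nat_gt (d / (δ / 2))
  obtain ⟨γ, η, hη, hγ, hγ0, hγd, hγx⟩ := hind n
  have hmin : min ((n + 1) * (δ / 2)) d = d := by
    refine min_eq_right ?_
    rw [div_lt_iff₀ (by positivity)] at hn
    nlinarith
  rw [hmin] at hγ hγd hγx
  exact ⟨γ, η, hη, hγ, hγ0, dist_eq_zero.1 (by rw [hγx, sub_self]), hγd⟩

end HopfRinow

/-! ### The scalar Jacobi equation. -/

section Scalar

/-- Growth of the solutions of the scalar Jacobi equation `b'' + κ b = 0`. -/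
theorem abs_le_of_jacobi {k b β κ : ℝ → ℝ} (hk : Continuous k) (hk0 : ∀ s, 0 ≤ k s)
    {t₁ t₂ A : ℝ} (h0 : 0 ≤ t₁) (h12 : t₁ ≤ t₂) (hb : ∀ s ∈ Icc t₁ t₂, HasDerivAt b (β s) s)
    (hβ : ∀ s ∈ Icc t₁ t₂, HasDerivAt β (-κ s * b s) s) (hκ : ∀ s ∈ Icc t₁ t₂, |κ s| ≤ k s)
    (hb1 : |b t₁| ≤ t₁ * A) (hβ1 : |β t₁| ≤ A) :
    |b t₂| ≤ t₂ * (A * Real.exp (∫ s in t₁..t₂, s * k s)) ∧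
      |β t₂| ≤ A * Real.exp (∫ s in t₁..t₂, s * k s) := by
  have hbc : ContinuousOn b (Icc t₁ t₂) := fun s hs => (hb s hs).continuousAt.continuousWithinAt
  have hβc : ContinuousOn β (Icc t₁ t₂) := fun s hs => (hβ s hs).continuousAt.continuousWithinAt
  -- Extending `b` by constants outside the interval makes `m` continuous on the whole line, so that
  -- its primitive `G` is differentiable everywhere.
  set m : ℝ → ℝ := fun s => k s * |IccExtend h12 ((Icc t₁ t₂).domRestrict b) s| with hm
  have hmc : Continuous m := hk.mul ((continuousOn_iff_continuous_domRestrict.1 hbc).Icc_extend').abs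
  have hm0 : ∀ s, 0 ≤ m s := fun s => mul_nonneg (hk0 s) (abs_nonneg _)
  have hmb : ∀ s ∈ Icc t₁ t₂, m s = k s * |b s| := fun s hs => by
    simp only [hm, IccExtend_of_mem h12 _ hs, domRestrict_apply]
  set G : ℝ → ℝ := fun s => A + ∫ u in t₁..s, m u with hG
  have hGd : ∀ s, HasDerivAt G (m s) s := fun s =>
    (hmc.integral_hasStrictDerivAt t₁ s).hasDerivAt.const_add A
  have hGmono : Monotone G := monotone_of_hasDerivAt_nonneg hGd hm0
  have hG1 : G t₁ = A := by simp [hG]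
  have hβG : ∀ s ∈ Icc t₁ t₂, |β s| ≤ G s := by
    have := image_norm_le_of_norm_deriv_right_le_deriv_boundary (f := β)
      (f' := fun s => -κ s * b s) hβc
      (fun s hs => (hβ s (Ico_subset_Icc_self hs)).hasDerivWithinAt) (B := G) (B' := m)
      (by rwa [hG1]) hGd (fun s hs => by
        have hs' := Ico_subset_Icc_self hs
        rw [Real.norm_eq_abs, abs_mul, abs_neg, hmb s hs']
        exact mul_le_mul_of_nonneg_right (hκ s hs') (abs_nonneg _))
    exact fun s hs => this hs
  -- The mean value inequality contributes `(s - t₁) G s` since `G` is monotone, and the initial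
  -- value at most `t₁ A ≤ t₁ G s`.
  have hbG : ∀ s ∈ Icc t₁ t₂, |b s| ≤ s * G s := by
    intro s hs
    have := norm_image_sub_le_of_norm_deriv_le_segment' (f := b) (f' := β) (a := t₁) (b := s)
      (C := G s) (fun u hu => (hb u ⟨hu.1, hu.2.trans hs.2⟩).hasDerivWithinAt)
      (fun u hu => (hβG u ⟨hu.1, hu.2.le.trans hs.2⟩).trans (hGmono hu.2.le)) s ⟨hs.1, le_rfl⟩
    have h1 : |b s| ≤ |b s - b t₁| + |b t₁| := by
      simpa using abs_add_le (b s - b t₁) (b t₁)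
    rw [Real.norm_eq_abs] at this
    have h2 : t₁ * A ≤ t₁ * G s := mul_le_mul_of_nonneg_left (hG1 ▸ hGmono hs.1) h0
    linarith
  set K : ℝ → ℝ := fun s => ∫ u in t₁..s, u * k u with hK
  have hKd : ∀ s, HasDerivAt K (s * k s) s := fun s =>
    ((continuous_id.mul hk).integral_hasStrictDerivAt t₁ s).hasDerivAt
  -- Here `G' = k |b| ≤ s k G`: the weight `s` in the integral comes from `hbG`.
  have hanti : AntitoneOn (fun s => G s * Real.exp (-K s)) (Icc t₁ t₂) := by
    have hd : ∀ s, HasDerivAt (fun s => G s * Real.exp (-K s))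
        (m s * Real.exp (-K s) + G s * (Real.exp (-K s) * -(s * k s))) s := fun s =>
      (hGd s).fun_mul (hKd s).fun_neg.exp
    refine antitoneOn_of_deriv_nonpos (convex_Icc _ _)
      (fun s _ => (hd s).continuousAt.continuousWithinAt)
      (fun s _ => (hd s).differentiableAt.differentiableWithinAt) fun s hs => ?_
    rw [interior_Icc] at hs
    have hs' := Ioo_subset_Icc_self hs
    rw [(hd s).deriv, hmb s hs']
    have h1 : k s * |b s| ≤ k s * (s * G s) := mul_le_mul_of_nonneg_left (hbG s hs') (hk0 s)
    have h2 := mul_le_mul_of_nonneg_right h1 (Real.exp_nonneg (-K s))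
    linarith
  have hfin := hanti (left_mem_Icc.2 h12) (right_mem_Icc.2 h12) h12
  have hGle : G t₂ ≤ A * Real.exp (K t₂) := by
    simp only [hG1, hK, intervalIntegral.integral_same, neg_zero, Real.exp_zero, mul_one] at hfin
    rw [Real.exp_neg, ← div_eq_mul_inv, div_le_iff₀ (Real.exp_pos _)] at hfin
    exact hfin
  have h2 := right_mem_Icc.2 h12
  exact ⟨(hbG t₂ h2).trans (mul_le_mul_of_nonneg_left hGle (h0.trans h12)), (hβG t₂ h2).trans hGle⟩

end Scalar

/-! ### Normal components of Jacobi fields; orthonormal frames. -/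

section PlaneJacobi

open Filter
open scoped Topology

variable {g : Plane → Plane →L[ℝ] Plane →L[ℝ] ℝ} {Γ : Plane → Plane →L[ℝ] Plane →L[ℝ] Plane}
  {Ω : Set Plane}

namespace IsLeviCivita

variable (h : IsLeviCivita g Γ Ω)

include h

theorem hasDerivAt_areaForm_variation {z q : ℝ → Plane × Plane} {t : ℝ} (hΩ : (z t).1 ∈ Ω)
    (hz : HasDerivAt z (spray Γ (z t)) t)
    (hq : HasDerivAt q (fderiv ℝ (spray Γ) (z t) (q t)) t) :
    HasDerivAt (fun s => areaForm g (z s).1 (q s).1 (z s).2)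
      (areaForm g (z t).1 (covDeriv Γ (z t) (q t)) (z t).2) t := by
  rw [h.fderiv_spray hΩ] at hq
  have := h.hasDerivAt_areaForm (c := fun s => (z s).1) (a := fun s => (q s).1)
    (b := fun s => (z s).2) hΩ hz.fst hq.fst hz.snd
  convert! this using 1
  simp [spray, covDeriv, areaForm, det2]

/-- Together with `hasDerivAt_areaForm_variation` this is `b'' = -κ b` for `b` the area form of the
Jacobi field and the velocity: area form and velocity are parallel, so only the field is
differentiated. -/
theorem hasDerivAt_areaForm_covDeriv {z q : ℝ → Plane × Plane} {t : ℝ} (hΩ : (z t).1 ∈ Ω)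
    (hz : HasDerivAt z (spray Γ (z t)) t)
    (hq : HasDerivAt q (fderiv ℝ (spray Γ) (z t) (q t)) t)
    (hsp : g (z t).1 (z t).2 (z t).2 = 1) :
    HasDerivAt (fun s => areaForm g (z s).1 (covDeriv Γ (z s) (q s)) (z s).2)
      (-gaussK g Γ (z t).1 * areaForm g (z t).1 (q t).1 (z t).2) t := by
  have := h.hasDerivAt_areaForm (c := fun s => (z s).1) (a := fun s => covDeriv Γ (z s) (q s))
    (b := fun s => (z s).2) hΩ hz.fst (h.hasDerivAt_covDeriv hΩ hz hq) hz.snd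
  convert! this using 1
  have h1 := h.areaForm_curvatureTensor hΩ (q t).1 (z t).2
  rw [hsp, mul_one] at h1
  rw [neg_mul, ← h1]
  simp only [spray, sub_add_cancel, neg_add_cancel]
  simp [areaForm, det2]
  ring

/-- Orthonormal frames. -/
theorem exists_orthonormal {x : Plane} (hx : x ∈ Ω) :
    ∃ e₁ e₂ : Plane, g x e₁ e₁ = 1 ∧ g x e₂ e₂ = 1 ∧ g x e₁ e₂ = 0 := by
  have hnorm : ∀ v, v ≠ 0 → g x ((√(g x v v))⁻¹ • v) ((√(g x v v))⁻¹ • v) = 1 := by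
    intro v hv
    have hp := h.pos x hx v hv
    have hs := Real.mul_self_sqrt hp.le
    have hs0 := (Real.sqrt_pos.2 hp).ne'
    simp only [map_smul, smul_apply, smul_eq_mul]
    field_simp
    nlinarith
  have h0 : stdVec 0 ≠ 0 := fun h0 => by simpa using congr($h0 0)
  set f := stdVec 1 - (g x (stdVec 0) (stdVec 1) / g x (stdVec 0) (stdVec 0)) • stdVec 0 with hf
  have hf0 : f ≠ 0 := fun h1 => by simpa [hf] using congr($h1 1)
  have hort : g x (stdVec 0) f = 0 := by
    have := (h.pos x hx _ h0).ne'
    simp only [hf, map_sub, map_smul, smul_eq_mul]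
    field_simp
    ring
  exact ⟨_, _, hnorm _ h0, hnorm f hf0, by simp [hort]⟩

theorem eq_cos_smul_add_sin_smul {x e₁ e₂ v : Plane} (hx : x ∈ Ω) (h1 : g x e₁ e₁ = 1)
    (h2 : g x e₂ e₂ = 1) (h12 : g x e₁ e₂ = 0) (hv : g x v v = 1) :
    ∃ θ ∈ Icc (-Real.pi) Real.pi, v = Real.cos θ • e₁ + Real.sin θ • e₂ := by
  have hA := h.areaForm_sq hx e₁ e₂
  rw [h1, h2, h12] at hA
  have hdet : det2 e₁ e₂ ≠ 0 := by
    intro h0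
    rw [areaForm, h0] at hA
    norm_num at hA
  obtain ⟨a, b, hab⟩ : ∃ a b : ℝ, v = a • e₁ + b • e₂ := by
    refine ⟨det2 v e₂ / det2 e₁ e₂, det2 e₁ v / det2 e₁ e₂, ?_⟩
    rw [eq_comm]
    ext i
    simp only [PiLp.add_apply, PiLp.smul_apply, smul_eq_mul]
    rw [div_mul_eq_mul_div, div_mul_eq_mul_div, ← add_div, div_eq_iff hdet]
    fin_cases i <;> simp [det2] <;> ring
  have hsq : a ^ 2 + b ^ 2 = 1 := by
    rw [hab] at hv
    simp only [map_add, map_smul, add_apply, smul_apply, smul_eq_mul, h1, h2, h12,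
      h.symm x hx e₂ e₁] at hv
    linarith
  have hn : ‖(⟨a, b⟩ : ℂ)‖ = 1 := by
    rw [Complex.norm_eq_sqrt_sq_add_sq]
    simp [hsq]
  have hne : (⟨a, b⟩ : ℂ) ≠ 0 := by
    rw [← norm_ne_zero_iff, hn]
    exact one_ne_zero
  refine ⟨Complex.arg ⟨a, b⟩, ⟨(Complex.neg_pi_lt_arg _).le, Complex.arg_le_pi _⟩, ?_⟩
  rw [Complex.cos_arg hne, Complex.sin_arg, hn, div_one, div_one, hab]

end IsLeviCivita

end PlaneJacobi

/-! ### Families of radial geodesics and their Jacobi fields in one chart. -/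

section Polar

open Filter Manifold Metric
open scoped Topology

variable {M : Type*} [MetricSpace M] [ChartedSpace Plane M]
  [RiemannianBundle (fun x : M => TangentSpace (𝓡 2) x)]

/-- Unit speed geodesics that start at `p` with velocity `v`. -/
structure IsRadial (p : M) (v : Plane) (γ : ℝ → M) (I : Set ℝ) : Prop where
  isGeodesicOn : IsGeodesicOn γ I
  isPreconnected : IsPreconnected I
  zero_mem : 0 ∈ I
  apply_zero : γ 0 = p
  chartState_zero : chartState p γ 0 = (extChartAt (𝓡 2) p p, v)

theorem IsRadial.mem {p : M} {v : Plane} {γ : ℝ → M} {I : Set ℝ} (h : IsRadial p v γ I) {s t : ℝ}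
    (hs : 0 ≤ s) (hst : s ≤ t) (ht : t ∈ I) : s ∈ I :=
  h.isPreconnected.Icc_subset h.zero_mem ht ⟨hs, hst⟩

/-- The states at time `t` of the geodesics with initial velocities `u θ` form a family that
depends smoothly on `θ` near `θ₀`. -/
def IsStateFamily (p : M) (u : ℝ → Plane) (θ₀ : ℝ) (q : M) (t : ℝ) (Z : ℝ → Plane × Plane) : Prop :=
  ContDiffAt ℝ 1 Z θ₀ ∧ ∀ᶠ θ in 𝓝 θ₀, ∀ γ I, IsRadial p (u θ) γ I → t ∈ I →
    γ t ∈ (extChartAt (𝓡 2) q).source ∧ chartState q γ t = Z θ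

/-- Bounds for a normal Jacobi field and its covariant derivative. -/
def JacobiBound (q : M) (z w : Plane × Plane) (t A : ℝ) : Prop :=
  |areaForm (chartMetric q) z.1 w.1 z.2| ≤ t * A ∧
    |areaForm (chartMetric q) z.1 (covDeriv (chartSymbol q) z w) z.2| ≤ A

variable [IsManifold (𝓡 2) ∞ M]
  [IsContMDiffRiemannianBundle (𝓡 2) ∞ Plane (fun x : M => TangentSpace (𝓡 2) x)]

/-- A geodesic follows the solution of the geodesic equation in a chart with the same state. -/
theorem IsGeodesicOn.chartState_eq_of_solution {q : M} {γ : ℝ → M} {I : Set ℝ}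
    (hγ : IsGeodesicOn γ I) (hI : IsPreconnected I) {t₁ a b : ℝ} {z : ℝ → Plane × Plane}
    (hz : ∀ s ∈ Ioo a b, (z s).1 ∈ (extChartAt (𝓡 2) q).target ∧
      HasDerivAt z (spray (chartSymbol q) (z s)) s) (ht : t₁ ∈ Ioo a b) (htI : t₁ ∈ I)
    (hq : γ t₁ ∈ (extChartAt (𝓡 2) q).source) (h1 : chartState q γ t₁ = z t₁) :
    ∀ s ∈ Ioo a b, s ∈ I → γ s ∈ (extChartAt (𝓡 2) q).source ∧ chartState q γ s = z s := by
  have hLC := isLeviCivita_chart q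
  have hγ1 := hγ.isGeodesicAt htI hq
  have hsp : ∀ s ∈ Ioo a b, chartMetric q (z s).1 (z s).2 (z s).2 = 1 := by
    intro s hs
    rw [← hγ1.speed, h1]
    exact eq_of_hasDerivAt_zero (f := fun s => chartMetric q (z s).1 (z s).2 (z s).2)
      (fun u hu => hLC.hasDerivAt_speed (hz u hu).2 (hz u hu).1) hs ht
  set σ : ℝ → M := fun s => (extChartAt (𝓡 2) q).symm (z s).1 with hσ
  have hσs : ∀ s ∈ Ioo a b, IsGeodesicAt q σ s ∧ chartState q σ s = z s := fun s hs =>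
    isGeodesicAt_of_hasDerivAt q (by
      filter_upwards [isOpen_Ioo.mem_nhds hs] with u hu
      exact ⟨(hz u hu).1, (hz u hu).2, hsp u hu⟩)
  have hev : γ =ᶠ[𝓝 t₁] σ := hγ1.eventuallyEq (hσs t₁ ht).1 (by rw [h1, (hσs t₁ ht).2])
  have hpc : IsPreconnected (Ioo a b ∩ I) :=
    (ordConnected_Ioo.inter hI.ordConnected).isPreconnected
  intro s hs hsI
  have hes := IsGeodesicOn.eqOn hpc (hγ.mono inter_subset_right)
    (fun t ht => ⟨q, (hσs t ht.1).1⟩) ⟨ht, htI⟩ hev s ⟨hs, hsI⟩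
  refine ⟨?_, ?_⟩
  · rw [hes.self_of_nhds]
    exact (hσs s hs).1.mem_source
  · rw [(chartState_congr q hes).self_of_nhds, (hσs s hs).2]

variable {p : M} {u : ℝ → Plane} {θ₀ : ℝ} {γ₀ : ℝ → M} {I₀ : Set ℝ}

omit [IsManifold (𝓡 2) ∞ M]
  [IsContMDiffRiemannianBundle (𝓡 2) ∞ Plane (fun x : M => TangentSpace (𝓡 2) x)] in
theorem IsStateFamily.apply {q : M} {t : ℝ} {Z : ℝ → Plane × Plane}
    (hZ : IsStateFamily p u θ₀ q t Z) (hγ₀ : IsRadial p (u θ₀) γ₀ I₀) (ht : t ∈ I₀) :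
    γ₀ t ∈ (extChartAt (𝓡 2) q).source ∧ chartState q γ₀ t = Z θ₀ :=
  hZ.2.self_of_nhds γ₀ I₀ hγ₀ ht

/-- Change of chart for families of geodesics. -/
theorem IsStateFamily.change {q q' : M} {t A : ℝ} {Z : ℝ → Plane × Plane}
    (hZ : IsStateFamily p u θ₀ q t Z) (hγ₀ : IsRadial p (u θ₀) γ₀ I₀) (ht : t ∈ I₀)
    (hq' : γ₀ t ∈ (extChartAt (𝓡 2) q').source) (hb : JacobiBound q (Z θ₀) (deriv Z θ₀) t A) :
    ∃ Z', IsStateFamily p u θ₀ q' t Z' ∧ JacobiBound q' (Z' θ₀) (deriv Z' θ₀) t A := by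
  have hiso := isIsometryOn_transition q q'
  have hsub : overlap q q' ⊆ (extChartAt (𝓡 2) q).target := fun _ hy => hy.1
  obtain ⟨hq, hst⟩ := hZ.apply hγ₀ ht
  have hov : (Z θ₀).1 ∈ overlap q q' := by
    rw [← hst]
    exact mem_overlap hq hq'
  refine ⟨fun θ => stateMap (transition q q') (Z θ), ⟨?_, ?_⟩, ?_⟩
  · exact ((hiso.contDiffAt_stateMap hov).of_le (by norm_cast)).comp θ₀ hZ.1
  · have hc : ∀ᶠ θ in 𝓝 θ₀, (Z θ).1 ∈ overlap q q' :=
      hZ.1.continuousAt.fst.eventually (hiso.isOpen.mem_nhds hov)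
    filter_upwards [hZ.2, hc] with θ hθ hθ' γ I hγ htI
    obtain ⟨h1, h2⟩ := hθ γ I hγ htI
    have hgeo := hγ.isGeodesicOn.isGeodesicAt htI h1
    have h3 : γ t ∈ (extChartAt (𝓡 2) q').source := by
      rw [hgeo.eq_symm, h2]
      exact hθ'.2
    exact ⟨h3, by rw [hgeo.chartState_eq h3, h2]⟩
  · have hd : HasDerivAt (fun θ => stateMap (transition q q') (Z θ))
        (fderiv ℝ (stateMap (transition q q')) (Z θ₀) (deriv Z θ₀)) θ₀ :=
      (hiso.hasFDerivAt_stateMap hov).comp_hasDerivAt θ₀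
        (hZ.1.differentiableAt (by simp)).hasDerivAt
    obtain ⟨ς, hς, harea⟩ :=
      hiso.areaForm_map (isLeviCivita_chart q) (isLeviCivita_chart q') hsub hov
    have hcov := hiso.covDeriv_stateMap (isLeviCivita_chart q) (isLeviCivita_chart q') hsub hov
      (deriv Z θ₀)
    rw [JacobiBound, hd.deriv, hcov, hiso.fderiv_stateMap hov]
    simp only [stateMap, harea, abs_mul, hς, one_mul]
    exact hb

/-- Geodesics near a given geodesic are given by a flow in a chart. -/
theorem exists_forward_flow {q : M} {k : ℝ → ℝ} (hk : Continuous k) (hk0 : ∀ s, 0 ≤ k s)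
    {t₀ L : ℝ} (hL : L ∈ I₀) (ht₀ : t₀ ∈ Icc 0 L) (hγ₀ : IsRadial p (u θ₀) γ₀ I₀)
    (hcurv : ∀ s ∈ Icc 0 L, |gaussianCurvature (γ₀ s)| ≤ k s)
    (hq : γ₀ t₀ ∈ (extChartAt (𝓡 2) q).source) :
    ∃ ε > 0, ∀ t₁ ∈ Ioo (t₀ - ε) (t₀ + ε), ∀ t₂ ∈ Ioo (t₀ - ε) (t₀ + ε), 0 ≤ t₁ → t₁ < t₂ →
      t₂ ≤ L → ∀ A Z, IsStateFamily p u θ₀ q t₁ Z → JacobiBound q (Z θ₀) (deriv Z θ₀) t₁ A →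
      ∃ (Φ : Plane × Plane → ℝ → Plane × Plane) (w : Plane × Plane),
        ContDiffAt ℝ 1 (fun x : (Plane × Plane) × ℝ => Φ x.1 x.2) (Z θ₀, t₂ - t₁) ∧
        (∀ a c : ℝ, fderiv ℝ (fun x : (Plane × Plane) × ℝ => Φ x.1 x.2) (Z θ₀, t₂ - t₁)
          (a • deriv Z θ₀, c) = a • w + c • spray (chartSymbol q) (Φ (Z θ₀) (t₂ - t₁))) ∧
        JacobiBound q (Φ (Z θ₀) (t₂ - t₁)) w t₂ (A * Real.exp (∫ s in t₁..t₂, s * k s)) ∧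
        ∀ᶠ x : ℝ × ℝ in 𝓝 (t₂, θ₀),
          (Φ (Z x.2) (x.1 - t₁)).1 ∈ (extChartAt (𝓡 2) q).target ∧
          ∀ γ I, IsRadial p (u x.2) γ I → x.1 ∈ I →
            γ x.1 ∈ (extChartAt (𝓡 2) q).source ∧ chartState q γ x.1 = Φ (Z x.2) (x.1 - t₁) := by
  have hLC := isLeviCivita_chart q
  have hI : ∀ s ∈ Icc 0 L, s ∈ I₀ := fun s hs => hγ₀.mem hs.1 hs.2 hL
  have hgeo₀ := hγ₀.isGeodesicOn.isGeodesicAt (hI t₀ ht₀) hq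
  set z₀ := chartState q γ₀ t₀ with hz₀
  have hz₀t : z₀.1 ∈ (extChartAt (𝓡 2) q).target := (extChartAt (𝓡 2) q).map_source hq
  obtain ⟨r, hr, ε, hε, Φ, A', hΦ, hΦd⟩ := exists_flow
    ((hLC.contDiffAt_spray hz₀t).of_le (m := 2) (by norm_cast))
    (continuousAt_fst.preimage_mem_nhds (hLC.isOpen.mem_nhds hz₀t))
  have hnear : ∀ᶠ t in 𝓝 t₀, chartState q γ₀ t ∈ ball z₀ r :=
    hgeo₀.hasDerivAt.continuousAt.eventually (ball_mem_nhds _ hr)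
  obtain ⟨δ, hδ, hball⟩ := Metric.eventually_nhds_iff_ball.1 hnear
  -- Any two such times differ by less than `ε`, and the state of `γ₀` at `t₁` lies in the ball
  -- where the flow is defined. The radius depends on `t₀` but not on `t₁`, `t₂` or the family.
  refine ⟨min δ (ε / 2), by positivity, ?_⟩
  intro t₁ ht₁ t₂ ht₂ h01 h12 h2L A Z hZ hJ
  have hmin1 := min_le_left δ (ε / 2)
  have hmin2 := min_le_right δ (ε / 2)
  have ht1L : t₁ ∈ Icc 0 L := ⟨h01, h12.le.trans h2L⟩
  obtain ⟨hq1, hst1⟩ := hZ.apply hγ₀ (hI t₁ ht1L)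
  have hZb : Z θ₀ ∈ ball z₀ r := by
    rw [← hst1]
    refine hball t₁ ?_
    rw [Real.ball_eq_Ioo]
    exact ⟨by linarith [ht₁.1], by linarith [ht₁.2]⟩
  have h21 : t₂ - t₁ ∈ Ioo 0 ε := ⟨sub_pos.2 h12, by linarith [ht₁.1, ht₂.2]⟩
  -- all geodesics of the family follow the flow
  have hfollow : ∀ θ, Z θ ∈ ball z₀ r → (∀ γ I, IsRadial p (u θ) γ I → t₁ ∈ I →
      γ t₁ ∈ (extChartAt (𝓡 2) q).source ∧ chartState q γ t₁ = Z θ) →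
      ∀ t, t₁ ≤ t → t - t₁ ∈ Ioo (-ε) ε → (Φ (Z θ) (t - t₁)).1 ∈ (extChartAt (𝓡 2) q).target ∧
        ∀ γ I, IsRadial p (u θ) γ I → t ∈ I →
          γ t ∈ (extChartAt (𝓡 2) q).source ∧ chartState q γ t = Φ (Z θ) (t - t₁) := by
    intro θ hθ hfam t htt ht
    obtain ⟨hΦ0, -, hΦt⟩ := hΦ _ hθ
    refine ⟨(hΦt _ ht).1, fun γ I hγ htI => ?_⟩
    have ht1I : t₁ ∈ I := hγ.mem h01 htt htI
    obtain ⟨h1, h2⟩ := hfam γ I hγ ht1I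
    have hz : ∀ s ∈ Ioo (t₁ - ε) (t₁ + ε), (Φ (Z θ) (s - t₁)).1 ∈ (extChartAt (𝓡 2) q).target ∧
        HasDerivAt (fun s => Φ (Z θ) (s - t₁)) (spray (chartSymbol q) (Φ (Z θ) (s - t₁))) s := by
      intro s hs
      have hs' : s - t₁ ∈ Ioo (-ε) ε := ⟨by linarith [hs.1], by linarith [hs.2]⟩
      exact ⟨(hΦt _ hs').1, (hΦt _ hs').2.1.comp_sub_const s t₁⟩
    exact hγ.isGeodesicOn.chartState_eq_of_solution hγ.isPreconnected hz
      ⟨by linarith, by linarith⟩ ht1I h1 (by rw [h2, sub_self, hΦ0]) t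
      ⟨by linarith [ht.1], by linarith [ht.2]⟩ htI
  obtain ⟨hcd, hstrict⟩ := hΦd _ hZb _ h21
  have hfd := hstrict.hasFDerivAt
  refine ⟨Φ, A' (Z θ₀) (t₂ - t₁) (deriv Z θ₀), hcd, fun a c => ?_, ?_, ?_⟩
  · rw [hfd.fderiv]
    simp
  · obtain ⟨hΦ0, hA0, hΦt⟩ := hΦ _ hZb
    have hin : ∀ s ∈ Icc t₁ t₂, s - t₁ ∈ Ioo (-ε) ε := fun s hs =>
      ⟨by linarith [hs.1], by linarith [hs.2, h21.2]⟩
    have hz : ∀ s ∈ Icc t₁ t₂, (Φ (Z θ₀) (s - t₁)).1 ∈ (extChartAt (𝓡 2) q).target ∧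
        HasDerivAt (fun s => Φ (Z θ₀) (s - t₁)) (spray (chartSymbol q) (Φ (Z θ₀) (s - t₁))) s :=
      fun s hs => ⟨(hΦt _ (hin s hs)).1, (hΦt _ (hin s hs)).2.1.comp_sub_const s t₁⟩
    have hw : ∀ s ∈ Icc t₁ t₂, HasDerivAt (fun s => A' (Z θ₀) (s - t₁) (deriv Z θ₀))
        (fderiv ℝ (spray (chartSymbol q)) (Φ (Z θ₀) (s - t₁))
          (A' (Z θ₀) (s - t₁) (deriv Z θ₀))) s := by
      intro s hs
      have := ((hΦt _ (hin s hs)).2.2.comp_sub_const s t₁).clm_apply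
        (hasDerivAt_const s (deriv Z θ₀))
      simpa using this
    have hon : ∀ s ∈ Icc t₁ t₂, γ₀ s ∈ (extChartAt (𝓡 2) q).source ∧
        chartState q γ₀ s = Φ (Z θ₀) (s - t₁) := fun s hs =>
      (hfollow θ₀ hZb hZ.2.self_of_nhds s hs.1 (hin s hs)).2 γ₀ I₀ hγ₀
        (hI s ⟨h01.trans hs.1, hs.2.trans h2L⟩)
    -- Applied to `b`, the area form of the Jacobi field and the velocity, and to `β`, that of its
    -- covariant derivative; the flow line coincides with `γ₀`, which supplies unit speed and the
    -- curvature bound.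
    have hres := abs_le_of_jacobi hk hk0 h01 h12.le
      (fun s hs => hLC.hasDerivAt_areaForm_variation (z := fun s => Φ (Z θ₀) (s - t₁))
        (q := fun s => A' (Z θ₀) (s - t₁) (deriv Z θ₀)) (hz s hs).1 (hz s hs).2 (hw s hs))
      (fun s hs => hLC.hasDerivAt_areaForm_covDeriv (z := fun s => Φ (Z θ₀) (s - t₁))
        (q := fun s => A' (Z θ₀) (s - t₁) (deriv Z θ₀)) (hz s hs).1 (hz s hs).2 (hw s hs) (by
          obtain ⟨h1, h2⟩ := hon s hs
          rw [← h2]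
          exact (hγ₀.isGeodesicOn.isGeodesicAt
            (hI s ⟨h01.trans hs.1, hs.2.trans h2L⟩) h1).speed))
      (fun s hs => by
        obtain ⟨h1, h2⟩ := hon s hs
        have h3 := gaussK_transition q h1
        have h4 : (Φ (Z θ₀) (s - t₁)).1 = extChartAt (𝓡 2) q (γ₀ s) := by
          rw [← h2]
          rfl
        rw [h4, h3]
        exact hcurv s ⟨h01.trans hs.1, hs.2.trans h2L⟩)
      (A := A) (by simpa [hΦ0, hA0] using hJ.1) (by simpa [hΦ0, hA0] using hJ.2)
    exact hres
  · have e1 : ∀ᶠ x : ℝ × ℝ in 𝓝 (t₂, θ₀), Z x.2 ∈ ball z₀ r :=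
      (hZ.1.continuousAt.comp (f := fun x : ℝ × ℝ => x.2) (x := (t₂, θ₀))
        continuousAt_snd).eventually (isOpen_ball.mem_nhds hZb)
    have e2 : ∀ᶠ x : ℝ × ℝ in 𝓝 (t₂, θ₀), ∀ γ I, IsRadial p (u x.2) γ I → t₁ ∈ I →
        γ t₁ ∈ (extChartAt (𝓡 2) q).source ∧ chartState q γ t₁ = Z x.2 :=
      (continuous_snd.tendsto (t₂, θ₀)).eventually hZ.2
    have e3 : ∀ᶠ x : ℝ × ℝ in 𝓝 (t₂, θ₀), x.1 - t₁ ∈ Ioo 0 ε :=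
      ((continuous_fst.sub continuous_const).tendsto (t₂, θ₀)).eventually
        (isOpen_Ioo.mem_nhds h21)
    filter_upwards [e1, e2, e3] with x h1 h2 h3
    exact hfollow x.2 h1 h2 x.1 (by linarith [h3.1]) ⟨by linarith [h3.1], h3.2⟩

end Polar

/-! ### Polar coordinates along a whole geodesic. -/

section PolarChart

open Filter Manifold Metric
open scoped Topology

variable {M : Type*} [MetricSpace M] [ChartedSpace Plane M]
  [RiemannianBundle (fun x : M => TangentSpace (𝓡 2) x)] [IsManifold (𝓡 2) ∞ M]
  [IsContMDiffRiemannianBundle (𝓡 2) ∞ Plane (fun x : M => TangentSpace (𝓡 2) x)]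
  {p : M} {u : ℝ → Plane} {θ₀ : ℝ} {γ₀ : ℝ → M} {I₀ : Set ℝ}

/-- One forward step near `t₀`, from a family given in an arbitrary chart to one in the chart at `γ₀
t₀`. That `ε` is uniform in `t₁` makes the supremum argument of `exists_stateFamily` possible. -/
theorem exists_stateFamily_step {k : ℝ → ℝ} (hk : Continuous k) (hk0 : ∀ s, 0 ≤ k s)
    {t₀ L : ℝ} (hL : L ∈ I₀) (ht₀ : t₀ ∈ Icc 0 L) (hγ₀ : IsRadial p (u θ₀) γ₀ I₀)
    (hcurv : ∀ s ∈ Icc 0 L, |gaussianCurvature (γ₀ s)| ≤ k s) :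
    ∃ ε > 0, ∀ t₁ ∈ Ioo (t₀ - ε) (t₀ + ε), ∀ t₂ ∈ Ioo (t₀ - ε) (t₀ + ε), 0 ≤ t₁ → t₁ < t₂ →
      t₂ ≤ L → ∀ A q₁ Z₁, IsStateFamily p u θ₀ q₁ t₁ Z₁ →
      JacobiBound q₁ (Z₁ θ₀) (deriv Z₁ θ₀) t₁ A →
      ∃ Z₂, IsStateFamily p u θ₀ (γ₀ t₀) t₂ Z₂ ∧ JacobiBound (γ₀ t₀) (Z₂ θ₀) (deriv Z₂ θ₀) t₂
        (A * Real.exp (∫ s in t₁..t₂, s * k s)) := by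
  have hI : ∀ s ∈ Icc 0 L, s ∈ I₀ := fun s hs => hγ₀.mem hs.1 hs.2 hL
  have hsrc : ∀ᶠ t in 𝓝 t₀, γ₀ t ∈ (extChartAt (𝓡 2) (γ₀ t₀)).source :=
    (hγ₀.isGeodesicOn.continuousAt (hI t₀ ht₀)).eventually (extChartAt_source_mem_nhds _)
  obtain ⟨δ, hδ, hball⟩ := Metric.eventually_nhds_iff_ball.1 hsrc
  obtain ⟨ε, hε, hflow⟩ := exists_forward_flow hk hk0 hL ht₀ hγ₀ hcurv (mem_extChartAt_source _)
  refine ⟨min δ ε, by positivity, fun t₁ ht₁ t₂ ht₂ h01 h12 h2L A q₁ Z₁ hZ₁ hJ₁ => ?_⟩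
  have hmin1 := min_le_left δ ε
  have hmin2 := min_le_right δ ε
  have ht₁I : t₁ ∈ I₀ := hI t₁ ⟨h01, h12.le.trans h2L⟩
  obtain ⟨Z, hZ, hJ⟩ := hZ₁.change hγ₀ ht₁I (hball t₁ (by
    rw [Real.ball_eq_Ioo]
    exact ⟨by linarith [ht₁.1], by linarith [ht₁.2]⟩)) hJ₁
  obtain ⟨Φ, w, hcd, hd, hJ₂, hev⟩ := hflow t₁ ⟨by linarith [ht₁.1], by linarith [ht₁.2]⟩
    t₂ ⟨by linarith [ht₂.1], by linarith [ht₂.2]⟩ h01 h12 h2L A Z hZ hJ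
  have hder : HasDerivAt (fun θ => Φ (Z θ) (t₂ - t₁)) w θ₀ := by
    have h1 : HasDerivAt (fun θ => (Z θ, t₂ - t₁)) (deriv Z θ₀, 0) θ₀ :=
      (hZ.1.differentiableAt (by simp)).hasDerivAt.prodMk (hasDerivAt_const _ _)
    have h2 := (hcd.differentiableAt (by simp)).hasFDerivAt.comp_hasDerivAt θ₀ h1
    have h3 := hd 1 0
    simp only [one_smul, zero_smul, add_zero] at h3
    rw [h3] at h2
    exact h2
  refine ⟨fun θ => Φ (Z θ) (t₂ - t₁), ⟨?_, ?_⟩, ?_⟩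
  · exact hcd.comp θ₀ (f := fun θ => (Z θ, t₂ - t₁)) (hZ.1.prodMk contDiffAt_const)
  · have hc : Tendsto (fun θ : ℝ => (t₂, θ)) (𝓝 θ₀) (𝓝 (t₂, θ₀)) :=
      (continuous_const.prodMk continuous_id).tendsto θ₀
    filter_upwards [hc.eventually hev] with θ hθ using hθ.2
  · rw [hder.deriv]
    exact hJ₂

/-- A continuity argument on `[0, L]`: the set of times that can be reached contains 0, its supremum
belongs to it, and a further step forward is possible unless the supremum is `L`. The exponential
factors of the steps multiply to the exponential of the full integral. -/
theorem exists_stateFamily {k : ℝ → ℝ} (hk : Continuous k) (hk0 : ∀ s, 0 ≤ k s)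
    {L : ℝ} (hL0 : 0 ≤ L) (hL : L ∈ I₀) (hγ₀ : IsRadial p (u θ₀) γ₀ I₀)
    (hcurv : ∀ s ∈ Icc 0 L, |gaussianCurvature (γ₀ s)| ≤ k s) (hu : ContDiffAt ℝ 1 u θ₀)
    (hu1 : |areaForm (chartMetric p) (extChartAt (𝓡 2) p p) (deriv u θ₀) (u θ₀)| ≤ 1) :
    ∃ q Z, IsStateFamily p u θ₀ q L Z ∧
      JacobiBound q (Z θ₀) (deriv Z θ₀) L (Real.exp (∫ s in 0..L, s * k s)) := by
  set S : Set ℝ := {t | t ∈ Icc 0 L ∧ ∃ q Z, IsStateFamily p u θ₀ q t Z ∧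
    JacobiBound q (Z θ₀) (deriv Z θ₀) t (Real.exp (∫ s in 0..t, s * k s))} with hS
  have hint : ∀ a b : ℝ, IntervalIntegrable (fun s => s * k s) volume a b := fun a b =>
    (continuous_id.mul hk).intervalIntegrable a b
  have h0 : (0 : ℝ) ∈ S := by
    refine ⟨⟨le_rfl, hL0⟩, p, fun θ => (extChartAt (𝓡 2) p p, u θ),
      ⟨contDiffAt_const.prodMk hu, Eventually.of_forall fun θ γ I hγ _ => ?_⟩, ?_⟩
    · exact ⟨by rw [hγ.apply_zero]; exact mem_extChartAt_source p, hγ.chartState_zero⟩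
    · have hd : HasDerivAt (fun θ => (extChartAt (𝓡 2) p p, u θ)) (0, deriv u θ₀) θ₀ :=
        (hasDerivAt_const _ _).prodMk (hu.differentiableAt (by simp)).hasDerivAt
      rw [JacobiBound, hd.deriv]
      simp only [covDeriv, map_zero, add_zero, intervalIntegral.integral_same, Real.exp_zero,
        mul_one]
      exact ⟨by simp [areaForm, det2], hu1⟩
  have hba : BddAbove S := ⟨L, fun t ht => ht.1.2⟩
  set T := sSup S with hT
  have hT0 : 0 ≤ T := le_csSup hba h0
  have hTL : T ≤ L := csSup_le ⟨0, h0⟩ fun t ht => ht.1.2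
  obtain ⟨ε, hε, hstep⟩ := exists_stateFamily_step hk hk0 hL ⟨hT0, hTL⟩ hγ₀ hcurv
  have hstep' : ∀ t₁ ∈ S, ∀ t₂, T - ε < t₁ → t₁ < t₂ → t₂ < T + ε → t₂ ≤ L → t₂ ∈ S := by
    rintro t₁ ⟨⟨h1, -⟩, q, Z, hZ, hJ⟩ t₂ h2 h3 h4 h5
    obtain ⟨Z₂, hZ₂, hJ₂⟩ := hstep t₁ ⟨h2, h3.trans h4⟩ t₂ ⟨h2.trans h3, h4⟩ h1 h3 h5 _ q Z hZ hJ
    refine ⟨⟨h1.trans h3.le, h5⟩, _, Z₂, hZ₂, ?_⟩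
    rwa [← Real.exp_add, intervalIntegral.integral_add_adjacent_intervals (hint _ _) (hint _ _)]
      at hJ₂
  obtain ⟨t₁, ht₁, hlt⟩ := exists_lt_of_lt_csSup ⟨0, h0⟩ (show T - ε < T by linarith)
  have hTS : T ∈ S := by
    rcases (le_csSup hba ht₁).eq_or_lt with h | h
    · rwa [hT, ← h]
    · exact hstep' t₁ ht₁ T hlt h (by linarith) hTL
  rcases hTL.eq_or_lt with h | h
  · rw [h] at hTS
    exact hTS.2
  · have h1 : min (T + ε / 2) L ∈ S := hstep' T hTS _ (by linarith) (lt_min (by linarith) h)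
      ((min_le_left _ _).trans_lt (by linarith)) (min_le_right _ _)
    have h2 := le_csSup hba h1
    have h3 : T < min (T + ε / 2) L := lt_min (by linarith) h
    linarith

/-- Geodesic polar coordinates near the end point of a geodesic, with a bound for their
Jacobian. -/
theorem exists_polar_chart {k : ℝ → ℝ} (hk : Continuous k) (hk0 : ∀ s, 0 ≤ k s)
    {x₀ : Plane} (hL0 : 0 < x₀ 0) (hL : x₀ 0 ∈ I₀) (hγ₀ : IsRadial p (u (x₀ 1)) γ₀ I₀)
    (hcurv : ∀ s ∈ Icc 0 (x₀ 0), |gaussianCurvature (γ₀ s)| ≤ k s) (hu : ContDiffAt ℝ 1 u (x₀ 1))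
    (hu1 : |areaForm (chartMetric p) (extChartAt (𝓡 2) p p) (deriv u (x₀ 1)) (u (x₀ 1))| ≤ 1) :
    ∃ (q : M) (E : Plane → Plane), ContDiffAt ℝ 1 E x₀ ∧ E x₀ ∈ (extChartAt (𝓡 2) q).target ∧
      √(gram (chartMetric q) (E x₀)) * |(fderiv ℝ E x₀).det| ≤
        x₀ 0 * Real.exp (∫ s in 0..x₀ 0, s * k s) ∧
      ∀ᶠ x in 𝓝 x₀, E x ∈ (extChartAt (𝓡 2) q).target ∧ ∀ γ I, IsRadial p (u (x 1)) γ I →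
        x 0 ∈ I → γ (x 0) = (extChartAt (𝓡 2) q).symm (E x) := by
  have hint : ∀ a b : ℝ, IntervalIntegrable (fun s => s * k s) volume a b := fun a b =>
    (continuous_id.mul hk).intervalIntegrable a b
  set L := x₀ 0 with hLdef
  set θ₀ := x₀ 1 with hθ₀
  have hI : ∀ s ∈ Icc 0 L, s ∈ I₀ := fun s hs => hγ₀.mem hs.1 hs.2 hL
  set q := γ₀ L with hq
  have hsrc : ∀ᶠ t in 𝓝 L, γ₀ t ∈ (extChartAt (𝓡 2) q).source :=
    (hγ₀.isGeodesicOn.continuousAt hL).eventually (extChartAt_source_mem_nhds _)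
  obtain ⟨δ, hδ, hball⟩ := Metric.eventually_nhds_iff_ball.1 hsrc
  obtain ⟨ε, hε, hflow⟩ :=
    exists_forward_flow hk hk0 hL ⟨hL0.le, le_rfl⟩ hγ₀ hcurv (mem_extChartAt_source q)
  -- The last step starts strictly before `L`, since the flow is known to be jointly differentiable
  -- only at positive flow times. Joint differentiability is needed here because the time varies
  -- too.
  obtain ⟨t₁, h1, h2⟩ := exists_between (show max 0 (L - min δ ε) < L from
    max_lt hL0 (by have : 0 < min δ ε := by positivity
                   linarith))
  have h01 : 0 < t₁ := (le_max_left _ _).trans_lt h1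
  have h1' : L - min δ ε < t₁ := (le_max_right _ _).trans_lt h1
  have hmin1 := min_le_left δ ε
  have hmin2 := min_le_right δ ε
  have ht₁I : t₁ ∈ I₀ := hI t₁ ⟨h01.le, h2.le⟩
  obtain ⟨q₁, Z₁, hZ₁, hJ₁⟩ := exists_stateFamily hk hk0 h01.le ht₁I hγ₀
    (fun s hs => hcurv s ⟨hs.1, hs.2.trans h2.le⟩) hu hu1
  obtain ⟨Z, hZ, hJ⟩ := hZ₁.change hγ₀ ht₁I (hball t₁ (by
    rw [Real.ball_eq_Ioo]
    exact ⟨by linarith, by linarith⟩)) hJ₁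
  obtain ⟨Φ, w, hcd, hd, hJ₂, hev⟩ := hflow t₁ ⟨by linarith, by linarith⟩
    L ⟨by linarith, by linarith⟩ h01.le h2 le_rfl _ Z hZ hJ
  rw [← Real.exp_add, intervalIntegral.integral_add_adjacent_intervals (hint _ _) (hint _ _)] at hJ₂
  let π₀ : Plane →L[ℝ] ℝ := EuclideanSpace.proj 0
  let π₁ : Plane →L[ℝ] ℝ := EuclideanSpace.proj 1
  have hcH : ContDiffAt ℝ 1 (fun x : Plane => (Z (x 1), x 0 - t₁)) x₀ :=
    (hZ.1.comp x₀ (f := fun x : Plane => x 1) π₁.contDiff.contDiffAt).prodMk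
      (π₀.contDiff.contDiffAt.sub contDiffAt_const)
  have hcE : ContDiffAt ℝ 1 (fun x : Plane => Φ (Z (x 1)) (x 0 - t₁)) x₀ :=
    hcd.comp x₀ (f := fun x : Plane => (Z (x 1), x 0 - t₁)) hcH
  have hdH : HasFDerivAt (fun x : Plane => (Z (x 1), x 0 - t₁))
      ((π₁.smulRight (deriv Z θ₀)).prod π₀) x₀ := by
    have e1 : HasFDerivAt (fun x : Plane => x 1) π₁ x₀ := π₁.hasFDerivAt
    have e2 : HasFDerivAt (fun x : Plane => x 0) π₀ x₀ := π₀.hasFDerivAt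
    have e3 : HasFDerivAt (fun x : Plane => Z (x 1)) (π₁.smulRight (deriv Z θ₀)) x₀ := by
      have := (hZ.1.differentiableAt (by simp)).hasDerivAt.hasFDerivAt.comp x₀
        (f := fun x : Plane => x 1) e1
      convert! this using 1
    exact e3.prodMk (e2.sub_const t₁)
  have hdE : HasFDerivAt (fun x : Plane => (Φ (Z (x 1)) (x 0 - t₁)).1) _ x₀ :=
    ((hcd.differentiableAt (by simp)).hasFDerivAt.comp x₀
      (f := fun x : Plane => (Z (x 1), x 0 - t₁)) hdH).fst
  have hlim : Tendsto (fun x : Plane => (x 0, x 1)) (𝓝 x₀) (𝓝 (L, θ₀)) :=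
    (π₀.continuous.prodMk π₁.continuous).tendsto x₀
  have hev' := hlim.eventually hev
  refine ⟨q, fun x => (Φ (Z (x 1)) (x 0 - t₁)).1, contDiffAt_fst.comp x₀ hcE,
    hev'.self_of_nhds.1, ?_, ?_⟩
  -- The columns of the derivative are the radial velocity and the Jacobi field, so the Jacobian
  -- weighted with `√gram` is the absolute value of their area form.
  · rw [hdE.fderiv, det_eq_det2]
    have e0 := hd 0 1
    have e1 := hd 1 0
    simp only [zero_smul, one_smul, zero_add, add_zero] at e0 e1
    simp only [ContinuousLinearMap.comp_apply, ContinuousLinearMap.prod_apply,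
      ContinuousLinearMap.smulRight_apply, ContinuousLinearMap.coe_fst']
    have p00 : π₀ (stdVec 0) = 1 := stdVec_zero_zero
    have p01 : π₀ (stdVec 1) = 0 := stdVec_one_zero
    have p10 : π₁ (stdVec 0) = 0 := stdVec_zero_one
    have p11 : π₁ (stdVec 1) = 1 := stdVec_one_one
    rw [p00, p01, p10, p11, zero_smul, one_smul, e0, e1]
    refine le_of_eq_of_le ?_ hJ₂.1
    rw [areaForm, abs_mul, abs_of_nonneg (Real.sqrt_nonneg _)]
    congr 1
    rw [← abs_neg]
    congr 1
    simp only [det2, spray]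
    ring
  · filter_upwards [hev'] with x hx
    refine ⟨hx.1, fun γ I hγ hxI => ?_⟩
    obtain ⟨h3, h4⟩ := hx.2 γ I hγ hxI
    have h5 : extChartAt (𝓡 2) q (γ (x 0)) = (Φ (Z (x 1)) (x 0 - t₁)).1 := congrArg Prod.fst h4
    rw [← h5, (extChartAt (𝓡 2) q).left_inv h3]

end PolarChart

/-! ### Area in charts and of parametrized sets. -/

section Area

open Filter
open scoped Topology

theorem measurableSet_inter_preimage_of_continuousOn {X Y : Type*} [TopologicalSpace X]
    [MeasurableSpace X] [BorelSpace X] [TopologicalSpace Y] [MeasurableSpace Y] [BorelSpace Y]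
    {f : X → Y} {s : Set X} {A : Set Y} (hf : ContinuousOn f s) (hs : MeasurableSet s)
    (hA : MeasurableSet A) : MeasurableSet (s ∩ f ⁻¹' A) := by
  have hres : Measurable (s.domRestrict f) :=
    (continuousOn_iff_continuous_domRestrict.1 hf).measurable
  convert! hs.subtype_image (hres hA) using 1
  ext x
  simp [and_comm]

variable {M : Type*} [MetricSpace M] [ChartedSpace Plane M]
  [RiemannianBundle (fun x : M => TangentSpace (𝓡 2) x)] [IsManifold (𝓡 2) ∞ M]
  [IsContMDiffRiemannianBundle (𝓡 2) ∞ Plane (fun x : M => TangentSpace (𝓡 2) x)]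
  [MeasurableSpace M] [BorelSpace M]

/-- The change of variables formula for the transition map, whose Jacobian is the ratio of the two
densities by `gram_eq`. Points of `A` outside the chart at `q'` only decrease the left side. -/
theorem chartArea_le_chartArea (q q' : M) {A : Set M} (hA : MeasurableSet A)
    (hAq : A ⊆ (extChartAt (𝓡 2) q).source) : chartArea q' A ≤ chartArea q A := by
  set T := (extChartAt (𝓡 2) q').target ∩ (extChartAt (𝓡 2) q').symm ⁻¹' A with hT
  have hiso := isIsometryOn_transition q' q
  have hTov : T ⊆ overlap q' q := fun y hy => ⟨hy.1, hAq hy.2⟩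
  have hTm : MeasurableSet T :=
    measurableSet_inter_preimage_of_continuousOn (continuousOn_extChartAt_symm q')
      (isOpen_extChartAt_target q').measurableSet hA
  have himg : transition q' q '' T ⊆
      (extChartAt (𝓡 2) q).target ∩ (extChartAt (𝓡 2) q).symm ⁻¹' A := by
    rintro _ ⟨y, hy, rfl⟩
    refine ⟨(transition_mapsTo q' q (hTov hy)).1, ?_⟩
    rw [mem_preimage, symm_transition q' q (hTov hy)]
    exact hy.2
  have hinj : InjOn (transition q' q) T := fun y hy y' hy' h => by
    rw [← transition_transition q' q (hTov hy), h, transition_transition q' q (hTov hy')]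
  rw [chartArea_apply q' hA, chartArea_apply q hA]
  refine le_trans ?_ (lintegral_mono_set himg)
  rw [lintegral_image_eq_lintegral_abs_det_fderiv_mul volume hTm
    (fun y hy => (hiso.hasFDerivAt (hTov hy)).hasFDerivWithinAt) hinj]
  refine (setLIntegral_congr_fun hTm fun y hy => ?_).le
  rw [← gram_chartMetric, ← gram_chartMetric, hiso.gram_eq (isLeviCivita_chart q) (hTov hy),
    ← det_eq_det2, Real.sqrt_mul' _ (sq_nonneg _), Real.sqrt_sq_eq_abs, mul_comm,
    ENNReal.ofReal_mul (abs_nonneg _)]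

theorem area_le_chartArea (q : M) {A : Set M} (hA : MeasurableSet A)
    (hAq : A ⊆ (extChartAt (𝓡 2) q).source) : area M A ≤ chartArea q A := by
  set S := (extChartAt (𝓡 2) q).source with hS
  have hSm : MeasurableSet S := (isOpen_extChartAt_source q).measurableSet
  -- A supremum of measures is controlled by exhibiting one common upper bound; off the chart it may
  -- be infinite, since `A` does not meet that part.
  have hle : area M ≤ (chartArea q).restrict S + (⊤ : Measure M).restrict Sᶜ := by
    refine iSup_le fun q' => Measure.le_iff.2 fun B hB => ?_
    rw [Measure.add_apply, Measure.restrict_apply hB, Measure.restrict_apply hB,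
      ← measure_inter_add_sdiff B hSm]
    exact add_le_add (chartArea_le_chartArea q q' (hB.inter hSm) inter_subset_right)
      ((le_top : chartArea q' ≤ ⊤) _)
  refine (hle A).trans_eq ?_
  rw [Measure.add_apply, Measure.restrict_apply hA, Measure.restrict_apply hA,
    inter_eq_left.2 hAq, ← sdiff_eq, sdiff_eq_empty.2 hAq, measure_empty, add_zero]

theorem area_singleton (p : M) : area M {p} = 0 := by
  refine le_antisymm ((area_le_chartArea p (measurableSet_singleton p)
    (singleton_subset_iff.2 (mem_extChartAt_source p))).trans_eq ?_) bot_le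
  rw [chartArea_apply p (measurableSet_singleton p)]
  refine setLIntegral_measure_zero _ _ (measure_mono_null (t := {extChartAt (𝓡 2) p p}) ?_
    (measure_singleton _))
  rintro y ⟨hy, hyp⟩
  have hyp' : (extChartAt (𝓡 2) p).symm y = p := hyp
  rw [mem_singleton_iff, ← (extChartAt (𝓡 2) p).right_inv hy, hyp']

/-- Upper bound for the area of the image of a differentiable parametrization. -/
theorem area_image_le (q : M) {E : Plane → Plane} {D : Set Plane} {a d : ℝ}
    (hD : MeasurableSet D) (hE : ∀ x ∈ D, DifferentiableAt ℝ E x)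
    (hEt : ∀ x ∈ D, E x ∈ (extChartAt (𝓡 2) q).target)
    (ha : ∀ x ∈ D, √(gram (chartMetric q) (E x)) < a) (hd : ∀ x ∈ D, |(fderiv ℝ E x).det| ≤ d) :
    area M ((fun x => (extChartAt (𝓡 2) q).symm (E x)) '' D) ≤
      ENNReal.ofReal a * (ENNReal.ofReal d * volume D) := by
  have hLC := isLeviCivita_chart q
  have hgc : ContinuousOn (fun y => √(gram (chartMetric q) y)) (extChartAt (𝓡 2) q).target := by
    have hc := hLC.contDiffOn_metric.continuousOn
    have he : ∀ u v : Plane, ContinuousOn (fun y => chartMetric q y u v)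
        (extChartAt (𝓡 2) q).target := fun u v =>
      (hc.clm_apply continuousOn_const).clm_apply continuousOn_const
    exact (((he _ _).mul (he _ _)).sub ((he _ _).pow 2)).sqrt
  set N := (extChartAt (𝓡 2) q).target ∩ (fun y => √(gram (chartMetric q) y)) ⁻¹' Iio a with hN
  have hNo : IsOpen N := hgc.isOpen_inter_preimage hLC.isOpen isOpen_Iio
  -- The image of `D` need not be known to be measurable, so it is replaced by a measurable hull of
  -- the same volume, cut down to the open set where the density is below `a`.
  set H := toMeasurable volume (E '' D) ∩ N with hH
  have hHm : MeasurableSet H := (measurableSet_toMeasurable _ _).inter hNo.measurableSet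
  have hEH : E '' D ⊆ H := subset_inter (subset_toMeasurable _ _) (by
    rintro _ ⟨x, hx, rfl⟩
    exact ⟨hEt x hx, ha x hx⟩)
  set A := (extChartAt (𝓡 2) q).source ∩ extChartAt (𝓡 2) q ⁻¹' H with hA
  have hAm : MeasurableSet A :=
    measurableSet_inter_preimage_of_continuousOn (continuousOn_extChartAt q)
      (isOpen_extChartAt_source q).measurableSet hHm
  have hsub : (fun x => (extChartAt (𝓡 2) q).symm (E x)) '' D ⊆ A := by
    rintro _ ⟨x, hx, rfl⟩
    refine ⟨(extChartAt (𝓡 2) q).map_target (hEt x hx), ?_⟩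
    rw [mem_preimage, (extChartAt (𝓡 2) q).right_inv (hEt x hx)]
    exact hEH (mem_image_of_mem E hx)
  have hset : (extChartAt (𝓡 2) q).target ∩ (extChartAt (𝓡 2) q).symm ⁻¹' A ⊆ H := by
    rintro y ⟨hy, -, hy'⟩
    rwa [mem_preimage, (extChartAt (𝓡 2) q).right_inv hy] at hy'
  calc area M ((fun x => (extChartAt (𝓡 2) q).symm (E x)) '' D)
      ≤ area M A := measure_mono hsub
    _ ≤ chartArea q A := area_le_chartArea q hAm inter_subset_left
    _ ≤ ∫⁻ y in H, ENNReal.ofReal √(metricCoeff q y).det := by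
        rw [chartArea_apply q hAm]
        exact lintegral_mono_set hset
    _ ≤ ∫⁻ _ in H, ENNReal.ofReal a := by
        refine setLIntegral_mono measurable_const fun y hy => ENNReal.ofReal_le_ofReal ?_
        rw [← gram_chartMetric]
        exact le_of_lt hy.2.2
    _ = ENNReal.ofReal a * volume H := setLIntegral_const _ _
    _ ≤ ENNReal.ofReal a * volume (E '' D) := by
        refine mul_le_mul_right ?_ _
        exact (measure_mono inter_subset_left).trans_eq (measure_toMeasurable _)
    _ ≤ ENNReal.ofReal a * ∫⁻ x in D, ENNReal.ofReal |(fderiv ℝ E x).det| := by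
        gcongr
        exact addHaar_image_le_lintegral_abs_det_fderiv volume hD
          fun x hx => (hE x hx).hasFDerivAt.hasFDerivWithinAt
    _ ≤ ENNReal.ofReal a * ∫⁻ _ in D, ENNReal.ofReal d := by
        refine mul_le_mul_right (setLIntegral_mono measurable_const fun x hx => ?_) _
        exact ENNReal.ofReal_le_ofReal (hd x hx)
    _ = ENNReal.ofReal a * (ENNReal.ofReal d * volume D) := by rw [setLIntegral_const]

/-- From local to global bounds for the measure of a union. -/
theorem measure_biUnion_le_of_locally {X : Type*} [MeasurableSpace X] (μ : Measure X)
    {F : Plane → Set X} {G D : Set Plane} {C : ℝ≥0∞} (hD : MeasurableSet D) (hGD : G ⊆ D)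
    (hloc : ∀ x ∈ G, ∃ W ∈ 𝓝 x, ∀ B ⊆ W, MeasurableSet B → μ (⋃ y ∈ B, F y) ≤ C * volume B) :
    μ (⋃ x ∈ G, F x) ≤ C * volume D := by
  choose! W hW hWB using hloc
  obtain ⟨t, htG, htc, hcov⟩ := TopologicalSpace.countable_cover_nhdsWithin
    (f := fun x => interior (W x)) (s := G)
    (fun x hx => mem_nhdsWithin_of_mem_nhds (interior_mem_nhds.2 (hW x hx)))
  rcases t.eq_empty_or_nonempty with rfl | hne
  · have : G = ∅ := by simpa using hcov
    simp [this]
  obtain ⟨f, rfl⟩ := htc.exists_eq_range hne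
  -- Disjoint pieces keep the constant `C`, since their volumes add up to at most the volume of `D`.
  -- Only `D` has to be measurable, not `G`.
  set B : ℕ → Set Plane := fun n => D ∩ disjointed (fun n => interior (W (f n))) n with hB
  have hBm : ∀ n, MeasurableSet (B n) := fun n =>
    hD.inter (MeasurableSet.disjointed (fun n => isOpen_interior.measurableSet) n)
  have hBW : ∀ n, B n ⊆ W (f n) := fun n =>
    inter_subset_right.trans ((disjointed_subset _ n).trans interior_subset)
  have hdisj : Pairwise (Function.onFun Disjoint B) := fun m n hmn =>
    ((disjoint_disjointed _ hmn).mono inter_subset_right inter_subset_right)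
  have hGB : G ⊆ ⋃ n, B n := by
    intro x hx
    rw [hB, ← inter_iUnion, iUnion_disjointed]
    refine ⟨hGD hx, ?_⟩
    simpa using hcov hx
  calc μ (⋃ x ∈ G, F x) ≤ μ (⋃ n, ⋃ y ∈ B n, F y) := by
        refine measure_mono (iUnion₂_subset fun x hx => ?_)
        obtain ⟨n, hn⟩ := mem_iUnion.1 (hGB hx)
        exact (subset_biUnion_of_mem (u := F) hn).trans
          (subset_iUnion (fun n => ⋃ y ∈ B n, F y) n)
    _ ≤ ∑' n, μ (⋃ y ∈ B n, F y) := measure_iUnion_le _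
    _ ≤ ∑' n, C * volume (B n) :=
        ENNReal.tsum_le_tsum fun n => hWB (f n) (htG (mem_range_self n)) (B n) (hBW n) (hBm n)
    _ = C * ∑' n, volume (B n) := ENNReal.tsum_mul_left
    _ = C * volume (⋃ n, B n) := by rw [measure_iUnion hdisj hBm]
    _ ≤ C * volume D := by
        gcongr
        exact iUnion_subset fun n => inter_subset_left

theorem volume_plane_rectangle (a b c d : ℝ) :
    volume {x : Plane | x 0 ∈ Icc a b ∧ x 1 ∈ Icc c d} =
      ENNReal.ofReal (b - a) * ENNReal.ofReal (d - c) := by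
  have hset : {x : Plane | x 0 ∈ Icc a b ∧ x 1 ∈ Icc c d} =
      (WithLp.ofLp : Plane → (Fin 2 → ℝ)) ⁻¹' Icc ![a, c] ![b, d] := by
    ext x
    simp [Pi.le_def, Fin.forall_fin_two]
    tauto
  rw [hset, (PiLp.volume_preserving_ofLp (Fin 2)).measure_preimage
    measurableSet_Icc.nullMeasurableSet, Real.volume_Icc_pi]
  simp

theorem measurableSet_plane_rectangle (a b c d : ℝ) :
    MeasurableSet {x : Plane | x 0 ∈ Icc a b ∧ x 1 ∈ Icc c d} := by
  have h : ∀ i, Measurable fun x : Plane => x i := fun i =>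
    (EuclideanSpace.proj i : Plane →L[ℝ] ℝ).continuous.measurable
  exact (h 0 measurableSet_Icc).inter (h 1 measurableSet_Icc)

end Area

/-! ### Area growth of balls. -/

section Growth

open Filter Metric
open scoped Topology

/-- Splits a strict bound for density times Jacobian at a point into separate strict bounds, each of
which persists nearby by continuity. -/
theorem exists_lt_lt_mul_lt {s t C : ℝ} (h : s * t < C) : ∃ a d, s < a ∧ t < d ∧ a * d < C := by
  have hc : Continuous fun ε : ℝ => (s + ε) * (t + ε) := by fun_prop
  have he : ∀ᶠ ε in 𝓝[>] (0 : ℝ), (s + ε) * (t + ε) < C :=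
    nhdsWithin_le_nhds ((hc.tendsto 0).eventually (gt_mem_nhds (by simpa using h)))
  obtain ⟨ε, hε, hpos⟩ := (he.and self_mem_nhdsWithin).exists
  have hpos' : 0 < ε := hpos
  exact ⟨s + ε, t + ε, by linarith, by linarith, hε⟩

variable {M : Type*} [MetricSpace M] [ChartedSpace Plane M]
  [RiemannianBundle (fun x : M => TangentSpace (𝓡 2) x)] [IsManifold (𝓡 2) ∞ M]
  [IsContMDiffRiemannianBundle (𝓡 2) ∞ Plane (fun x : M => TangentSpace (𝓡 2) x)]
  [MeasurableSpace M] [BorelSpace M]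

/-- The end points at time `x 0` of the geodesics that start at `p` with velocity `u (x 1)`. -/
def radialEndpoints (p : M) (u : ℝ → Plane) (x : Plane) : Set M :=
  {m | ∃ γ I, IsRadial p (u (x 1)) γ I ∧ x 0 ∈ I ∧ γ (x 0) = m}

/-- Local area bound in geodesic polar coordinates. -/
theorem exists_nhds_area_radialEndpoints_le {p : M} {u : ℝ → Plane} {γ₀ : ℝ → M} {I₀ : Set ℝ}
    {k : ℝ → ℝ} (hk : Continuous k) (hk0 : ∀ s, 0 ≤ k s) {x₀ : Plane} (hL0 : 0 < x₀ 0)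
    (hL : x₀ 0 ∈ I₀) (hγ₀ : IsRadial p (u (x₀ 1)) γ₀ I₀)
    (hcurv : ∀ s ∈ Icc 0 (x₀ 0), |gaussianCurvature (γ₀ s)| ≤ k s) (hu : ContDiffAt ℝ 1 u (x₀ 1))
    (hu1 : |areaForm (chartMetric p) (extChartAt (𝓡 2) p p) (deriv u (x₀ 1)) (u (x₀ 1))| ≤ 1)
    {C : ℝ} (hC : x₀ 0 * Real.exp (∫ s in 0..x₀ 0, s * k s) < C) :
    ∃ W ∈ 𝓝 x₀, ∀ B ⊆ W, MeasurableSet B →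
      area M (⋃ x ∈ B, radialEndpoints p u x) ≤ ENNReal.ofReal C * volume B := by
  obtain ⟨q, E, hE, hEt, hjac, hev⟩ := exists_polar_chart hk hk0 hL0 hL hγ₀ hcurv hu hu1
  obtain ⟨a, d, ha, hd, had⟩ := exists_lt_lt_mul_lt (hjac.trans_lt hC)
  have hLC := isLeviCivita_chart q
  have hgc : ContinuousAt (fun y => √(gram (chartMetric q) y)) (E x₀) := by
    have hc := (hLC.contDiffAt_metric hEt).continuousAt
    have he : ∀ u v : Plane, ContinuousAt (fun y => chartMetric q y u v) (E x₀) := fun u v =>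
      (hc.clm_apply continuousAt_const).clm_apply continuousAt_const
    exact (((he _ _).mul (he _ _)).sub ((he _ _).pow 2)).sqrt
  have e1 : ∀ᶠ x in 𝓝 x₀, √(gram (chartMetric q) (E x)) < a :=
    (hgc.comp hE.continuousAt).eventually (gt_mem_nhds ha)
  have e2 : ∀ᶠ x in 𝓝 x₀, |(fderiv ℝ E x).det| < d := by
    have h1 : ContinuousAt (fderiv ℝ E) x₀ :=
      (hE.fderiv_right (m := 0) (by norm_num)).continuousAt
    have h2 : ContinuousAt (fun x => |(fderiv ℝ E x).det|) x₀ :=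
      (ContinuousLinearMap.continuous_det.continuousAt.comp h1).abs
    exact h2.eventually (gt_mem_nhds hd)
  have e3 : ∀ᶠ x in 𝓝 x₀, DifferentiableAt ℝ E x :=
    (hE.eventually (by simp)).mono fun x hx => hx.differentiableAt (by simp)
  refine ⟨_, e1.and (e2.and (e3.and hev)), fun B hB hBm => ?_⟩
  have ha0 : 0 ≤ a := (Real.sqrt_nonneg _).trans ha.le
  calc area M (⋃ x ∈ B, radialEndpoints p u x)
      ≤ area M ((fun x => (extChartAt (𝓡 2) q).symm (E x)) '' B) := by
        refine measure_mono (iUnion₂_subset fun x hx => ?_)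
        rintro m ⟨γ, I, hγ, hxI, rfl⟩
        exact ⟨x, hx, ((hB hx).2.2.2.2 γ I hγ hxI).symm⟩
    _ ≤ ENNReal.ofReal a * (ENNReal.ofReal d * volume B) :=
        area_image_le q hBm (fun x hx => (hB hx).2.2.1) (fun x hx => (hB hx).2.2.2.1)
          (fun x hx => (hB hx).1) (fun x hx => (hB hx).2.1.le)
    _ ≤ ENNReal.ofReal C * volume B := by
        rw [← mul_assoc, ← ENNReal.ofReal_mul ha0]
        gcongr

variable [IsRiemannianManifold (𝓡 2) M]

/-- Area growth of the balls around the base point. -/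
theorem area_closedBall_le [CompleteSpace M] {p : M} {k : ℝ → ℝ} (hk : Continuous k)
    (hk0 : ∀ s, 0 ≤ k s) (hcurv : ∀ x : M, |gaussianCurvature x| ≤ k (dist p x)) {K : ℝ}
    (hK : ∀ t, 0 ≤ t → ∫ s in 0..t, s * k s ≤ K) {R : ℝ} (hR : 0 ≤ R) :
    area M (closedBall p R) ≤
      ENNReal.ofReal (R * Real.exp K + 1) * (ENNReal.ofReal R * ENNReal.ofReal (2 * Real.pi)) := by
  have := properSpace_of_complete M
  have hLC := isLeviCivita_chart p
  have hpt := mem_extChartAt_target (I := 𝓡 2) p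
  obtain ⟨e₁, e₂, h1, h2, h12⟩ := hLC.exists_orthonormal hpt
  set u : ℝ → Plane := fun θ => Real.cos θ • e₁ + Real.sin θ • e₂ with hu
  have hud : ∀ θ, HasDerivAt u (-Real.sin θ • e₁ + Real.cos θ • e₂) θ := fun θ =>
    ((Real.hasDerivAt_cos θ).smul_const e₁).add ((Real.hasDerivAt_sin θ).smul_const e₂)
  have huc : ContDiff ℝ 1 u :=
    (Real.contDiff_cos.smul contDiff_const).add (Real.contDiff_sin.smul contDiff_const)
  have hu1 : ∀ θ, |areaForm (chartMetric p) (extChartAt (𝓡 2) p p) (deriv u θ) (u θ)| ≤ 1 := by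
    intro θ
    rw [(hud θ).deriv, ← sq_le_one_iff_abs_le_one, hLC.areaForm_sq hpt]
    have h21 : chartMetric p (extChartAt (𝓡 2) p p) e₂ e₁ = 0 := by
      rw [hLC.symm _ hpt, h12]
    simp only [hu, map_add, map_smul, add_apply, smul_apply, smul_eq_mul, h1, h2, h12, h21]
    nlinarith [Real.sin_sq_add_cos_sq θ]
  -- The polar coordinates `(time, angle)` at which some radial geodesic minimizes up to that time.
  -- Time 0 is left out because `exists_polar_chart` needs a positive one; it only accounts for the
  -- null set `{p}`.
  set G : Set Plane := {x | (0 < x 0 ∧ x 0 ≤ R ∧ x 1 ∈ Icc (-Real.pi) Real.pi) ∧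
    ∃ γ I, IsRadial p (u (x 1)) γ I ∧ x 0 ∈ I ∧ ∀ s ∈ Icc 0 (x 0), dist p (γ s) = s} with hG
  set D : Set Plane := {x | x 0 ∈ Icc 0 R ∧ x 1 ∈ Icc (-Real.pi) Real.pi} with hD
  have hbound : area M (⋃ x ∈ G, radialEndpoints p u x) ≤
      ENNReal.ofReal (R * Real.exp K + 1) * volume D := by
    refine measure_biUnion_le_of_locally _ (measurableSet_plane_rectangle _ _ _ _)
      (fun x hx => ⟨⟨hx.1.1.le, hx.1.2.1⟩, hx.1.2.2⟩) ?_
    rintro x ⟨⟨hx0, hxR, -⟩, γ, I, hγ, hxI, hdist⟩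
    -- Minimality turns the curvature bound at distance `dist p (γ s)` into one at time `s`. The
    -- summand 1 in the constant provides the strict inequality that the local bound requires.
    refine exists_nhds_area_radialEndpoints_le hk hk0 hx0 hxI hγ (fun s hs => ?_)
      huc.contDiffAt (hu1 _) ?_
    · have := hcurv (γ s)
      rwa [hdist s hs] at this
    · have h3 : Real.exp (∫ s in 0..x 0, s * k s) ≤ Real.exp K := Real.exp_le_exp.2 (hK _ hx0.le)
      have h4 := mul_le_mul hxR h3 (Real.exp_pos _).le hR
      linarith
  have hcover : closedBall p R ⊆ {p} ∪ ⋃ x ∈ G, radialEndpoints p u x := by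
    intro x hx
    rcases eq_or_ne p x with rfl | hne
    · exact Or.inl rfl
    right
    rw [mem_closedBall, dist_comm] at hx
    obtain ⟨γ, η, hη, hγ, hγ0, hγx, hγd⟩ := exists_minimizer hne
    set L := dist p x with hL
    have hL0 : 0 < L := dist_pos.2 hne
    have m0 : (0 : ℝ) ∈ Ioo (-η) (L + η) := ⟨by linarith, by linarith⟩
    have hgeo : IsGeodesicAt p γ 0 :=
      hγ.isGeodesicAt m0 (by rw [hγ0]; exact mem_extChartAt_source p)
    have hfst : (chartState p γ 0).1 = extChartAt (𝓡 2) p p := by rw [chartState, hγ0]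
    have hsp := hgeo.speed
    rw [hfst] at hsp
    obtain ⟨θ, hθ, hv⟩ := hLC.eq_cos_smul_add_sin_smul hpt h1 h2 h12 hsp
    have hrad : IsRadial p (u θ) γ (Ioo (-η) (L + η)) :=
      ⟨hγ, isPreconnected_Ioo, m0, hγ0, Prod.ext hfst hv⟩
    have mL : L ∈ Ioo (-η) (L + η) := ⟨by linarith, by linarith⟩
    exact mem_iUnion₂.2 ⟨(!₂[L, θ] : Plane), ⟨⟨hL0, hx, hθ⟩, γ, _, hrad, mL, hγd⟩,
      γ, _, hrad, mL, hγx⟩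
  calc area M (closedBall p R) ≤ area M ({p} ∪ ⋃ x ∈ G, radialEndpoints p u x) :=
        measure_mono hcover
    _ ≤ area M {p} + area M (⋃ x ∈ G, radialEndpoints p u x) := measure_union_le _ _
    _ ≤ 0 + ENNReal.ofReal (R * Real.exp K + 1) * volume D :=
        add_le_add (area_singleton p).le hbound
    _ = _ := by
        rw [zero_add, hD, volume_plane_rectangle]
        congr 3
        · ring_nf
        · ring_nf

end Growth

end RiemannianSurface

/-! ### Passage to an arbitrary center. -/

theorem mainTheorem5 {M : Type*} [MetricSpace M] [CompleteSpace M]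
    [ChartedSpace RiemannianSurface.Plane M] [IsManifold (𝓡 2) ∞ M]
    [RiemannianBundle (fun x : M => TangentSpace (𝓡 2) x)]
    [IsContMDiffRiemannianBundle (𝓡 2) ∞ RiemannianSurface.Plane
      (fun x : M => TangentSpace (𝓡 2) x)]
    [IsRiemannianManifold (𝓡 2) M]
    [MeasurableSpace M] [BorelSpace M]
    (p₀ : M) (k : ℝ → ℝ)
    (hk_smooth : ContDiffOn ℝ 2 k (Ici 0))
    (hk_nonneg : ∀ s, 0 ≤ s → 0 ≤ k s)
    (hk_int : IntegrableOn (fun s => s * k s) (Ioi 0))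
    (hcurv : ∀ p : M, RiemannianSurface.gaussianCurvature p ≤ 0 ∧
      -k (dist p p₀) ≤ RiemannianSurface.gaussianCurvature p)
    (q : M) :
    ∃ c r₀ : ℝ, 0 < c ∧ 0 < r₀ ∧ ∀ r, r₀ ≤ r →
      RiemannianSurface.area M (Metric.closedBall q r) ≤ ENNReal.ofReal (c * r ^ 2) := by
  -- `k` is controlled on `[0, ∞)` only; composing with `max s 0` gives a continuous nonnegative
  -- function on the line with the same values there.
  have hcont : Continuous fun s => k (max s 0) :=
    hk_smooth.continuousOn.comp_continuous (continuous_id.max continuous_const)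
      fun s => le_max_right s 0
  set κ : ℝ → ℝ := fun s => k (max s 0) with hκ
  have hκ0 : ∀ s, 0 ≤ κ s := fun s => hk_nonneg _ (le_max_right s 0)
  have hκk : ∀ s, 0 ≤ s → κ s = k s := fun s hs => by simp only [hκ, max_eq_left hs]
  have hcurv' : ∀ x : M, |RiemannianSurface.gaussianCurvature x| ≤ κ (dist p₀ x) := by
    intro x
    obtain ⟨h1, h2⟩ := hcurv x
    rw [abs_of_nonpos h1, hκk _ dist_nonneg, dist_comm]
    linarith
  set K := ∫ s in Ioi 0, s * k s with hK
  have hint : ∀ t, 0 ≤ t → ∫ s in 0..t, s * κ s ≤ K := by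
    intro t ht
    rw [intervalIntegral.integral_of_le ht,
      setIntegral_congr_fun measurableSet_Ioc (g := fun s => s * k s)
        (fun s hs => by simp only [hκk s hs.1.le])]
    refine setIntegral_mono_set hk_int ?_ (Ioc_subset_Ioi_self.eventuallyLE)
    filter_upwards [ae_restrict_mem measurableSet_Ioi] with s hs
    exact mul_nonneg (le_of_lt hs) (hk_nonneg s (le_of_lt hs))
  have hpi := Real.pi_pos
  have hexp := Real.exp_pos K
  -- `r ≥ dist q p₀` puts the ball inside the one of radius `2r` about `p₀`, of area at most `(2r
  -- e^K + 1) · 2r · 2π`; `r ≥ 1` absorbs the summand 1 into `r`.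
  refine ⟨(2 * Real.exp K + 1) * (4 * Real.pi), 1 + dist q p₀, by positivity, by positivity,
    fun r hr => ?_⟩
  have hd : 0 ≤ dist q p₀ := dist_nonneg
  have hr1 : 1 ≤ r := by linarith
  have hsub : Metric.closedBall q r ⊆ Metric.closedBall p₀ (2 * r) :=
    Metric.closedBall_subset_closedBall' (by linarith)
  have h2r : 0 ≤ 2 * r := by linarith
  refine (measure_mono hsub).trans
    ((RiemannianSurface.area_closedBall_le hcont hκ0 hcurv' hint h2r).trans ?_)
  rw [← ENNReal.ofReal_mul h2r, ← ENNReal.ofReal_mul (by positivity)]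
  refine ENNReal.ofReal_le_ofReal ?_
  have h3 : 2 * r * Real.exp K + 1 ≤ (2 * Real.exp K + 1) * r := by nlinarith
  calc (2 * r * Real.exp K + 1) * (2 * r * (2 * Real.pi))
      ≤ ((2 * Real.exp K + 1) * r) * (2 * r * (2 * Real.pi)) :=
        mul_le_mul_of_nonneg_right h3 (by positivity)
    _ = (2 * Real.exp K + 1) * (4 * Real.pi) * r ^ 2 := by ring
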